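/- Let $0<s<1$, $\alpha>s-1$, $\beta>-1$, $\omega^{(a,b)}(x)=(1-x)^a(1+x)^b$, and let $q$ be a real measurable function bounded on $[-1,1]$, $\|q\|_\infty=\sup_{[-1,1]}|q|$. With the Riemann–Liouville derivatives $${}_{-1}D_x^s v(x)=\frac{d}{dx}I_-v(x),\quad I_-v(x)=\frac1{\Gamma(1-s)}\int_{-1}^x\frac{v(y)\,dy}{(x-y)^s},\qquad {}_xD_1^s v(x)=-\frac{d}{dx}I_+v(x),\quad I_+v(x)=\frac1{\Gamma(1-s)}\int_x^1\frac{v(y)\,dy}{(y-x)^s},$$ put $\phi_u=\omega^{(-\alpha+s,\beta+s)}\,{}_xD_1^su$ and $Lu=\omega^{(\alpha,-\beta)}\,{}_{-1}D_x^s\phi_u$. Let $(u,v)=\int_{-1}^1\omega^{(-\alpha,\beta)}uv\,dx$ and $\|u\|=(u,u)^{1/2}$. Say that a function $u$ on $(-1,1)$ with $\|u\|<\infty$ solves $Lu=G$ if $I_+u$ and $I_-\phi_u$ are locally absolutely continuous on $(-1,1)$, $\phi_u$ is integrable on $(-1,x)$ for each $x<1$, $Lu=G$ almost everywhere in $(-1,1)$,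 and the following boundary conditions hold: $u$ is bounded near $-1$; near $1$, $u\to0$ if $\alpha>0$, $u$ is bounded if $\alpha=0$, $\phi_u$ is bounded if $\alpha<0$; and $I_+u(x)\to0$ as $x\to1^-$, $I_-\phi_u(x)\to0$ as $x\to-1^+$ (the first of these two limits is automatic for $\alpha\ge0$, the second for $\beta\ge s-1$). An eigenpair of $Lu+(q-\lambda)u=0$ is a pair $(\lambda,u)$ with $\|u\|\neq0$ such that $u$ solves $Lu=\lambda u-qu$. For $n=0,1,2,\dots$ let $P_n^{(\alpha,\beta)}$ be the Jacobi polynomial, $\gamma_n=\int_{-1}^1 (P_n^{(\alpha,\beta)})^2\omega^{(\alpha,\beta)}dx$, and $$u_n^{(0)}(x)=\gamma_n^{-1/2}(1-x)^\alpha P_n^{(\alpha,\beta)}(x),\qquad \lambda_n^{(0)}=\frac{\Gamma(n+\alpha+1)\Gamma(n+\beta+s+1)}{\Gamma(n+\alpha-s+1)\Gamma(n+\beta+1)}.$$ The FD-method with base potential $\bar q\equiv0$ starts from $(\lambda_n^{(0)},u_n^{(0)})$ and determines $\lambda_n^{(j+1)}\in\mathbb R$ and $u_n^{(j+1)}$,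 $j=0,1,\dots$, by the requirements that $u_n^{(j+1)}$ solves (in the above sense) $$Lu_n^{(j+1)}-\lambda_n^{(0)}u_n^{(j+1)}=\sum_{p=0}^{j}\lambda_n^{(j+1-p)}u_n^{(p)}-q\,u_n^{(j)},\qquad (u_n^{(0)},u_n^{(j+1)})=0 .$$ Let $M_n=\max\{(\lambda_n^{(0)}-\lambda_{n-1}^{(0)})^{-1},(\lambda_{n+1}^{(0)}-\lambda_n^{(0)})^{-1}\}$ for $n\ge1$, $M_0=(\lambda_1^{(0)}-\lambda_0^{(0)})^{-1}$, and $r_n=4\|q\|_\infty M_n$. **Theorem.** Fix $n\ge 0$ and suppose $r_n<1$. Then $(\lambda_n^{(0)},u_n^{(0)})$ is an eigenpair for $q=0$ with $\|u_n^{(0)}\|=1$; sequences $\lambda_n^{(j)},u_n^{(j)}$ as above exist; and for all such sequences there is an eigenpair $(\lambda_n,u_n)$ of $Lu+(q-\lambda)u=0$ such that $\lambda_n=\sum_{j\ge0}\lambda_n^{(j)}$ (absolutely convergent), $u_n=\sum_{j\ge0}u_n^{(j)}$ (convergent in $\|\cdot\|$), and the approximations of rank $m$, $\overset{m}{\lambda}_n=\sum_{j=0}^m\lambda_n^{(j)}$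 and $\overset{m}{u}_n=\sum_{j=0}^m u_n^{(j)}$, satisfy for every $m\ge0$ $$|\lambda_n-\overset{m}{\lambda}_n|\le 2\|q\|_\infty\frac{r_n^m}{1-r_n}\frac{(2m-1)!!}{(2m+2)!!}\le\|q\|_\infty\frac{r_n^m}{1-r_n}\frac1{(m+1)\sqrt{\pi m}},$$ $$\|u_n-\overset{m}{u}_n\|\le 2\frac{r_n^{m+1}}{1-r_n}\frac{(2m+1)!!}{(2m+4)!!}\le\frac{r_n^{m+1}}{1-r_n}\frac1{(m+2)\sqrt{\pi(m+1)}},$$ where $(-1)!!=1$ and the last bound in the first line is for $m\ge1$. In particular, as $m\to\infty$ both errors are $o(r_n^m)$ (for $r_n=0$: they vanish for all large $m$). -/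

import Mathlib

open Set Filter Topology MeasureTheory Asymptotics
open scoped Nat

noncomputable section

namespace FracJacobi

/-- The Jacobi-type weight `ω^{(a,b)}(x) = (1-x)^a (1+x)^b`. -/
def weight (a b x : ℝ) : ℝ := (1 - x) ^ a * (1 + x) ^ b

/-- The measure `ω^{(a,b)}(x) dx` on `(-1,1)`. -/
def weightMeasure (a b : ℝ) : Measure ℝ :=
  (volume.restrict (Ioo (-1) 1)).withDensity fun x => ENNReal.ofReal (weight a b x)

/-- The scalar product `(u,v) = ∫_{-1}^1 ω^{(-α,β)} u v dx`. -/
def wInner (α β : ℝ) (u v : ℝ → ℝ) : ℝ := ∫ x, u x * v x ∂(weightMeasure (-α) β)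

/-- The norm `‖u‖ = (∫_{-1}^1 ω^{(-α,β)} u² dx)^{1/2}`. -/
def wNorm (α β : ℝ) (u : ℝ → ℝ) : ℝ := √(∫ x, u x ^ 2 ∂(weightMeasure (-α) β))

/-- `Γ(1-s)⁻¹ ∫_{-1}^x v(y) (x-y)^{-s} dy`, the left-side fractional integral of order `1-s`. -/
def leftInt (s : ℝ) (v : ℝ → ℝ) (x : ℝ) : ℝ :=
  1 / Real.Gamma (1 - s) * ∫ y in (-1)..x, v y / (x - y) ^ s

/-- `Γ(1-s)⁻¹ ∫_x^1 v(y) (y-x)^{-s} dy`, the right-side fractional integral of order `1-s`. -/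
def rightInt (s : ℝ) (v : ℝ → ℝ) (x : ℝ) : ℝ :=
  1 / Real.Gamma (1 - s) * ∫ y in x..1, v y / (y - x) ^ s

/-- The left-side Riemann-Liouville derivative of order `s ∈ (0,1)`. -/
def leftDeriv (s : ℝ) (v : ℝ → ℝ) (x : ℝ) : ℝ := deriv (leftInt s v) x

/-- The right-side Riemann-Liouville derivative of order `s ∈ (0,1)`. -/
def rightDeriv (s : ℝ) (v : ℝ → ℝ) (x : ℝ) : ℝ := -deriv (rightInt s v) x

/-- The flux `ω^{(-α+s,β+s)} D_right^s u`. -/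
def flux (α β s : ℝ) (u : ℝ → ℝ) (x : ℝ) : ℝ :=
  weight (-α + s) (β + s) x * rightDeriv s u x

/-- The operator `L u = ω^{(α,-β)} D_left^s { ω^{(-α+s,β+s)} D_right^s u }`. -/
def jacobiOp (α β s : ℝ) (u : ℝ → ℝ) (x : ℝ) : ℝ :=
  weight α (-β) x * leftDeriv s (flux α β s u) x

/-- Local absolute continuity on `(-1,1)`. -/
def LocAC (f : ℝ → ℝ) : Prop :=
  ∀ a b : ℝ, -1 < a → a ≤ b → b < 1 → AbsolutelyContinuousOnInterval f a b

/-- `u ∈ L²_ω` solves the boundary value problem `L u = G` on `(-1,1)`, where both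
Riemann-Liouville derivatives are taken in the usual sense of differentiating a locally absolutely
continuous fractional integral, and the equation holds almost everywhere.

The fields `bdd_left`, `bc_pos`, `bc_zero`, `bc_neg` are the boundary conditions
`|u(-1)| < ∞`, and `u(1) = 0` for `α > 0`, `|u(1)| < ∞` for `α = 0`, bounded flux at `1` for
`s - 1 < α < 0`.

The fields `no_sing_right` and `no_sing_left` say that `u` contains no multiple of the singular
solution `(1-x)^{s-1}` of `D_right^s u = 0`, and its flux no multiple of the singular solution
`(1+x)^{s-1}` of `D_left^s φ = 0`. They select the self-adjoint realization of `L`: the first is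
automatic for `α ≥ 0`, the second for `β ≥ s - 1`. For smaller parameters the other boundary
conditions alone do not exclude these solutions. -/
structure IsSolution (α β s : ℝ) (u G : ℝ → ℝ) : Prop where
  memLp : MemLp u 2 (weightMeasure (-α) β)
  ac_right : LocAC (rightInt s u)
  flux_integrable : ∀ x ∈ Ioo (-1 : ℝ) 1, IntervalIntegrable (flux α β s u) volume (-1) x
  ac_left : LocAC (leftInt s (flux α β s u))
  eqn : ∀ᵐ x ∂(volume.restrict (Ioo (-1 : ℝ) 1)), jacobiOp α β s u x = G x
  bdd_left : ∃ C : ℝ, ∀ᶠ x in 𝓝[>] (-1 : ℝ), |u x| ≤ C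
  bc_pos : 0 < α → Tendsto u (𝓝[<] 1) (𝓝 0)
  bc_zero : α = 0 → ∃ C : ℝ, ∀ᶠ x in 𝓝[<] (1 : ℝ), |u x| ≤ C
  bc_neg : α < 0 → ∃ C : ℝ, ∀ᶠ x in 𝓝[<] (1 : ℝ), |flux α β s u x| ≤ C
  no_sing_right : Tendsto (rightInt s u) (𝓝[<] 1) (𝓝 0)
  no_sing_left : Tendsto (leftInt s (flux α β s u)) (𝓝[>] (-1)) (𝓝 0)

/-- `(lam, u)` is an eigenpair of `L u + (q - lam) u = 0` with the boundary conditions above. -/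
def IsEigenpair (α β s : ℝ) (q : ℝ → ℝ) (lam : ℝ) (u : ℝ → ℝ) : Prop :=
  wNorm α β u ≠ 0 ∧ IsSolution α β s u (fun x => lam * u x - q x * u x)

/-- The classical Jacobi polynomial
`P_n^{(α,β)}(x) = (1/n!) ∑_k C(n,k) (n+α+β+1)_k (α+k+1)_{n-k} ((x-1)/2)^k`. -/
def jacobiP (α β : ℝ) (n : ℕ) (x : ℝ) : ℝ :=
  1 / (n ! : ℝ) * ∑ k ∈ Finset.range (n + 1),
    (n.choose k : ℝ) * (ascPochhammer ℝ k).eval (n + α + β + 1) *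
      (ascPochhammer ℝ (n - k)).eval (α + k + 1) * ((x - 1) / 2) ^ k

/-- `γ_n^{(α,β)} = ∫_{-1}^1 P_n^{(α,β)}(x)² ω^{(α,β)}(x) dx`. -/
def jacobiGamma (α β : ℝ) (n : ℕ) : ℝ := ∫ x, jacobiP α β n x ^ 2 ∂(weightMeasure α β)

/-- The normalized generalized Jacobi function `γ_n^{-1/2} (1-x)^α P_n^{(α,β)}(x)`. -/
def baseFun (α β : ℝ) (n : ℕ) (x : ℝ) : ℝ :=
  (√(jacobiGamma α β n))⁻¹ * ((1 - x) ^ α * jacobiP α β n x)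

/-- The base eigenvalues `λ_n^{(0)}`. -/
def baseEig (α β s : ℝ) (n : ℕ) : ℝ :=
  Real.Gamma (n + α + 1) * Real.Gamma (n + β + s + 1) /
    (Real.Gamma (n + α - s + 1) * Real.Gamma (n + β + 1))

/-- The reciprocal of the smallest gap next to `λ_n^{(0)}`; for `n = 0` there is only the gap
`λ_1^{(0)} - λ_0^{(0)}`. -/
def gapRecip (α β s : ℝ) : ℕ → ℝ
  | 0 => 1 / (baseEig α β s 1 - baseEig α β s 0)
  | n + 1 => max (1 / (baseEig α β s (n + 1) - baseEig α β s n))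
      (1 / (baseEig α β s (n + 2) - baseEig α β s (n + 1)))

/-- `‖q‖_∞ = sup_{x ∈ [-1,1]} |q(x)|`. -/
def supNorm (q : ℝ → ℝ) : ℝ := sSup ((fun x => |q x|) '' Icc (-1) 1)

/-- `r_n = 4 ‖q‖_∞ M_n`. -/
def ratio (α β s : ℝ) (q : ℝ → ℝ) (n : ℕ) : ℝ := 4 * supNorm q * gapRecip α β s n

/-- The right-hand side `F^{(j+1)} = ∑_{p=0}^j λ^{(j+1-p)} u^{(p)} - q u^{(j)}`. -/
def fdRhs (q : ℝ → ℝ) (lam : ℕ → ℝ) (u : ℕ → ℝ → ℝ) (j : ℕ) (x : ℝ) : ℝ :=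
  ∑ p ∈ Finset.range (j + 1), lam (j + 1 - p) * u p x - q x * u j x

/-- The sequences `λ_n^{(j)}`, `u_n^{(j)}` (`j = 0, 1, …`) are produced by the FD-method with
base potential `0` started at the `n`-th base eigenpair. -/
structure IsFDScheme (α β s : ℝ) (q : ℝ → ℝ) (n : ℕ) (lam : ℕ → ℝ) (u : ℕ → ℝ → ℝ) : Prop where
  lam_zero : lam 0 = baseEig α β s n
  u_zero : ∀ x ∈ Ioo (-1 : ℝ) 1, u 0 x = baseFun α β n x
  step : ∀ j, IsSolution α β s (u (j + 1)) (fun x => lam 0 * u (j + 1) x + fdRhs q lam u j x)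
  orth : ∀ j, wInner α β (u 0) (u (j + 1)) = 0

/-- The approximation of rank `m` to the eigenvalue. -/
def lamApprox (lam : ℕ → ℝ) (m : ℕ) : ℝ := ∑ j ∈ Finset.range (m + 1), lam j

/-- The approximation of rank `m` to the eigenfunction. -/
def uApprox (u : ℕ → ℝ → ℝ) (m : ℕ) (x : ℝ) : ℝ := ∑ j ∈ Finset.range (m + 1), u j x

end FracJacobi

end

open Set Filter Topology MeasureTheory Asymptotics
open scoped Nat

noncomputable section

namespace FracJacobi

/-! Let T be the operator `solOp`: take the left fractional integral of order s of ω^{(-α,β)}G,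
multiply by ω^{(α-s,-β-s)}, then take the right fractional integral of order s. Formally T inverts
L, and the whole argument is carried out with T.

Uniqueness. If u solves Lu = G with G in the weighted L² space, then integrating the equation from
-1, applying Abel's inversion, integrating from 1 and inverting again gives u = TG almost everywhere
(`IsSolution.ae_eq_solOp`). The limit conditions on the two fractional integrals remove the
constants of integration.

Spectrum. Fractional integration of order s maps a weighted Jacobi polynomial to a weighted Jacobi
polynomial with parameters shifted by s (`fR_jacobi`, `fL_jacobi`). The two shifts inside T cancel,
so T has the base functions as eigenfunctions with eigenvalues 1/λ_n (`solOp_baseFun`). T is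
symmetric by fractional integration by parts, the λ_n are strictly increasing, and polynomials are
determining; hence the base functions are a Hilbert basis (`exists_hilbertBasis_baseFun`). In this
basis the FD equations become the coefficientwise recursion `AbsFD`.

Convergence. Pairing with the n-th basis vector gives |λ^{(j+1)}| ≤ ‖q‖‖u^{(j)}‖, and dividing by
the spectral gaps gives ‖u^{(j+1)}‖ ≤ M‖q‖ ∑_p ‖u^{(p)}‖‖u^{(j-p)}‖. This is the Catalan recursion,
so ‖u^{(j)}‖ ≤ (M‖q‖)^j C_j (`AbsFD.norm_le`). Since C_j = 2·4^j (2j-1)!!/(2j+2)!!, the ratio r =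
4‖q‖M and the double factorials appear; Wallis' product turns them into the bounds with π. The
Cauchy product of the two series shows that the sums satisfy the eigenvalue equation coefficientwise
(`AbsFD.limit_eq`).

Return to functions. Solving the boundary value problem is a pointwise notion, while the Hilbert
space argument yields classes in L². If |G| ≤ K(1-x)^α, then TG is a genuine solution with all
boundary conditions (`isSolution_solOp`). So it has to be shown that every L² solution of LU = pU +
h, with p bounded and h bounded by a multiple of (1-x)^α, obeys such a bound itself
(`weightBounded_of_coeff`). This rests on T being arbitrarily small in the (1-x)^α-weighted sup norm
up to a multiple of an L² norm (`abs_solOp_le_small`): once finitely many modes are removed, a fixed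
point iteration converges in L² while staying bounded in the weighted sup norm. -/

/-! ### Fractional integration kernels and their convolution semigroup. -/

/-- The convolution kernel `t_+^{a-1} / Γ(a)` of fractional integration of order `a`. -/
def kap (a t : ℝ) : ℝ := if 0 < t then t ^ (a - 1) / Real.Gamma a else 0

lemma kap_of_pos {a t : ℝ} (ht : 0 < t) : kap a t = t ^ (a - 1) / Real.Gamma a := if_pos ht

lemma kap_of_nonpos {a t : ℝ} (ht : t ≤ 0) : kap a t = 0 := if_neg ht.not_gt

lemma kap_nonneg {a : ℝ} (ha : 0 < a) (t : ℝ) : 0 ≤ kap a t := by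
  unfold kap
  split_ifs with h
  · exact div_nonneg (Real.rpow_nonneg h.le _) (Real.Gamma_pos_of_pos ha).le
  · exact le_rfl

lemma kap_pos {a t : ℝ} (ha : 0 < a) (ht : 0 < t) : 0 < kap a t := by
  rw [kap_of_pos ht]
  exact div_pos (Real.rpow_pos_of_pos ht _) (Real.Gamma_pos_of_pos ha)

@[fun_prop]
lemma measurable_kap (a : ℝ) : Measurable (kap a) :=
  Measurable.ite measurableSet_Ioi (by fun_prop) measurable_const

lemma kap_one (t : ℝ) : kap 1 t = if 0 < t then 1 else 0 := by
  simp [kap]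

lemma rpow_eq_kap {a t : ℝ} (ha : 0 < a + 1) (ht : 0 < t) :
    t ^ a = Real.Gamma (a + 1) * kap (a + 1) t := by
  rw [kap_of_pos ht, mul_div_cancel₀ _ (Real.Gamma_pos_of_pos ha).ne', add_sub_cancel_right]

lemma integral_rpow_mul_rpow {a b c : ℝ} (ha : 0 < a) (hb : 0 < b) (hc : 0 < c) :
    ∫ x in (0)..c, x ^ (b - 1) * (c - x) ^ (a - 1) =
      c ^ (a + b - 1) * (Real.Gamma a * Real.Gamma b / Real.Gamma (a + b)) := by
  have h := Complex.betaIntegral_scaled b a hc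
  rw [Complex.betaIntegral_eq_Gamma_mul_div _ _ (by simpa using hb) (by simpa using ha)] at h
  have key : ((∫ x in (0)..c, x ^ (b - 1) * (c - x) ^ (a - 1) : ℝ) : ℂ) =
      ((c ^ (a + b - 1) * (Real.Gamma a * Real.Gamma b / Real.Gamma (a + b)) : ℝ) : ℂ) := by
    rw [← intervalIntegral.integral_ofReal]
    have e : ((c ^ (a + b - 1) * (Real.Gamma a * Real.Gamma b / Real.Gamma (a + b)) : ℝ) : ℂ)
        = (c : ℂ) ^ ((b : ℂ) + a - 1) *
          (Complex.Gamma b * Complex.Gamma a / Complex.Gamma (b + a)) := by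
      rw [← Complex.ofReal_add, Complex.Gamma_ofReal, Complex.Gamma_ofReal, Complex.Gamma_ofReal]
      push_cast
      rw [Complex.ofReal_cpow hc.le]
      push_cast
      rw [add_comm a b]
      ring_nf
    rw [e, ← h]
    refine intervalIntegral.integral_congr fun x hx => ?_
    rw [uIcc_of_le hc.le] at hx
    push_cast
    rw [Complex.ofReal_cpow hx.1, Complex.ofReal_cpow (sub_nonneg.2 hx.2)]
    push_cast
    rfl
  exact_mod_cast key

/-- Dividing by Γ(a) is exactly what turns the Beta integral into the semigroup law κ_a * κ_b =
κ_{a+b}. -/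
lemma integral_kap_mul_kap {a b : ℝ} (ha : 0 < a) (hb : 0 < b) (x z : ℝ) :
    ∫ y, kap a (x - y) * kap b (y - z) = kap (a + b) (x - z) := by
  rcases le_or_gt x z with h | h
  · rw [kap_of_nonpos (by linarith)]
    have : ∀ y, kap a (x - y) * kap b (y - z) = 0 := fun y => by
      rcases le_or_gt x y with h1 | h1
      · rw [kap_of_nonpos (by linarith), zero_mul]
      · rw [kap_of_nonpos (t := y - z) (by linarith), mul_zero]
    simp [this]
  · have e : (fun y => kap a (x - y) * kap b (y - z)) = indicator (Ioo z x)
        (fun y => ((y - z) ^ (b - 1) * ((x - z) - (y - z)) ^ (a - 1)) /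
          (Real.Gamma a * Real.Gamma b)) := by
      ext y
      by_cases hy : y ∈ Ioo z x
      · rw [indicator_of_mem hy, kap_of_pos (by linarith [hy.2]), kap_of_pos (by linarith [hy.1])]
        rw [sub_sub_sub_cancel_right]
        ring
      · rw [indicator_of_notMem hy]
        rcases le_or_gt x y with h1 | h1
        · rw [kap_of_nonpos (by linarith), zero_mul]
        · have : y ≤ z := by by_contra h2; exact hy ⟨not_le.1 h2, h1⟩
          rw [kap_of_nonpos (t := y - z) (by linarith), mul_zero]
    rw [e, integral_indicator measurableSet_Ioo, integral_div, ← integral_Ioc_eq_integral_Ioo,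
      ← intervalIntegral.integral_of_le h.le,
      intervalIntegral.integral_comp_sub_right
        (fun y => y ^ (b - 1) * ((x - z) - y) ^ (a - 1)), sub_self,
      integral_rpow_mul_rpow ha hb (by linarith), kap_of_pos (by linarith)]
    have h1 := (Real.Gamma_pos_of_pos ha).ne'
    have h2 := (Real.Gamma_pos_of_pos hb).ne'
    field_simp

/-- For z < x the integral has just been computed and is positive; a non-integrable function would
have integral 0 by convention. -/
lemma integrable_kap_mul_kap {a b : ℝ} (ha : 0 < a) (hb : 0 < b) (x z : ℝ) :
    Integrable fun y => kap a (x - y) * kap b (y - z) := by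
  rcases le_or_gt x z with h | h
  · have : (fun y => kap a (x - y) * kap b (y - z)) = 0 := by
      ext y
      rcases le_or_gt x y with h1 | h1
      · simp [kap_of_nonpos (show x - y ≤ 0 by linarith)]
      · simp [kap_of_nonpos (show y - z ≤ 0 by linarith)]
    rw [this]
    exact integrable_zero _ _ _
  · by_contra hn
    have := integral_kap_mul_kap ha hb x z
    rw [integral_undef hn] at this
    exact (kap_pos (add_pos ha hb) (sub_pos.2 h)).ne this

/-- Fubini's theorem for an integral operator with a measurable kernel. -/
lemma fubini_kernel {k : ℝ → ℝ → ℝ} (hk : Measurable (Function.uncurry k)) {a F : ℝ → ℝ}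
    (ha : AEStronglyMeasurable a) (hF : AEStronglyMeasurable F)
    (h1 : ∀ z, Integrable fun y => a y * k y z)
    (h2 : Integrable fun z => (∫ y, |a y * k y z|) * F z) :
    (Integrable fun y => a y * ∫ z, k y z * F z) ∧
      ∫ y, a y * ∫ z, k y z * F z = ∫ z, (∫ y, a y * k y z) * F z := by
  have hP : Integrable (fun p : ℝ × ℝ => a p.1 * k p.1 p.2 * F p.2) (volume.prod volume) := by
    have hm : AEStronglyMeasurable (fun p : ℝ × ℝ => a p.1 * k p.1 p.2 * F p.2)
        (volume.prod volume) := (ha.comp_fst.mul hk.aestronglyMeasurable).mul hF.comp_snd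
    rw [integrable_prod_iff' hm]
    refine ⟨Eventually.of_forall fun z => (h1 z).mul_const (F z), h2.norm.congr ?_⟩
    refine Eventually.of_forall fun z => ?_
    simp only [norm_mul, Real.norm_eq_abs]
    rw [integral_mul_const, abs_of_nonneg (integral_nonneg fun y => abs_nonneg _)]
    simp only [abs_mul]
  have e : ∀ y, ∫ z, a y * k y z * F z = a y * ∫ z, k y z * F z := fun y => by
    rw [← integral_const_mul]
    simp only [mul_assoc]
  refine ⟨?_, ?_⟩
  · have := hP.integral_prod_left
    simpa only [e] using this
  · have := integral_integral_swap (f := fun y z => a y * k y z * F z) hP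
    simp only [e, integral_mul_const] at this
    exact this

/-! ### Fractional integrals on the whole line: semigroup law and integration by parts. -/

/-- The left fractional integral of order `a` over the whole line. -/
def fL (a : ℝ) (f : ℝ → ℝ) (x : ℝ) : ℝ := ∫ y, kap a (x - y) * f y

/-- The right fractional integral of order `a` over the whole line. -/
def fR (a : ℝ) (f : ℝ → ℝ) (x : ℝ) : ℝ := ∫ y, kap a (y - x) * f y

lemma aestronglyMeasurable_fL {a : ℝ} {f : ℝ → ℝ} (hf : AEStronglyMeasurable f) :
    AEStronglyMeasurable (fL a f) := by
  have : AEStronglyMeasurable (fun p : ℝ × ℝ => kap a (p.1 - p.2) * f p.2)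
      (volume.prod volume) :=
    (Measurable.aestronglyMeasurable (by fun_prop)).mul hf.comp_snd
  exact this.integral_prod_right'

lemma aestronglyMeasurable_fR {a : ℝ} {f : ℝ → ℝ} (hf : AEStronglyMeasurable f) :
    AEStronglyMeasurable (fR a f) := by
  have : AEStronglyMeasurable (fun p : ℝ × ℝ => kap a (p.2 - p.1) * f p.2)
      (volume.prod volume) :=
    (Measurable.aestronglyMeasurable (by fun_prop)).mul hf.comp_snd
  exact this.integral_prod_right'

/-- The kernels are nonnegative and convolve to the kernel of order a + b, so integrability at order
a + b is already the absolute integrability on the product that Fubini needs. -/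
lemma fL_fL {a b : ℝ} (ha : 0 < a) (hb : 0 < b) {f : ℝ → ℝ} (hf : AEStronglyMeasurable f) {x : ℝ}
    (hi : Integrable fun z => kap (a + b) (x - z) * f z) :
    (Integrable fun y => kap a (x - y) * fL b f y) ∧ fL a (fL b f) x = fL (a + b) f x := by
  have e : ∀ z, ∫ y, |kap a (x - y) * kap b (y - z)| = kap (a + b) (x - z) := fun z => by
    simp only [abs_of_nonneg (mul_nonneg (kap_nonneg ha _) (kap_nonneg hb _)),
      integral_kap_mul_kap ha hb]
  have := fubini_kernel (k := fun y z => kap b (y - z)) (by fun_prop)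
    (a := fun y => kap a (x - y)) (F := f) (Measurable.aestronglyMeasurable (by fun_prop)) hf
    (fun z => integrable_kap_mul_kap ha hb x z) (by simpa only [e] using hi)
  simp only [integral_kap_mul_kap ha hb] at this
  exact this

lemma fR_fR {a b : ℝ} (ha : 0 < a) (hb : 0 < b) {f : ℝ → ℝ} (hf : AEStronglyMeasurable f) {x : ℝ}
    (hi : Integrable fun z => kap (a + b) (z - x) * f z) :
    (Integrable fun y => kap a (y - x) * fR b f y) ∧ fR a (fR b f) x = fR (a + b) f x := by
  have e0 : ∀ z, ∫ y, kap a (y - x) * kap b (z - y) = kap (a + b) (z - x) := fun z => by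
    rw [add_comm, ← integral_kap_mul_kap hb ha]
    simp only [mul_comm]
  have e : ∀ z, ∫ y, |kap a (y - x) * kap b (z - y)| = kap (a + b) (z - x) := fun z => by
    simp only [abs_of_nonneg (mul_nonneg (kap_nonneg ha _) (kap_nonneg hb _)), e0]
  have := fubini_kernel (k := fun y z => kap b (z - y)) (by fun_prop)
    (a := fun y => kap a (y - x)) (F := f) (Measurable.aestronglyMeasurable (by fun_prop)) hf
    (fun z => by simpa only [mul_comm] using integrable_kap_mul_kap hb ha z x)
    (by simpa only [e] using hi)
  simp only [e0] at this
  exact this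

/-- Fractional integration by parts. -/
lemma integral_mul_fL {a : ℝ} (ha : 0 < a) {f g : ℝ → ℝ} (hf : AEStronglyMeasurable f)
    (hg : AEStronglyMeasurable g) (h1 : ∀ z, Integrable fun y => kap a (y - z) * f y)
    (h2 : Integrable fun z => fR a (fun y => |f y|) z * g z) :
    (Integrable fun y => f y * fL a g y) ∧ ∫ y, f y * fL a g y = ∫ z, fR a f z * g z := by
  have := fubini_kernel (k := fun y z => kap a (y - z)) (by fun_prop) hf hg
    (fun z => by simpa only [mul_comm] using h1 z) (by
      refine h2.congr (Eventually.of_forall fun z => ?_)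
      simp only [fR, abs_mul, abs_of_nonneg (kap_nonneg ha _), mul_comm])
  refine ⟨this.1, this.2.trans ?_⟩
  simp only [fR, mul_comm]

/-- Fractional integration by parts, with the integrability condition on the other side. -/
lemma integral_mul_fR {a : ℝ} (ha : 0 < a) {f g : ℝ → ℝ} (hf : AEStronglyMeasurable f)
    (hg : AEStronglyMeasurable g) (h1 : ∀ z, Integrable fun y => kap a (z - y) * f y)
    (h2 : Integrable fun z => fL a (fun y => |f y|) z * g z) :
    (Integrable fun y => f y * fR a g y) ∧ ∫ y, f y * fR a g y = ∫ z, fL a f z * g z := by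
  have := fubini_kernel (k := fun y z => kap a (z - y)) (by fun_prop) hf hg
    (fun z => by simpa only [mul_comm] using h1 z) (by
      refine h2.congr (Eventually.of_forall fun z => ?_)
      simp only [fL, abs_mul, abs_of_nonneg (kap_nonneg ha _), mul_comm])
  refine ⟨this.1, this.2.trans ?_⟩
  simp only [fL, mul_comm]

lemma kap_one_mul (x : ℝ) (f : ℝ → ℝ) : (fun z => kap 1 (x - z) * f z) = indicator (Iio x) f := by
  ext z
  by_cases h : z < x <;> simp [kap_one, h]

lemma integrable_kap_one_iff {x : ℝ} {f : ℝ → ℝ} :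
    (Integrable fun z => kap 1 (x - z) * f z) ↔ IntegrableOn f (Iio x) := by
  rw [kap_one_mul, integrable_indicator_iff measurableSet_Iio]

lemma fL_one (f : ℝ → ℝ) (x : ℝ) : fL 1 f x = ∫ z in Iic x, f z := by
  rw [fL, kap_one_mul, integral_indicator measurableSet_Iio, integral_Iic_eq_integral_Iio]

lemma kap_one_mul' (x : ℝ) (f : ℝ → ℝ) : (fun z => kap 1 (z - x) * f z) = indicator (Ioi x) f := by
  ext z
  by_cases h : x < z <;> simp [kap_one, h]

lemma integrable_kap_one_iff' {x : ℝ} {f : ℝ → ℝ} :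
    (Integrable fun z => kap 1 (z - x) * f z) ↔ IntegrableOn f (Ioi x) := by
  rw [kap_one_mul', integrable_indicator_iff measurableSet_Ioi]

lemma fR_one (f : ℝ → ℝ) (x : ℝ) : fR 1 f x = ∫ z in Ioi x, f z := by
  rw [fR, kap_one_mul', integral_indicator measurableSet_Ioi]

lemma fL_congr_lt {a x : ℝ} {f g : ℝ → ℝ} (h : ∀ y < x, f y = g y) : fL a f x = fL a g x := by
  refine integral_congr_ae (Eventually.of_forall fun y => ?_)
  rcases lt_or_ge y x with hy | hy
  · simp only [h y hy]
  · simp only [kap_of_nonpos (sub_nonpos.2 hy), zero_mul]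

lemma fR_congr_gt {a x : ℝ} {f g : ℝ → ℝ} (h : ∀ y, x < y → f y = g y) :
    fR a f x = fR a g x := by
  refine integral_congr_ae (Eventually.of_forall fun y => ?_)
  rcases lt_or_ge x y with hy | hy
  · simp only [h y hy]
  · simp only [kap_of_nonpos (sub_nonpos.2 hy), zero_mul]

lemma fL_congr_ae {a : ℝ} {f g : ℝ → ℝ} (h : f =ᵐ[volume] g) : fL a f = fL a g := by
  ext x
  refine integral_congr_ae ?_
  filter_upwards [h] with y hy
  rw [hy]

lemma fR_eq_fL_neg (a : ℝ) (f : ℝ → ℝ) (x : ℝ) : fR a f x = fL a (fun y => f (-y)) (-x) := by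
  rw [fR, fL, ← integral_neg_eq_self]
  refine integral_congr_ae (Eventually.of_forall fun y => ?_)
  simp only
  rw [neg_sub_comm]

/-! ### Abel's inversion. -/

/-- The half line is exhausted by countably many bounded intervals. On each of them Lebesgue's
differentiation theorem identifies h almost everywhere with the derivative of a primitive that
vanishes. -/
lemma ae_eq_zero_of_forall_intervalIntegral {h : ℝ → ℝ} {c : ℝ}
    (hi : ∀ a b, a ≤ b → b < c → IntervalIntegrable h volume a b)
    (h0 : ∀ a b, a ≤ b → b < c → ∫ x in a..b, h x = 0) : ∀ᵐ x, x < c → h x = 0 := by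
  have key : ∀ n : ℕ, ∀ᵐ x, x ∈ Ioo (c - (n + 1)) (c - 1 / (n + 1)) → h x = 0 := by
    intro n
    have hn : (c - (n + 1) : ℝ) ≤ c - 1 / (n + 1) := by
      have : (1 : ℝ) / (n + 1) ≤ 1 := by
        rw [div_le_one (by positivity)]
        linarith [(Nat.cast_nonneg n : (0 : ℝ) ≤ n)]
      linarith [(Nat.cast_nonneg n : (0 : ℝ) ≤ n)]
    have hlt : (c - 1 / (n + 1) : ℝ) < c := by
      have : (0 : ℝ) < 1 / (n + 1) := by positivity
      linarith
    filter_upwards [(hi _ _ hn hlt).ae_hasDerivAt_integral] with x hx hxm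
    have hd := hx (by rw [uIcc_of_le hn]; exact Ioo_subset_Icc_self hxm) _ left_mem_uIcc
    refine hd.unique ((hasDerivAt_const x (0 : ℝ)).congr_of_eventuallyEq ?_)
    filter_upwards [isOpen_Ioo.mem_nhds hxm] with y hy
    exact h0 _ _ hy.1.le (hy.2.trans hlt)
  filter_upwards [ae_all_iff.2 key] with x hx hxc
  obtain ⟨n, hn⟩ := exists_nat_gt (max (c - x) (1 / (c - x)))
  have h1 : c - x < n := (le_max_left _ _).trans_lt hn
  have h2 : 1 / (c - x) < n := (le_max_right _ _).trans_lt hn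
  refine hx n ⟨by linarith, ?_⟩
  have hcx : 0 < c - x := by linarith
  have : 1 / ((n : ℝ) + 1) < c - x := by
    rw [div_lt_comm₀ (by positivity) hcx]
    linarith
  linarith

/-- Abel's inversion on a left half line. -/
lemma abel_fL {s c : ℝ} (hs0 : 0 < s) (hs1 : s < 1) {f g : ℝ → ℝ} (hf : AEStronglyMeasurable f)
    (hg : AEStronglyMeasurable g) (hfi : ∀ x < c, IntegrableOn f (Iio x))
    (hgi : ∀ x < c, Integrable fun z => kap (1 + s) (x - z) * g z)
    (h : ∀ x < c, fL (1 - s) f x = fL 1 g x) : ∀ᵐ x, x < c → f x = fL s g x := by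
  have hint : ∀ x < c, IntegrableOn (fL s g) (Iio x) := fun x hx =>
    integrable_kap_one_iff.1 (fL_fL one_pos hs0 hg (hgi x hx)).1
  -- Applying the integral of order s to the hypothesis gives I^1 f = I^{1+s} g = I^1 (I^s g), so f
  -- and I^s g have the same primitive.
  have heq : ∀ x < c, ∫ z in Iic x, f z = ∫ z in Iic x, fL s g z := fun x hx => by
    have h1 := (fL_fL (a := s) (b := 1 - s) hs0 (by linarith) hf (x := x)
      (by rw [add_sub_cancel]; exact integrable_kap_one_iff.2 (hfi x hx))).2
    have h2 := (fL_fL (a := s) (b := 1) hs0 one_pos hg (x := x)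
      (by rw [add_comm]; exact hgi x hx)).2
    have h3 := (fL_fL (a := 1) (b := s) one_pos hs0 hg (hgi x hx)).2
    rw [add_sub_cancel] at h1
    rw [← fL_one, ← fL_one, ← h1, h3, add_comm, ← h2]
    exact fL_congr_lt fun y hy => h y (hy.trans hx)
  have hsub : ∀ x < c, IntegrableOn (fun z => f z - fL s g z) (Iic x) := fun x hx => by
    rw [integrableOn_Iic_iff_integrableOn_Iio]
    exact (hfi x hx).sub (hint x hx)
  have := ae_eq_zero_of_forall_intervalIntegral (h := fun z => f z - fL s g z) (c := c)
    (fun a b hab hb => (intervalIntegrable_iff_integrableOn_Ioc_of_le hab).2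
      ((hsub b hb).mono_set Ioc_subset_Iic_self))
    (fun a b hab hb => by
      have ha : a < c := hab.trans_lt hb
      have e : ∀ x < c, ∫ z in Iic x, (f z - fL s g z) = 0 := fun x hx => by
        have i1 : IntegrableOn f (Iic x) := by
          rw [integrableOn_Iic_iff_integrableOn_Iio]; exact hfi x hx
        have i2 : IntegrableOn (fL s g) (Iic x) := by
          rw [integrableOn_Iic_iff_integrableOn_Iio]; exact hint x hx
        rw [integral_sub i1 i2, heq x hx, sub_self]
      rw [← intervalIntegral.integral_Iic_sub_Iic (hsub a ha) (hsub b hb), e a ha, e b hb,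
        sub_self])
  filter_upwards [this] with x hx hxc
  exact sub_eq_zero.1 (hx hxc)

/-- Abel's inversion on a right half line. -/
lemma abel_fR {s c : ℝ} (hs0 : 0 < s) (hs1 : s < 1) {f g : ℝ → ℝ} (hf : AEStronglyMeasurable f)
    (hg : AEStronglyMeasurable g) (hfi : ∀ x, c < x → IntegrableOn f (Ioi x))
    (hgi : ∀ x, c < x → Integrable fun z => kap (1 + s) (z - x) * g z)
    (h : ∀ x, c < x → fR (1 - s) f x = fR 1 g x) : ∀ᵐ x, c < x → f x = fR s g x := by
  -- The reflection x ↦ -x reduces the claim to `abel_fL` with endpoint -c.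
  have hneg := Measure.measurePreserving_neg (volume : Measure ℝ)
  have hset : ∀ f' : ℝ → ℝ, (∀ x, c < x → IntegrableOn f' (Ioi x)) →
      ∀ x < -c, IntegrableOn (fun y => f' (-y)) (Iio x) := fun f' hf' x hx => by
    have := (hneg.integrableOn_comp_preimage (Homeomorph.neg ℝ).measurableEmbedding
      (f := f') (s := Ioi (-x))).2 (hf' (-x) (by linarith))
    have e : (fun y : ℝ => -y) ⁻¹' Ioi (-x) = Iio x := by ext y; simp
    exact e ▸ this
  have := abel_fL (c := -c) hs0 hs1 (f := fun y => f (-y)) (g := fun y => g (-y))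
    (hf.comp_measurePreserving hneg) (hg.comp_measurePreserving hneg) (hset f hfi)
    (fun x hx => by
      have := (hgi (-x) (by linarith)).comp_neg
      refine this.congr (Eventually.of_forall fun z => ?_)
      simp only
      rw [show -z - -x = x - z by ring])
    (fun x hx => by
      have := h (-x) (by linarith)
      rwa [fR_eq_fL_neg, fR_eq_fL_neg, neg_neg] at this)
  have h2 := hneg.quasiMeasurePreserving.ae this
  filter_upwards [h2] with x hx hxc
  have := hx (by linarith)
  rw [neg_neg] at this
  rw [this, fR_eq_fL_neg]

/-! ### Passage between the interval (-1,1) and the whole line. -/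

/-- Truncation to the interval `(-1,1)`. -/
def cut (f : ℝ → ℝ) : ℝ → ℝ := indicator (Ioo (-1) 1) f

lemma cut_of_mem {f : ℝ → ℝ} {x : ℝ} (hx : x ∈ Ioo (-1 : ℝ) 1) : cut f x = f x :=
  indicator_of_mem hx f

lemma cut_of_notMem {f : ℝ → ℝ} {x : ℝ} (hx : x ∉ Ioo (-1 : ℝ) 1) : cut f x = 0 :=
  indicator_of_notMem hx f

/-- Truncating the function turns the interval integral into a convolution on the line, where the
semigroup law and Abel's inversion apply. -/
lemma leftInt_eq {s : ℝ} {v : ℝ → ℝ} {x : ℝ} (hx : x ∈ Ioo (-1 : ℝ) 1) :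
    leftInt s v x = fL (1 - s) (cut v) x := by
  have e : (fun y => kap (1 - s) (x - y) * cut v y) = indicator (Ioo (-1) x)
      (fun y => 1 / Real.Gamma (1 - s) * (v y / (x - y) ^ s)) := by
    ext y
    by_cases hy : y ∈ Ioo (-1) x
    · have h0 : 0 < x - y := sub_pos.2 hy.2
      rw [indicator_of_mem hy, cut_of_mem ⟨hy.1, hy.2.trans hx.2⟩, kap_of_pos h0,
        show 1 - s - 1 = -s by ring, Real.rpow_neg h0.le]
      ring
    · rw [indicator_of_notMem hy]
      rcases le_or_gt x y with h1 | h1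
      · rw [kap_of_nonpos (sub_nonpos.2 h1), zero_mul]
      · rw [cut_of_notMem fun h => hy ⟨h.1, h1⟩, mul_zero]
  rw [leftInt, fL, e, integral_indicator measurableSet_Ioo, integral_const_mul,
    intervalIntegral.integral_of_le hx.1.le, integral_Ioc_eq_integral_Ioo]

lemma rightInt_eq {s : ℝ} {v : ℝ → ℝ} {x : ℝ} (hx : x ∈ Ioo (-1 : ℝ) 1) :
    rightInt s v x = fR (1 - s) (cut v) x := by
  have e : (fun y => kap (1 - s) (y - x) * cut v y) = indicator (Ioo x 1)
      (fun y => 1 / Real.Gamma (1 - s) * (v y / (y - x) ^ s)) := by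
    ext y
    by_cases hy : y ∈ Ioo x 1
    · have h0 : 0 < y - x := sub_pos.2 hy.1
      rw [indicator_of_mem hy, cut_of_mem ⟨hx.1.trans hy.1, hy.2⟩, kap_of_pos h0,
        show 1 - s - 1 = -s by ring, Real.rpow_neg h0.le]
      ring
    · rw [indicator_of_notMem hy]
      rcases le_or_gt y x with h1 | h1
      · rw [kap_of_nonpos (sub_nonpos.2 h1), zero_mul]
      · rw [cut_of_notMem fun h => hy ⟨h1, h.2⟩, mul_zero]
  rw [rightInt, fR, e, integral_indicator measurableSet_Ioo, integral_const_mul,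
    intervalIntegral.integral_of_le hx.2.le, integral_Ioc_eq_integral_Ioo]

lemma integral_Iic_cut {f : ℝ → ℝ} {x : ℝ} (hx : x ∈ Ioo (-1 : ℝ) 1) :
    ∫ z in Iic x, cut f z = ∫ z in (-1)..x, f z := by
  have : Iic x ∩ Ioo (-1) 1 = Ioc (-1) x := by
    ext y
    simp only [mem_inter_iff, mem_Iic, mem_Ioo, mem_Ioc]
    constructor
    · rintro ⟨h1, h2, h3⟩; exact ⟨h2, h1⟩
    · rintro ⟨h1, h2⟩; exact ⟨h2, h1, h2.trans_lt hx.2⟩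
  rw [intervalIntegral.integral_of_le hx.1.le, cut, setIntegral_indicator measurableSet_Ioo, this]

lemma integral_Ioi_cut {f : ℝ → ℝ} {x : ℝ} (hx : x ∈ Ioo (-1 : ℝ) 1) :
    ∫ z in Ioi x, cut f z = ∫ z in x..1, f z := by
  have : Ioi x ∩ Ioo (-1) 1 = Ioo x 1 := by
    ext y
    simp only [mem_inter_iff, mem_Ioi, mem_Ioo]
    constructor
    · rintro ⟨h1, h2, h3⟩; exact ⟨h1, h3⟩
    · rintro ⟨h1, h2⟩; exact ⟨h1, hx.1.trans h1, h2⟩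
  rw [intervalIntegral.integral_of_le hx.2.le, cut, setIntegral_indicator measurableSet_Ioo, this,
    integral_Ioc_eq_integral_Ioo]

lemma integrableOn_Iio_cut {f : ℝ → ℝ} {x : ℝ} (hx : x ∈ Ioo (-1 : ℝ) 1) :
    IntegrableOn (cut f) (Iio x) ↔ IntervalIntegrable f volume (-1) x := by
  have : Ioo (-1) 1 ∩ Iio x = Ioo (-1) x := by
    ext y
    simp only [mem_inter_iff, mem_Iio, mem_Ioo]
    constructor
    · rintro ⟨⟨h2, h3⟩, h1⟩; exact ⟨h2, h1⟩
    · rintro ⟨h1, h2⟩; exact ⟨⟨h1, h2.trans hx.2⟩, h2⟩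
  rw [intervalIntegrable_iff_integrableOn_Ioo_of_le hx.1.le, cut, IntegrableOn,
    integrable_indicator_iff measurableSet_Ioo, IntegrableOn,
    Measure.restrict_restrict measurableSet_Ioo, this, IntegrableOn]

/-! ### Jacobi polynomials: Chu-Vandermonde, reflection and the coefficient shift. -/

lemma ascPochhammer_eval_add (C : ℝ) (j i : ℕ) : (ascPochhammer ℝ (j + i)).eval C =
    (ascPochhammer ℝ j).eval C * (ascPochhammer ℝ i).eval (C + j) := by
  rw [← ascPochhammer_mul]
  simp

lemma ascPochhammer_eval_succ' (C : ℝ) (i : ℕ) : (ascPochhammer ℝ (i + 1)).eval C =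
    C * (ascPochhammer ℝ i).eval (C + 1) := by
  rw [add_comm, ascPochhammer_eval_add]
  simp

lemma Gamma_mul_ascPochhammer {x : ℝ} (hx : 0 < x) (m : ℕ) :
    Real.Gamma x * (ascPochhammer ℝ m).eval x = Real.Gamma (x + m) := by
  induction m with
  | zero => simp
  | succ m ih =>
    rw [ascPochhammer_succ_eval, ← mul_assoc, ih, Nat.cast_succ, ← add_assoc,
      Real.Gamma_add_one (by positivity), mul_comm]

/-- The Chu-Vandermonde identity. -/
lemma sum_choose_ascPochhammer (N : ℕ) (C A : ℝ) :
    ∑ i ∈ Finset.range (N + 1), (N.choose i : ℝ) * (-1) ^ i * (ascPochhammer ℝ i).eval C *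
      (ascPochhammer ℝ (N - i)).eval (A + i) = (ascPochhammer ℝ N).eval (A - C) := by
  induction N generalizing A with
  | zero => simp
  | succ N ih =>
    rw [Finset.sum_range_succ']
    -- Pascal's rule splits the sum into one part with factor -(C + i) and one with factor A + i,
    -- both times the summand of level N at A + 1. The factors add up to A - C, independent of i,
    -- and the induction hypothesis at A + 1 finishes.
    have e1 : ∀ i ∈ Finset.range (N + 1), ((N + 1).choose (i + 1) : ℝ) * (-1) ^ (i + 1) *
        (ascPochhammer ℝ (i + 1)).eval C *
        (ascPochhammer ℝ (N + 1 - (i + 1))).eval (A + ((i + 1 : ℕ) : ℝ)) =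
        -((C + i) * ((N.choose i : ℝ) * (-1) ^ i * (ascPochhammer ℝ i).eval C *
        (ascPochhammer ℝ (N - i)).eval (A + 1 + i))) +
        (N.choose (i + 1) : ℝ) * (-1) ^ (i + 1) * (ascPochhammer ℝ (i + 1)).eval C *
        (ascPochhammer ℝ (N + 1 - (i + 1))).eval (A + ((i + 1 : ℕ) : ℝ)) := fun i _ => by
      rw [Nat.choose_succ_succ, Nat.add_sub_add_right, ascPochhammer_succ_eval]
      push_cast
      rw [show A + ((i : ℝ) + 1) = A + 1 + i by ring]
      ring
    rw [Finset.sum_congr rfl e1, Finset.sum_add_distrib, add_assoc]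
    have e2 := Finset.sum_range_succ' (fun i => (N.choose i : ℝ) * (-1) ^ i *
      (ascPochhammer ℝ i).eval C * (ascPochhammer ℝ (N + 1 - i)).eval (A + (i : ℝ))) (N + 1)
    have e3 : ((N + 1).choose 0 : ℝ) * (-1) ^ 0 * (ascPochhammer ℝ 0).eval C *
        (ascPochhammer ℝ (N + 1 - 0)).eval (A + ((0 : ℕ) : ℝ)) = (N.choose 0 : ℝ) * (-1) ^ 0 *
        (ascPochhammer ℝ 0).eval C * (ascPochhammer ℝ (N + 1 - 0)).eval (A + ((0 : ℕ) : ℝ)) := by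
      simp
    rw [e3, ← e2, Finset.sum_range_succ _ (N + 1), Nat.choose_succ_self]
    have e4 : ∀ i ∈ Finset.range (N + 1), (N.choose i : ℝ) * (-1) ^ i *
        (ascPochhammer ℝ i).eval C * (ascPochhammer ℝ (N + 1 - i)).eval (A + (i : ℝ)) =
        (A + i) * ((N.choose i : ℝ) * (-1) ^ i * (ascPochhammer ℝ i).eval C *
        (ascPochhammer ℝ (N - i)).eval (A + 1 + i)) := fun i hi => by
      rw [Nat.succ_sub (Finset.mem_range_succ_iff.1 hi), Nat.succ_eq_add_one,
        ascPochhammer_eval_succ', show A + (i : ℝ) + 1 = A + 1 + i by ring]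
      ring
    rw [Finset.sum_congr rfl e4]
    simp only [Nat.cast_zero, zero_mul, add_zero]
    rw [← Finset.sum_add_distrib]
    have e5 : ∀ i ∈ Finset.range (N + 1), -((C + i) * ((N.choose i : ℝ) * (-1) ^ i *
        (ascPochhammer ℝ i).eval C * (ascPochhammer ℝ (N - i)).eval (A + 1 + i))) +
        (A + i) * ((N.choose i : ℝ) * (-1) ^ i * (ascPochhammer ℝ i).eval C *
        (ascPochhammer ℝ (N - i)).eval (A + 1 + i)) = (A - C) * ((N.choose i : ℝ) * (-1) ^ i *
        (ascPochhammer ℝ i).eval C * (ascPochhammer ℝ (N - i)).eval (A + 1 + i)) := fun i _ => by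
      ring
    rw [Finset.sum_congr rfl e5, ← Finset.mul_sum, ih, ascPochhammer_eval_succ']
    ring_nf

/-- With n = j + N, this compares the coefficients of ((x-1)/2)^j on the two sides of the reflection
formula, up to the common factor 1/n!. The terms k < j vanish; the others form a Chu-Vandermonde sum
with A = a + j + 1 and A - C = -(b + j + N). -/
lemma sum_choose_mul_choose_ascPochhammer (a b : ℝ) (j N : ℕ) :
    ∑ k ∈ Finset.range (j + N + 1), ((j + N).choose k : ℝ) *
      (ascPochhammer ℝ k).eval (((j + N : ℕ) : ℝ) + a + b + 1) *
      (ascPochhammer ℝ (j + N - k)).eval (a + k + 1) * ((-1) ^ k * (k.choose j : ℝ)) =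
    (-1) ^ (j + N) * (((j + N).choose j : ℝ) *
      (ascPochhammer ℝ j).eval (((j + N : ℕ) : ℝ) + b + a + 1) *
      (ascPochhammer ℝ (j + N - j)).eval (b + j + 1)) := by
  rw [add_assoc, Finset.sum_range_add]
  rw [Finset.sum_eq_zero (s := Finset.range j) fun k hk => by
    rw [Nat.choose_eq_zero_of_lt (Finset.mem_range.1 hk)]; simp, zero_add]
  have e : ∀ i ∈ Finset.range (N + 1), ((j + N).choose (j + i) : ℝ) *
      (ascPochhammer ℝ (j + i)).eval (((j + N : ℕ) : ℝ) + a + b + 1) *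
      (ascPochhammer ℝ (j + N - (j + i))).eval (a + ((j + i : ℕ) : ℝ) + 1) *
      ((-1) ^ (j + i) * ((j + i).choose j : ℝ)) =
      (-1) ^ j * ((j + N).choose j : ℝ) *
        (ascPochhammer ℝ j).eval (((j + N : ℕ) : ℝ) + b + a + 1) *
      ((N.choose i : ℝ) * (-1) ^ i *
        (ascPochhammer ℝ i).eval (((j + N : ℕ) : ℝ) + a + b + 1 + j) *
        (ascPochhammer ℝ (N - i)).eval (a + j + 1 + i)) := fun i hi => by
    have h := Nat.choose_mul (n := j + N) (k := j + i) (s := j)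
      (by simp)
    rw [Nat.add_sub_cancel_left, Nat.add_sub_cancel_left] at h
    have h' : ((j + N).choose (j + i) : ℝ) * ((j + i).choose j : ℝ) =
      ((j + N).choose j : ℝ) * (N.choose i : ℝ) := by exact_mod_cast h
    rw [ascPochhammer_eval_add, Nat.add_sub_add_left, pow_add,
      show a + ((j + i : ℕ) : ℝ) + 1 = a + j + 1 + i by push_cast; ring,
      show ((j + N : ℕ) : ℝ) + b + a + 1 = ((j + N : ℕ) : ℝ) + a + b + 1 by ring]
    linear_combination (ascPochhammer ℝ j).eval (((j + N : ℕ) : ℝ) + a + b + 1) *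
      (ascPochhammer ℝ i).eval (((j + N : ℕ) : ℝ) + a + b + 1 + j) *
      (ascPochhammer ℝ (N - i)).eval (a + j + 1 + i) * (-1) ^ j * (-1) ^ i * h'
  rw [Finset.sum_congr rfl e, ← Finset.mul_sum, sum_choose_ascPochhammer,
    show a + (j : ℝ) + 1 - (((j + N : ℕ) : ℝ) + a + b + 1 + j) = -(b + j + N) by push_cast; ring,
    ascPochhammer_eval_neg_eq_descPochhammer, descPochhammer_eval_eq_ascPochhammer,
    show b + (j : ℝ) + N - N + 1 = b + j + 1 by ring, Nat.add_sub_cancel_left, pow_add]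
  ring

/-- Write (-x-1)/2 = -((x-1)/2 + 1), expand by the binomial theorem and exchange the sums. The
symmetry lets every statement at the endpoint -1 follow from the one at 1. -/
lemma jacobiP_neg (a b : ℝ) (n : ℕ) (x : ℝ) :
    jacobiP a b n (-x) = (-1) ^ n * jacobiP b a n x := by
  unfold jacobiP
  have e : ∀ k ∈ Finset.range (n + 1), (n.choose k : ℝ) *
      (ascPochhammer ℝ k).eval (n + a + b + 1) *
      (ascPochhammer ℝ (n - k)).eval (a + k + 1) * ((-x - 1) / 2) ^ k =
      ∑ j ∈ Finset.range (n + 1), (n.choose k : ℝ) * (ascPochhammer ℝ k).eval (n + a + b + 1) *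
      (ascPochhammer ℝ (n - k)).eval (a + k + 1) * ((-1) ^ k * (k.choose j : ℝ)) *
      ((x - 1) / 2) ^ j := fun k hk => by
    rw [show (-x - 1) / 2 = -1 * ((x - 1) / 2 + 1) by ring, mul_pow, add_pow]
    rw [← Finset.sum_subset (Finset.range_subset_range.2 (Finset.mem_range.1 hk))
      (f := fun j => (n.choose k : ℝ) * (ascPochhammer ℝ k).eval (n + a + b + 1) *
      (ascPochhammer ℝ (n - k)).eval (a + k + 1) * ((-1) ^ k * (k.choose j : ℝ)) *
      ((x - 1) / 2) ^ j) fun j _ hj => by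
        rw [Nat.choose_eq_zero_of_lt (show k < j by simpa using hj)]; simp]
    rw [Finset.mul_sum, Finset.mul_sum]
    refine Finset.sum_congr rfl fun j _ => ?_
    ring
  rw [Finset.sum_congr rfl e, Finset.sum_comm, mul_left_comm]
  congr 1
  rw [Finset.mul_sum]
  refine Finset.sum_congr rfl fun j hj => ?_
  obtain ⟨N, rfl⟩ := Nat.exists_eq_add_of_le (Finset.mem_range_succ_iff.1 hj)
  rw [← Finset.sum_mul, sum_choose_mul_choose_ascPochhammer]
  ring

/-- The coefficients of the Jacobi polynomial in powers of `(x - 1) / 2`. -/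
def jacobiCoeff (a b : ℝ) (n k : ℕ) : ℝ :=
  1 / (n ! : ℝ) * ((n.choose k : ℝ) * (ascPochhammer ℝ k).eval (n + a + b + 1) *
      (ascPochhammer ℝ (n - k)).eval (a + k + 1))

lemma jacobiP_eq_sum (a b : ℝ) (n : ℕ) (x : ℝ) : jacobiP a b n x =
    ∑ k ∈ Finset.range (n + 1), jacobiCoeff a b n k * ((x - 1) / 2) ^ k := by
  rw [jacobiP, Finset.mul_sum]
  refine Finset.sum_congr rfl fun k _ => ?_
  rw [jacobiCoeff]
  ring

@[fun_prop]
lemma continuous_jacobiP (a b : ℝ) (n : ℕ) : Continuous (jacobiP a b n) := by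
  rw [funext (jacobiP_eq_sum a b n)]
  fun_prop

lemma exists_bound_jacobiP (a b : ℝ) (n : ℕ) :
    ∃ C, 0 ≤ C ∧ ∀ x ∈ Ioo (-1 : ℝ) 1, |jacobiP a b n x| ≤ C := by
  obtain ⟨C, hC⟩ := isCompact_Icc.exists_bound_of_continuousOn (s := Icc (-1 : ℝ) 1)
    (continuous_jacobiP a b n).continuousOn
  exact ⟨|C|, abs_nonneg _, fun x hx => (hC x (Ioo_subset_Icc_self hx)).trans (le_abs_self _)⟩

/-- The leading coefficient is (n+a+b+1)_n / n!, and its base point is positive for n ≥ 1. Hence the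
Jacobi polynomials determine all monomials. -/
lemma jacobiCoeff_self_ne_zero {a b : ℝ} (h : -2 < a + b) (n : ℕ) : jacobiCoeff a b n n ≠ 0 := by
  unfold jacobiCoeff
  have : (ascPochhammer ℝ n).eval (n + a + b + 1) ≠ 0 := by
    rcases n with _ | n
    · simp
    · refine (ascPochhammer_pos _ _ ?_).ne'
      push_cast
      linarith [(Nat.cast_nonneg n : (0 : ℝ) ≤ n)]
  simp [this, Nat.factorial_ne_zero]

lemma jacobiP_one_pos {a b : ℝ} (ha : -1 < a) (n : ℕ) : 0 < jacobiP a b n 1 := by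
  rw [jacobiP_eq_sum, Finset.sum_eq_single 0 (fun k _ hk => by simp [hk]) (by simp), jacobiCoeff]
  have : 0 < (ascPochhammer ℝ (n - 0)).eval (a + ((0 : ℕ) : ℝ) + 1) :=
    ascPochhammer_pos _ _ (by simpa using by linarith)
  simp only [Nat.choose_zero_right, Nat.cast_one, ascPochhammer_zero, Polynomial.eval_one, one_mul,
    pow_zero, mul_one]
  positivity

/-- Under (a,b) ↦ (a+s,b-s) the sum a + b is unchanged, so only (a+k+1)_{n-k} changes. Since
Γ(a+k+1)(a+k+1)_{n-k} = Γ(n+a+1) does not depend on k, all coefficients are rescaled by the same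
factor. -/
lemma jacobiCoeff_shift {a b s : ℝ} (ha : -1 < a) (hs : 0 < s) {n k : ℕ} (hk : k ≤ n) :
    jacobiCoeff a b n k * Real.Gamma (a + k + 1) =
      Real.Gamma (n + a + 1) / Real.Gamma (n + a + s + 1) *
        (jacobiCoeff (a + s) (b - s) n k * Real.Gamma (a + s + k + 1)) := by
  have hk0 : (0 : ℝ) ≤ k := Nat.cast_nonneg k
  have hn0 : (0 : ℝ) ≤ n := Nat.cast_nonneg n
  have h1 := Gamma_mul_ascPochhammer (x := a + k + 1) (by linarith) (n - k)
  have h2 := Gamma_mul_ascPochhammer (x := a + s + k + 1) (by linarith) (n - k)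
  rw [Nat.cast_sub hk, show a + k + 1 + ((n : ℝ) - k) = n + a + 1 by ring] at h1
  rw [Nat.cast_sub hk, show a + s + k + 1 + ((n : ℝ) - k) = n + a + s + 1 by ring] at h2
  have h3 : Real.Gamma (n + a + s + 1) ≠ 0 := (Real.Gamma_pos_of_pos (by linarith)).ne'
  unfold jacobiCoeff
  rw [show (n : ℝ) + (a + s) + (b - s) + 1 = n + a + b + 1 by ring]
  field_simp
  linear_combination (norm := skip) ((n.choose k : ℝ) *
    (ascPochhammer ℝ k).eval (n + a + b + 1)) * (Real.Gamma (n + a + s + 1) * h1 -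
      Real.Gamma (n + a + 1) * h2)
  ring_nf

/-! ### Fractional integrals of weighted Jacobi polynomials. -/

lemma fR_kap {s c : ℝ} (hs : 0 < s) (hc : 0 < c) (w x : ℝ) :
    fR s (fun y => kap c (w - y)) x = kap (s + c) (w - x) := by
  rw [fR, add_comm, ← integral_kap_mul_kap hc hs]
  simp only [mul_comm]

lemma integrable_fR_kap {s c : ℝ} (hs : 0 < s) (hc : 0 < c) (w x : ℝ) :
    Integrable fun y => kap s (y - x) * kap c (w - y) := by
  simpa only [mul_comm] using integrable_kap_mul_kap hc hs w x

lemma fL_kap {s c : ℝ} (hs : 0 < s) (hc : 0 < c) (w x : ℝ) :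
    fL s (fun y => kap c (y - w)) x = kap (s + c) (x - w) :=
  integral_kap_mul_kap hs hc x w

lemma one_sub_rpow_mul_jacobiP {a b x : ℝ} (ha : -1 < a) (hx : x < 1) (n : ℕ) :
    (1 - x) ^ a * jacobiP a b n x = ∑ k ∈ Finset.range (n + 1),
      (-1 / 2) ^ k * (jacobiCoeff a b n k * Real.Gamma (a + k + 1)) * kap (a + k + 1) (1 - x) := by
  rw [jacobiP_eq_sum, Finset.mul_sum]
  refine Finset.sum_congr rfl fun k _ => ?_
  have h0 : 0 < 1 - x := by linarith
  have hk0 : (0 : ℝ) ≤ k := Nat.cast_nonneg k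
  rw [mul_assoc _ (jacobiCoeff a b n k * _), mul_assoc (jacobiCoeff a b n k),
    ← rpow_eq_kap (by linarith) h0, Real.rpow_add_natCast h0.ne',
    show (x - 1) / 2 = (-1 / 2) * (1 - x) by ring, mul_pow]
  ring

/-- In powers of 1 - x the function is a sum of kernels of order a + k + 1. Fractional integration
raises each order by s, and `jacobiCoeff_shift` shows that the resulting factors are the same for
all k. -/
lemma fR_jacobi {a b s x : ℝ} (ha : -1 < a) (hs : 0 < s) (hx : x ∈ Ioo (-1 : ℝ) 1) (n : ℕ) :
    fR s (cut fun y => (1 - y) ^ a * jacobiP a b n y) x =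
      Real.Gamma (n + a + 1) / Real.Gamma (n + a + s + 1) *
        ((1 - x) ^ (a + s) * jacobiP (a + s) (b - s) n x) := by
  have e : fR s (cut fun y => (1 - y) ^ a * jacobiP a b n y) x =
      fR s (fun y => ∑ k ∈ Finset.range (n + 1), (-1 / 2) ^ k *
        (jacobiCoeff a b n k * Real.Gamma (a + k + 1)) * kap (a + k + 1) (1 - y)) x := by
    refine fR_congr_gt fun y hy => ?_
    rcases lt_or_ge y 1 with h | h
    · rw [cut_of_mem ⟨hx.1.trans hy, h⟩, one_sub_rpow_mul_jacobiP ha h]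
    · rw [cut_of_notMem fun h' => h'.2.not_ge h]
      refine (Finset.sum_eq_zero fun k _ => ?_).symm
      rw [kap_of_nonpos (by linarith), mul_zero]
  have hc : ∀ k : ℕ, 0 < a + k + 1 := fun k => by
    linarith [(Nat.cast_nonneg k : (0 : ℝ) ≤ k)]
  have e2 : fR s (fun y => ∑ k ∈ Finset.range (n + 1), (-1 / 2) ^ k *
        (jacobiCoeff a b n k * Real.Gamma (a + k + 1)) * kap (a + k + 1) (1 - y)) x =
      ∑ k ∈ Finset.range (n + 1), (-1 / 2) ^ k *
        (jacobiCoeff a b n k * Real.Gamma (a + k + 1)) * kap (s + (a + k + 1)) (1 - x) := by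
    simp only [fR, Finset.mul_sum]
    rw [integral_finsetSum _ fun k _ => by
      refine ((integrable_fR_kap hs (hc k) 1 x).const_mul ((-1 / 2) ^ k *
        (jacobiCoeff a b n k * Real.Gamma (a + k + 1)))).congr (Eventually.of_forall fun y => ?_)
      simp only
      ring]
    refine Finset.sum_congr rfl fun k _ => ?_
    rw [← fR_kap hs (hc k), fR, ← integral_const_mul]
    simp only [mul_left_comm]
  rw [e, e2, one_sub_rpow_mul_jacobiP (by linarith) hx.2, Finset.mul_sum]
  refine Finset.sum_congr rfl fun k hk => ?_
  rw [jacobiCoeff_shift (b := b) ha hs (Finset.mem_range_succ_iff.1 hk),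
    show s + (a + k + 1) = a + s + k + 1 by ring]
  ring

lemma fL_eq_fR_neg (a : ℝ) (f : ℝ → ℝ) (x : ℝ) : fL a f x = fR a (fun y => f (-y)) (-x) := by
  rw [fR_eq_fL_neg]
  simp

/-- This is `fR_jacobi` reflected; the sign (-1)^n from `jacobiP_neg` enters twice and cancels. -/
lemma fL_jacobi {a b s x : ℝ} (hb : -1 < b) (hs : 0 < s) (hx : x ∈ Ioo (-1 : ℝ) 1) (n : ℕ) :
    fL s (cut fun y => (1 + y) ^ b * jacobiP a b n y) x =
      Real.Gamma (n + b + 1) / Real.Gamma (n + b + s + 1) *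
        ((1 + x) ^ (b + s) * jacobiP (a - s) (b + s) n x) := by
  have e : (fun y => cut (fun y => (1 + y) ^ b * jacobiP a b n y) (-y)) =
      fun y => (-1) ^ n * cut (fun y => (1 - y) ^ b * jacobiP b a n y) y := by
    ext y
    by_cases hy : y ∈ Ioo (-1 : ℝ) 1
    · rw [cut_of_mem hy, cut_of_mem ⟨by linarith [hy.2], by linarith [hy.1]⟩, jacobiP_neg,
        ← sub_eq_add_neg]
      ring
    · rw [cut_of_notMem hy, cut_of_notMem fun h => hy ⟨by linarith [h.2], by linarith [h.1]⟩,
        mul_zero]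
  have e2 : ∀ (c : ℝ) (f : ℝ → ℝ), fR s (fun y => c * f y) (-x) = c * fR s f (-x) :=
    fun c f => by simp only [fR, mul_left_comm _ c, integral_const_mul]
  rw [fL_eq_fR_neg, e, e2, fR_jacobi hb hs ⟨by linarith [hx.2], by linarith [hx.1]⟩, jacobiP_neg,
    sub_neg_eq_add]
  have : ((-1 : ℝ) ^ n) * (-1) ^ n = 1 := by rw [← mul_pow]; simp
  linear_combination (Real.Gamma (n + b + 1) / Real.Gamma (n + b + s + 1) *
        ((1 + x) ^ (b + s) * jacobiP (a - s) (b + s) n x)) * this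

/-! ### The solution operator and the base spectrum. -/

/-- The datum `ω^{(-α,β)} G` truncated to `(-1,1)`. -/
def datum (α β : ℝ) (G : ℝ → ℝ) : ℝ → ℝ := cut fun y => weight (-α) β y * G y

/-- The right fractional derivative of the solution of `L u = G`, truncated to `(-1,1)`. -/
def solDeriv (α β s : ℝ) (G : ℝ → ℝ) : ℝ → ℝ :=
  cut fun y => weight (α - s) (-β - s) y * fL s (datum α β G) y

/-- The solution operator of `L u = G`. -/
def solOp (α β s : ℝ) (G : ℝ → ℝ) : ℝ → ℝ := fR s (solDeriv α β s G)

lemma baseEig_pos {α β s : ℝ} (hs0 : 0 < s) (hα : s - 1 < α) (hβ : -1 < β) (n : ℕ) :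
    0 < baseEig α β s n := by
  have hn0 : (0 : ℝ) ≤ n := Nat.cast_nonneg n
  unfold baseEig
  have := Real.Gamma_pos_of_pos (show 0 < n + α + 1 by linarith)
  have := Real.Gamma_pos_of_pos (show 0 < n + β + s + 1 by linarith)
  have := Real.Gamma_pos_of_pos (show 0 < n + α - s + 1 by linarith)
  have := Real.Gamma_pos_of_pos (show 0 < n + β + 1 by linarith)
  positivity

/-- The left integral sends (1+y)^β P^{(α,β)} to a multiple of (1+y)^{β+s} P^{(α-s,β+s)}; the weight
replaces (1+y)^{β+s} by (1-y)^{α-s}; the right integral shifts the parameters back to (α,β). The two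
Gamma quotients multiply to 1/λ_n. -/
lemma solOp_baseFun {α β s x : ℝ} (hs0 : 0 < s) (hα : s - 1 < α) (hβ : -1 < β)
    (hx : x ∈ Ioo (-1 : ℝ) 1) (n : ℕ) :
    solOp α β s (baseFun α β n) x = (baseEig α β s n)⁻¹ * baseFun α β n x := by
  set c := (√(jacobiGamma α β n))⁻¹ with hc
  have e1 : datum α β (baseFun α β n) =
      fun y => c * cut (fun y => (1 + y) ^ β * jacobiP α β n y) y := by
    ext y
    by_cases hy : y ∈ Ioo (-1 : ℝ) 1
    · have h0 : 0 < 1 - y := by linarith [hy.2]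
      rw [datum, cut_of_mem hy, cut_of_mem hy, weight, baseFun, ← hc, Real.rpow_neg h0.le]
      have := (Real.rpow_pos_of_pos h0 α).ne'
      field_simp
    · rw [datum, cut_of_notMem hy, cut_of_notMem hy, mul_zero]
  have e2 : solDeriv α β s (baseFun α β n) =
      fun y => c * (Real.Gamma (n + β + 1) / Real.Gamma (n + β + s + 1)) *
        cut (fun y => (1 - y) ^ (α - s) * jacobiP (α - s) (β + s) n y) y := by
    ext y
    by_cases hy : y ∈ Ioo (-1 : ℝ) 1
    · have h0 : 0 < 1 + y := by linarith [hy.1]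
      have e3 : fL s (fun y => c * cut (fun y => (1 + y) ^ β * jacobiP α β n y) y) y =
          c * fL s (cut (fun y => (1 + y) ^ β * jacobiP α β n y)) y := by
        simp only [fL, mul_left_comm _ c, integral_const_mul]
      rw [solDeriv, cut_of_mem hy, cut_of_mem hy, e1, e3, fL_jacobi hβ hs0 hy, weight,
        show -β - s = -(β + s) by ring, Real.rpow_neg h0.le]
      have := (Real.rpow_pos_of_pos h0 (β + s)).ne'
      field_simp
    · rw [solDeriv, cut_of_notMem hy, cut_of_notMem hy, mul_zero]
  have e4 : ∀ (c : ℝ) (f : ℝ → ℝ), fR s (fun y => c * f y) x = c * fR s f x :=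
    fun c f => by simp only [fR, mul_left_comm _ c, integral_const_mul]
  rw [solOp, e2, e4, fR_jacobi (by linarith) hs0 hx, sub_add_cancel, add_sub_cancel_right, baseFun,
    ← hc, baseEig, show (n : ℝ) + (α - s) + 1 = n + α - s + 1 by ring,
    show (n : ℝ) + (α - s) + s + 1 = n + α + 1 by ring]
  rw [inv_div]
  ring

lemma baseEig_succ {α β s : ℝ} (hs0 : 0 < s) (hα : s - 1 < α) (hβ : -1 < β) (n : ℕ) :
    baseEig α β s (n + 1) = baseEig α β s n *
      ((1 + s / (n + α - s + 1)) * (1 + s / (n + β + 1))) := by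
  have hn0 : (0 : ℝ) ≤ n := Nat.cast_nonneg n
  have h1 : (n : ℝ) + α - s + 1 ≠ 0 := by linarith
  have h2 : (n : ℝ) + β + 1 ≠ 0 := by linarith
  have g1 := (Real.Gamma_pos_of_pos (show 0 < n + α - s + 1 by linarith)).ne'
  have g2 := (Real.Gamma_pos_of_pos (show 0 < n + β + 1 by linarith)).ne'
  unfold baseEig
  push_cast
  rw [show (n : ℝ) + 1 + α + 1 = n + α + 1 + 1 by ring,
    show (n : ℝ) + 1 + β + s + 1 = n + β + s + 1 + 1 by ring,
    show (n : ℝ) + 1 + α - s + 1 = n + α - s + 1 + 1 by ring,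
    show (n : ℝ) + 1 + β + 1 = n + β + 1 + 1 by ring,
    Real.Gamma_add_one (s := n + α + 1) (by linarith),
    Real.Gamma_add_one (s := n + β + s + 1) (by linarith),
    Real.Gamma_add_one h1, Real.Gamma_add_one h2]
  field_simp
  ring

lemma baseEig_strictMono {α β s : ℝ} (hs0 : 0 < s) (hα : s - 1 < α) (hβ : -1 < β) :
    StrictMono (baseEig α β s) := by
  refine strictMono_nat_of_lt_succ fun n => ?_
  have hn0 : (0 : ℝ) ≤ n := Nat.cast_nonneg n
  rw [baseEig_succ hs0 hα hβ]
  have h1 : 0 < s / (n + α - s + 1) := div_pos hs0 (by linarith)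
  have h2 : 0 < s / (n + β + 1) := div_pos hs0 (by linarith)
  have := baseEig_pos hs0 hα hβ n
  nlinarith [mul_pos h1 h2]

/-- The gaps are at least λ_0 s/(n+α-s+1), hence at least c/(n+1), and the harmonic series diverges.
The sharp growth rate is not needed. -/
lemma tendsto_baseEig {α β s : ℝ} (hs0 : 0 < s) (hα : s - 1 < α) (hβ : -1 < β) :
    Tendsto (baseEig α β s) atTop atTop := by
  obtain ⟨c, hc0, hc⟩ : ∃ c : ℝ, 0 < c ∧ ∀ n : ℕ,
      c * (1 / ((n : ℝ) + 1)) ≤ baseEig α β s (n + 1) - baseEig α β s n := by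
    have hb := baseEig_pos hs0 hα hβ 0
    refine ⟨baseEig α β s 0 * s / (|α - s| + 1), by positivity, fun n => ?_⟩
    have hn0 : (0 : ℝ) ≤ n := Nat.cast_nonneg n
    have h0 : baseEig α β s 0 ≤ baseEig α β s n :=
      (baseEig_strictMono hs0 hα hβ).monotone (Nat.zero_le n)
    rw [baseEig_succ hs0 hα hβ]
    have h1 : 0 < s / (n + α - s + 1) := div_pos hs0 (by linarith)
    have h2 : 0 < s / (n + β + 1) := div_pos hs0 (by linarith)
    have h3 : s / ((|α - s| + 1) * (n + 1)) ≤ s / (n + α - s + 1) := by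
      refine div_le_div_of_nonneg_left hs0.le (by linarith) ?_
      nlinarith [abs_nonneg (α - s), le_abs_self (α - s)]
    have h4 : 0 < s / ((|α - s| + 1) * (n + 1)) := by positivity
    calc baseEig α β s 0 * s / (|α - s| + 1) * (1 / ((n : ℝ) + 1))
        = baseEig α β s 0 * (s / ((|α - s| + 1) * (n + 1))) := by field_simp
      _ ≤ baseEig α β s n * (s / (n + α - s + 1)) :=
          mul_le_mul h0 h3 h4.le (hb.trans_le h0).le
      _ ≤ _ := by
          nlinarith [mul_pos (hb.trans_le h0) (mul_pos h1 h2), mul_pos (hb.trans_le h0) h2]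
  have hsum : ∀ n : ℕ, c * (∑ i ∈ Finset.range n, 1 / ((i : ℝ) + 1)) ≤ baseEig α β s n := fun n => by
    have := Finset.sum_le_sum fun i (_ : i ∈ Finset.range n) => hc i
    rw [← Finset.mul_sum, Finset.sum_range_sub] at this
    linarith [baseEig_pos hs0 hα hβ 0]
  exact tendsto_atTop_mono hsum
    (Real.tendsto_sum_range_one_div_nat_succ_atTop.const_mul_atTop hc0)

/-! ### Weights, weighted measures and the weighted L² space. -/

/-- Adding the values at both ends of [δ,2] avoids a distinction on the sign of the exponent. -/
lemma rpow_le_add {t δ : ℝ} (hδ : 0 < δ) (h1 : δ ≤ t) (h2 : t ≤ 2) (p : ℝ) :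
    t ^ p ≤ δ ^ p + 2 ^ p := by
  rcases le_total 0 p with hp | hp
  · have := Real.rpow_le_rpow (hδ.trans_le h1).le h2 hp
    linarith [Real.rpow_nonneg hδ.le p]
  · have := Real.rpow_le_rpow_of_nonpos hδ h1 hp
    linarith [Real.rpow_nonneg (zero_le_two (α := ℝ)) p]

@[fun_prop]
lemma measurable_weight (a b : ℝ) : Measurable (weight a b) := by
  unfold weight
  fun_prop

lemma weight_pos {a b x : ℝ} (hx : x ∈ Ioo (-1 : ℝ) 1) : 0 < weight a b x :=
  mul_pos (Real.rpow_pos_of_pos (by linarith [hx.2]) _)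
    (Real.rpow_pos_of_pos (by linarith [hx.1]) _)

lemma one_sub_rpow_mul_weight {a b c x : ℝ} (hx : x ∈ Ioo (-1 : ℝ) 1) :
    (1 - x) ^ c * weight a b x = weight (c + a) b x := by
  rw [weight, weight, Real.rpow_add (by linarith [hx.2]), mul_assoc]

lemma weight_mul_weight {a b c d x : ℝ} (hx : x ∈ Ioo (-1 : ℝ) 1) :
    weight a b x * weight c d x = weight (a + c) (b + d) x := by
  rw [weight, weight, weight, Real.rpow_add (by linarith [hx.2]),
    Real.rpow_add (by linarith [hx.1])]
  ring

lemma weight_zero_zero (x : ℝ) : weight 0 0 x = 1 := by simp [weight]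

lemma integrable_cut_iff {f : ℝ → ℝ} : Integrable (cut f) ↔ IntegrableOn f (Ioo (-1) 1) :=
  integrable_indicator_iff measurableSet_Ioo

lemma integral_cut (f : ℝ → ℝ) : ∫ x, cut f x = ∫ x in Ioo (-1) 1, f x :=
  integral_indicator measurableSet_Ioo

lemma aestronglyMeasurable_cut {f : ℝ → ℝ} :
    AEStronglyMeasurable (cut f) ↔ AEStronglyMeasurable f (volume.restrict (Ioo (-1) 1)) :=
  aestronglyMeasurable_indicator_iff measurableSet_Ioo

lemma cut_congr_ae {f g : ℝ → ℝ} (h : f =ᵐ[volume.restrict (Ioo (-1) 1)] g) :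
    cut f =ᵐ[volume] cut g := (ae_eq_restrict_iff_indicator_ae_eq measurableSet_Ioo).1 h

/-- Lebesgue measure on `(-1,1)`. -/
abbrev volI : Measure ℝ := volume.restrict (Ioo (-1) 1)

lemma ae_volI_iff {p : ℝ → Prop} : (∀ᵐ x ∂volI, p x) ↔ ∀ᵐ x, x ∈ Ioo (-1 : ℝ) 1 → p x :=
  ae_restrict_iff' measurableSet_Ioo

lemma ae_volI_mem : ∀ᵐ x ∂volI, x ∈ Ioo (-1 : ℝ) 1 := ae_restrict_mem measurableSet_Ioo

lemma ae_weightMeasure_iff {a b : ℝ} {p : ℝ → Prop} :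
    (∀ᵐ x ∂weightMeasure a b, p x) ↔ ∀ᵐ x ∂volI, p x := by
  rw [weightMeasure, ae_withDensity_iff (by fun_prop)]
  refine ⟨fun h => ?_, fun h => h.mono fun x hx _ => hx⟩
  filter_upwards [h, ae_volI_mem] with x hx hxI
  exact hx (ENNReal.ofReal_pos.2 (weight_pos hxI)).ne'

lemma volI_absolutelyContinuous (a b : ℝ) : volI ≪ weightMeasure a b := by
  refine withDensity_absolutelyContinuous' (by fun_prop) ?_
  filter_upwards [ae_volI_mem] with x hx
  exact (ENNReal.ofReal_pos.2 (weight_pos hx)).ne'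

lemma aestronglyMeasurable_weightMeasure_iff {a b : ℝ} {f : ℝ → ℝ} :
    AEStronglyMeasurable f (weightMeasure a b) ↔ AEStronglyMeasurable f volI :=
  ⟨fun h => h.mono_ac (volI_absolutelyContinuous a b),
    fun h => h.mono_ac (withDensity_absolutelyContinuous _ _)⟩

lemma integral_weightMeasure (a b : ℝ) (f : ℝ → ℝ) :
    ∫ x, f x ∂weightMeasure a b = ∫ x, cut (fun x => weight a b x * f x) x := by
  rw [weightMeasure, integral_withDensity_eq_integral_toReal_smul (by fun_prop) (by simp),
    integral_cut]
  refine setIntegral_congr_fun measurableSet_Ioo fun x hx => ?_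
  simp [ENNReal.toReal_ofReal (weight_pos hx).le]

lemma integrable_weightMeasure_iff {a b : ℝ} {f : ℝ → ℝ} :
    Integrable f (weightMeasure a b) ↔ Integrable (cut fun x => weight a b x * f x) := by
  rw [weightMeasure, integrable_withDensity_iff_integrable_smul' (by fun_prop) (by simp),
    integrable_cut_iff]
  refine integrableOn_congr_fun (fun x hx => ?_) measurableSet_Ioo
  simp [ENNReal.toReal_ofReal (weight_pos hx).le]

/-- As a product of two opposite kernels with poles at 1 and -1, the weight inherits its
integrability from `integrable_kap_mul_kap`. -/
lemma cut_weight_eq {a b : ℝ} (ha : -1 < a) (hb : -1 < b) : cut (weight a b) = fun x =>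
    Real.Gamma (a + 1) * Real.Gamma (b + 1) * (kap (a + 1) (1 - x) * kap (b + 1) (x - -1)) := by
  ext x
  by_cases hx : x ∈ Ioo (-1 : ℝ) 1
  · rw [cut_of_mem hx, weight, rpow_eq_kap (a := a) (by linarith) (by linarith [hx.2]),
      rpow_eq_kap (a := b) (by linarith) (by linarith [hx.1]), sub_neg_eq_add, add_comm x 1]
    ring
  · rw [cut_of_notMem hx]
    rcases le_or_gt 1 x with h | h
    · rw [kap_of_nonpos (by linarith)]; ring
    · rw [kap_of_nonpos (t := x - -1)]
      · ring
      · by_contra h'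
        exact hx ⟨by linarith, h⟩

lemma integrable_cut_weight {a b : ℝ} (ha : -1 < a) (hb : -1 < b) :
    Integrable (cut (weight a b)) := by
  rw [cut_weight_eq ha hb]
  exact (integrable_kap_mul_kap (by linarith) (by linarith) _ _).const_mul _

/-- Squaring (1-x)^α against ω^{(-α,β)} leaves ω^{(α,β)}, which is integrable. -/
lemma memLp_two_of_bound {α β K : ℝ} (hα : -1 < α) (hβ : -1 < β) {G : ℝ → ℝ}
    (hG : AEStronglyMeasurable G volI) (hK : ∀ᵐ x ∂volI, |G x| ≤ K * (1 - x) ^ α) :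
    MemLp G 2 (weightMeasure (-α) β) := by
  rw [memLp_two_iff_integrable_sq (aestronglyMeasurable_weightMeasure_iff.2 hG),
    integrable_weightMeasure_iff]
  refine ((integrable_cut_weight hα hβ).const_mul (K ^ 2)).mono'
    (aestronglyMeasurable_cut.2 (by fun_prop)) ?_
  filter_upwards [ae_volI_iff.1 hK] with x hx
  by_cases hxI : x ∈ Ioo (-1 : ℝ) 1
  · rw [cut_of_mem hxI, cut_of_mem hxI, Real.norm_of_nonneg
      (mul_nonneg (weight_pos hxI).le (sq_nonneg _)), ← sq_abs]
    have h0 : 0 < 1 - x := by linarith [hxI.2]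
    calc weight (-α) β x * |G x| ^ 2 ≤ weight (-α) β x * (K * (1 - x) ^ α) ^ 2 := by
          gcongr
          · exact (weight_pos hxI).le
          · exact hx hxI
      _ = K ^ 2 * ((1 - x) ^ α * ((1 - x) ^ α * weight (-α) β x)) := by ring
      _ = K ^ 2 * weight α β x := by
          rw [one_sub_rpow_mul_weight hxI, one_sub_rpow_mul_weight hxI]
          ring_nf
  · simp [cut_of_notMem hxI]

lemma aestronglyMeasurable_datum {α β : ℝ} {G : ℝ → ℝ} (hG : AEStronglyMeasurable G volI) :
    AEStronglyMeasurable (datum α β G) :=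
  aestronglyMeasurable_cut.2 (by fun_prop)

lemma rpow_mul_abs_datum (α β : ℝ) (G : ℝ → ℝ) : (fun z => (1 - z) ^ α * |datum α β G z|) =
    cut fun z => weight (-α) β z * (|G z| * (1 - z) ^ α) := by
  ext z
  by_cases hz : z ∈ Ioo (-1 : ℝ) 1
  · rw [datum, cut_of_mem hz, cut_of_mem hz, abs_mul, abs_of_pos (weight_pos hz)]
    ring
  · simp [datum, cut_of_notMem hz]

lemma memLp_rpow {α β : ℝ} (hα : -1 < α) (hβ : -1 < β) :
    MemLp (fun x => (1 - x) ^ α) 2 (weightMeasure (-α) β) := by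
  refine memLp_two_of_bound (K := 1) hα hβ (Measurable.aestronglyMeasurable (by fun_prop)) ?_
  filter_upwards [ae_volI_mem] with x hx
  rw [one_mul, abs_of_pos (Real.rpow_pos_of_pos (by linarith [hx.2]) _)]

/-- The weighted `L²` norm dominates the `L¹` norm of the datum. -/
lemma integrable_rpow_mul_datum {α β : ℝ} (hα : -1 < α) (hβ : -1 < β) {G : ℝ → ℝ}
    (hG : MemLp G 2 (weightMeasure (-α) β)) :
    (Integrable fun z => (1 - z) ^ α * |datum α β G z|) ∧
      ∫ z, (1 - z) ^ α * |datum α β G z| ≤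
        wNorm α β G * wNorm α β fun x => (1 - x) ^ α := by
  have h1 := memLp_rpow hα hβ
  have habs : MemLp (fun x => |G x|) 2 (weightMeasure (-α) β) := hG.abs
  rw [rpow_mul_abs_datum, ← integrable_weightMeasure_iff, ← integral_weightMeasure]
  refine ⟨habs.integrable_mul h1, ?_⟩
  have := integral_mul_le_Lp_mul_Lq_of_nonneg (μ := weightMeasure (-α) β) (p := 2) (q := 2)
    Real.HolderConjugate.two_two (f := fun x => |G x|) (g := fun x => (1 - x) ^ α)
    (Eventually.of_forall fun x => abs_nonneg _)
    (ae_weightMeasure_iff.2 (ae_volI_mem.mono fun x hx =>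
      Real.rpow_nonneg (by linarith [hx.2]) _)) (by simpa using habs) (by simpa using h1)
  simpa only [wNorm, Real.sqrt_eq_rpow, Real.rpow_two, sq_abs] using this

/-! ### Weighted sup norm bounds for the solution operator. -/

/-- A bound `|G| ≤ K (1-x)^α` makes the datum bounded by `K (1+x)^β`. -/
lemma abs_datum_le {α β K : ℝ} (hβ : -1 < β) {G : ℝ → ℝ} (hK0 : 0 ≤ K)
    (hK : ∀ᵐ x ∂volI, |G x| ≤ K * (1 - x) ^ α) :
    ∀ᵐ z, |datum α β G z| ≤ K * Real.Gamma (β + 1) * kap (β + 1) (z - -1) := by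
  have hΓ := (Real.Gamma_pos_of_pos (show 0 < β + 1 by linarith)).le
  filter_upwards [ae_volI_iff.1 hK] with z hz
  by_cases hzI : z ∈ Ioo (-1 : ℝ) 1
  · have h0 : 0 < 1 - z := by linarith [hzI.2]
    rw [datum, cut_of_mem hzI, abs_mul, abs_of_pos (weight_pos hzI), mul_assoc,
      ← rpow_eq_kap (by linarith) (by linarith [hzI.1]), sub_neg_eq_add, add_comm z 1]
    calc weight (-α) β z * |G z| ≤ weight (-α) β z * (K * (1 - z) ^ α) := by
          gcongr
          · exact (weight_pos hzI).le
          · exact hz hzI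
      _ = K * ((1 - z) ^ α * weight (-α) β z) := by ring
      _ = K * (1 + z) ^ β := by rw [one_sub_rpow_mul_weight hzI]; simp [weight]
  · rw [datum, cut_of_notMem hzI, abs_zero]
    exact mul_nonneg (mul_nonneg hK0 hΓ) (kap_nonneg (by linarith) _)

lemma abs_fL_le {a : ℝ} (ha : 0 < a) {f g : ℝ → ℝ} (h : ∀ᵐ z, |f z| ≤ g z) {x : ℝ}
    (hi : Integrable fun y => kap a (x - y) * g y) : |fL a f x| ≤ fL a g x := by
  rw [← Real.norm_eq_abs]
  refine norm_integral_le_of_norm_le hi ?_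
  filter_upwards [h] with y hy
  rw [Real.norm_eq_abs, abs_mul, abs_of_nonneg (kap_nonneg ha _)]
  exact mul_le_mul_of_nonneg_left hy (kap_nonneg ha _)

lemma abs_fR_le {a : ℝ} (ha : 0 < a) {f g : ℝ → ℝ} (h : ∀ᵐ z, |f z| ≤ g z) {x : ℝ}
    (hi : Integrable fun y => kap a (y - x) * g y) : |fR a f x| ≤ fR a g x := by
  rw [← Real.norm_eq_abs]
  refine norm_integral_le_of_norm_le hi ?_
  filter_upwards [h] with y hy
  rw [Real.norm_eq_abs, abs_mul, abs_of_nonneg (kap_nonneg ha _)]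
  exact mul_le_mul_of_nonneg_left hy (kap_nonneg ha _)

lemma fL_const_mul (a c : ℝ) (f : ℝ → ℝ) (x : ℝ) : fL a (fun y => c * f y) x = c * fL a f x := by
  simp only [fL, mul_left_comm _ c, integral_const_mul]

lemma fR_const_mul (a c : ℝ) (f : ℝ → ℝ) (x : ℝ) : fR a (fun y => c * f y) x = c * fR a f x := by
  simp only [fR, mul_left_comm _ c, integral_const_mul]

lemma abs_fL_datum_le {α β s K : ℝ} (hs0 : 0 < s) (hβ : -1 < β) {G : ℝ → ℝ} (hK0 : 0 ≤ K)
    (hK : ∀ᵐ x ∂volI, |G x| ≤ K * (1 - x) ^ α) (x : ℝ) :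
    |fL s (datum α β G) x| ≤ K * Real.Gamma (β + 1) * kap (s + (β + 1)) (x - -1) := by
  refine (abs_fL_le hs0 (abs_datum_le hβ hK0 hK) ?_).trans_eq ?_
  · simpa only [mul_left_comm] using
      (integrable_kap_mul_kap hs0 (b := β + 1) (by linarith) x (-1)).const_mul
        (K * Real.Gamma (β + 1))
  · rw [fL_const_mul, fL_kap hs0 (by linarith)]

lemma abs_solDeriv_le {α β s K : ℝ} (hs0 : 0 < s) (hβ : -1 < β) {G : ℝ → ℝ}
    (hK0 : 0 ≤ K) (hK : ∀ᵐ x ∂volI, |G x| ≤ K * (1 - x) ^ α) (y : ℝ) :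
    |solDeriv α β s G y| ≤ K * (Real.Gamma (β + 1) / Real.Gamma (s + (β + 1))) *
      cut (weight (α - s) 0) y := by
  by_cases hy : y ∈ Ioo (-1 : ℝ) 1
  · rw [solDeriv, cut_of_mem hy, cut_of_mem hy, abs_mul, abs_of_pos (weight_pos hy)]
    have h0 : 0 < y - -1 := by linarith [hy.1]
    refine (mul_le_mul_of_nonneg_left (abs_fL_datum_le hs0 hβ hK0 hK y)
      (weight_pos hy).le).trans_eq ?_
    rw [kap_of_pos h0, ← show weight (α - s) (-β - s) y * weight 0 (β + s) y = weight (α - s) 0 y by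
      rw [weight_mul_weight hy]; ring_nf]
    rw [show weight 0 (β + s) y = (y - -1) ^ (s + (β + 1) - 1) by
      rw [weight, Real.rpow_zero, one_mul]; ring_nf]
    ring
  · rw [solDeriv, cut_of_notMem hy, cut_of_notMem hy, abs_zero, mul_zero]

lemma integrable_kap_mul_cut_weight {a c : ℝ} (ha : 0 < a) (hc : -1 < c) {x : ℝ} (hx : -1 ≤ x) :
    (Integrable fun y => kap a (y - x) * cut (weight c 0) y) ∧
      fR a (cut (weight c 0)) x = Real.Gamma (c + 1) * kap (a + (c + 1)) (1 - x) := by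
  have e : ∀ y, kap a (y - x) * cut (weight c 0) y =
      Real.Gamma (c + 1) * (kap a (y - x) * kap (c + 1) (1 - y)) := fun y => by
    rcases le_or_gt y x with h | h
    · rw [kap_of_nonpos (by linarith)]; ring
    · rcases lt_or_ge y 1 with h1 | h1
      · rw [cut_of_mem ⟨hx.trans_lt h, h1⟩, weight, Real.rpow_zero, mul_one,
          rpow_eq_kap (by linarith) (by linarith)]
        ring
      · rw [cut_of_notMem fun h' => h'.2.not_ge h1, kap_of_nonpos (t := 1 - y) (by linarith)]
        ring
  refine ⟨?_, ?_⟩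
  · simp only [e]
    exact (integrable_fR_kap ha (by linarith) 1 x).const_mul _
  · rw [fR]
    simp only [e]
    rw [integral_const_mul]
    congr 1
    exact fR_kap ha (by linarith) 1 x

/-- The constant in the sup norm bound of the solution operator. -/
def solConst (α β s : ℝ) : ℝ :=
  Real.Gamma (β + 1) / Real.Gamma (s + (β + 1)) *
    (Real.Gamma (α - s + 1) / Real.Gamma (α + 1))

lemma solConst_nonneg {α β s : ℝ} (hs0 : 0 < s) (hα : s - 1 < α) (hβ : -1 < β) :
    0 ≤ solConst α β s := by
  have := Real.Gamma_pos_of_pos (show 0 < β + 1 by linarith)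
  have := Real.Gamma_pos_of_pos (show 0 < s + (β + 1) by linarith)
  have := Real.Gamma_pos_of_pos (show 0 < α - s + 1 by linarith)
  have := Real.Gamma_pos_of_pos (show 0 < α + 1 by linarith)
  unfold solConst
  positivity

/-- T has a nonnegative kernel, and (1-x)^α is a multiple of its eigenfunction for n = 0; the
constant `solConst` is accordingly 1/λ_0. -/
lemma abs_solOp_le {α β s K : ℝ} (hs0 : 0 < s) (hα : s - 1 < α) (hβ : -1 < β) {G : ℝ → ℝ}
    (hK0 : 0 ≤ K) (hK : ∀ᵐ x ∂volI, |G x| ≤ K * (1 - x) ^ α) {x : ℝ} (hx : x ∈ Ioo (-1 : ℝ) 1) :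
    |solOp α β s G x| ≤ K * solConst α β s * (1 - x) ^ α := by
  obtain ⟨hi, he⟩ := integrable_kap_mul_cut_weight hs0 (c := α - s) (by linarith) hx.1.le
  refine (abs_fR_le hs0 (Eventually.of_forall (abs_solDeriv_le hs0 hβ hK0 hK)) ?_).trans_eq ?_
  · simpa only [mul_left_comm] using
      hi.const_mul (K * (Real.Gamma (β + 1) / Real.Gamma (s + (β + 1))))
  · rw [fR_const_mul, he, kap_of_pos (by linarith [hx.2]), solConst,
      show s + (α - s + 1) = α + 1 by ring, add_sub_cancel_right]
    ring

lemma solOp_of_one_le {α β s : ℝ} {G : ℝ → ℝ} {x : ℝ} (hx : 1 ≤ x) : solOp α β s G x = 0 := by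
  rw [solOp, fR_congr_gt (f := solDeriv α β s G) (g := fun _ => 0)
    fun y hy => cut_of_notMem fun h => h.2.not_ge (hx.trans hy.le)]
  simp [fR]

lemma aestronglyMeasurable_solDeriv {α β s : ℝ} {G : ℝ → ℝ} (hG : AEStronglyMeasurable G volI) :
    AEStronglyMeasurable (solDeriv α β s G) :=
  aestronglyMeasurable_cut.2 ((measurable_weight _ _).aestronglyMeasurable.mul
    (aestronglyMeasurable_fL (aestronglyMeasurable_datum hG)).restrict)

lemma aestronglyMeasurable_solOp {α β s : ℝ} {G : ℝ → ℝ} (hG : AEStronglyMeasurable G volI) :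
    AEStronglyMeasurable (solOp α β s G) :=
  aestronglyMeasurable_fR (aestronglyMeasurable_solDeriv hG)

lemma integral_rpow_mul_datum_nonneg {α β : ℝ} {G : ℝ → ℝ} :
    0 ≤ ∫ z, (1 - z) ^ α * |datum α β G z| := by
  rw [rpow_mul_abs_datum]
  refine integral_nonneg fun z => ?_
  by_cases hz : z ∈ Ioo (-1 : ℝ) 1
  · rw [cut_of_mem hz]
    exact mul_nonneg (weight_pos hz).le (mul_nonneg (abs_nonneg _)
      (Real.rpow_nonneg (by linarith [hz.2]) _))
  · rw [cut_of_notMem hz]; rfl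

/-! ### Smallness of the solution operator up to an L¹ term. -/

/-- Near 0 the kernel κ_s is less singular than κ_{s/2} by a factor of order t^{s/2}, which is
small; beyond the threshold t = e^{2/s} it is bounded, because s < 1. -/
lemma kap_le_add {s η : ℝ} (hs0 : 0 < s) (hs1 : s < 1) (hη : 0 < η) :
    ∃ C, 0 ≤ C ∧ ∀ t, kap s t ≤ η * kap (s / 2) t + C * kap 1 t := by
  have g1 := Real.Gamma_pos_of_pos hs0
  have g2 := Real.Gamma_pos_of_pos (half_pos hs0)
  set e := η * Real.Gamma s / Real.Gamma (s / 2) with he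
  have he0 : 0 < e := by positivity
  refine ⟨(e ^ (2 / s)) ^ (s - 1) / Real.Gamma s, by positivity, fun t => ?_⟩
  rcases le_or_gt t 0 with ht | ht
  · simp [kap_of_nonpos ht]
  rw [kap_one, if_pos ht, mul_one, kap_of_pos ht, kap_of_pos ht]
  rcases le_or_gt (t ^ (s / 2)) e with h | h
  · have h1 : t ^ (s - 1) = t ^ (s / 2) * t ^ (s / 2 - 1) := by
      rw [← Real.rpow_add ht]; ring_nf
    have h2 : t ^ (s - 1) / Real.Gamma s ≤ η * (t ^ (s / 2 - 1) / Real.Gamma (s / 2)) := by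
      rw [h1, div_le_iff₀ g1]
      calc t ^ (s / 2) * t ^ (s / 2 - 1) ≤ e * t ^ (s / 2 - 1) := by gcongr
        _ = _ := by rw [he]; ring
    have : 0 ≤ (e ^ (2 / s)) ^ (s - 1) / Real.Gamma s := by positivity
    linarith
  · have h1 : e ^ (2 / s) ≤ t := by
      have := Real.rpow_le_rpow he0.le h.le (show 0 ≤ 2 / s by positivity)
      rwa [← Real.rpow_mul ht.le, show s / 2 * (2 / s) = 1 by field_simp, Real.rpow_one] at this
    have h2 : t ^ (s - 1) ≤ (e ^ (2 / s)) ^ (s - 1) :=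
      Real.rpow_le_rpow_of_nonpos (by positivity) h1 (by linarith)
    have h3 : 0 ≤ η * (t ^ (s / 2 - 1) / Real.Gamma (s / 2)) := by positivity
    have h4 : t ^ (s - 1) / Real.Gamma s ≤ (e ^ (2 / s)) ^ (s - 1) / Real.Gamma s := by gcongr
    linarith

/-- Split according to whether (1-z)^{1/2} ≤ η. Near 1 the pointwise bound K(1+z)^β gains a factor η
at the price of the integrable (1-z)^{-1/2}; away from 1 the factor (1-z)^α is bounded below, so the
weighted L¹ norm controls the rest. -/
lemma integral_abs_datum_le {α β η : ℝ} (hα : -1 < α) (hβ : -1 < β) (hη : 0 < η) :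
    ∃ C, 0 ≤ C ∧ ∀ (G : ℝ → ℝ) (K : ℝ), AEStronglyMeasurable G volI → 0 ≤ K →
      (∀ᵐ x ∂volI, |G x| ≤ K * (1 - x) ^ α) →
      (Integrable fun z => |datum α β G z|) ∧
      ∫ z, |datum α β G z| ≤ η * K * (∫ z, cut (weight (-1 / 2) β) z) +
        C * ∫ z, (1 - z) ^ α * |datum α β G z| := by
  refine ⟨(η ^ 2) ^ (-α) + 2 ^ (-α), by positivity, fun G K hG hK0 hK => ?_⟩
  have hpt : ∀ᵐ z, |datum α β G z| ≤ η * K * cut (weight (-1 / 2) β) z +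
      ((η ^ 2) ^ (-α) + 2 ^ (-α)) * ((1 - z) ^ α * |datum α β G z|) := by
    filter_upwards [abs_datum_le hβ hK0 hK] with z hz
    by_cases hzI : z ∈ Ioo (-1 : ℝ) 1
    · have h0 : 0 < 1 - z := by linarith [hzI.2]
      have h1 : 0 < 1 + z := by linarith [hzI.1]
      have hw : weight (-1 / 2) β z = (1 - z) ^ (-1 / 2 : ℝ) * (1 + z) ^ β := rfl
      rw [mul_assoc, sub_neg_eq_add, add_comm z 1, ← rpow_eq_kap (by linarith) h1] at hz
      rw [cut_of_mem hzI, hw]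
      rcases le_or_gt ((1 - z) ^ (1 / 2 : ℝ)) η with h | h
      · have h2 : 1 ≤ η * (1 - z) ^ (-1 / 2 : ℝ) := by
          rw [show (-1 / 2 : ℝ) = -(1 / 2) by ring, Real.rpow_neg h0.le, ← div_eq_mul_inv,
            one_le_div (by positivity)]
          exact h
        have h3 : K * (1 + z) ^ β * 1 ≤
            K * (1 + z) ^ β * (η * (1 - z) ^ (-1 / 2 : ℝ)) := by gcongr
        have h4 : 0 ≤ ((η ^ 2) ^ (-α) + 2 ^ (-α)) * ((1 - z) ^ α * |datum α β G z|) := by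
          positivity
        linarith
      · have h2 : η ^ 2 ≤ 1 - z := by
          rw [← Real.sqrt_eq_rpow] at h
          exact (Real.lt_sqrt hη.le).1 h |>.le
        have h3 := rpow_le_add (by positivity) h2 (by linarith [hzI.1]) (-α)
        have h4 : 1 ≤ ((η ^ 2) ^ (-α) + 2 ^ (-α)) * (1 - z) ^ α := by
          have : (1 - z) ^ (-α) * (1 - z) ^ α = 1 := by
            rw [← Real.rpow_add h0, neg_add_cancel, Real.rpow_zero]
          exact this.symm.le.trans (mul_le_mul_of_nonneg_right h3 (by positivity))
        have h5 := mul_le_mul_of_nonneg_right h4 (abs_nonneg (datum α β G z))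
        have h6 : 0 ≤ η * K * ((1 - z) ^ (-1 / 2 : ℝ) * (1 + z) ^ β) := by positivity
        linarith
    · simp [datum, cut_of_notMem hzI]
  have i1 := (integrable_rpow_mul_datum hα hβ (memLp_two_of_bound hα hβ hG hK)).1
  have i2 := integrable_cut_weight (a := -1 / 2) (b := β) (by norm_num) hβ
  have i3 := (i2.const_mul (η * K)).add (i1.const_mul ((η ^ 2) ^ (-α) + 2 ^ (-α)))
  have i4 : Integrable fun z => |datum α β G z| :=
    i3.mono' (aestronglyMeasurable_datum hG).norm (by simpa using hpt)
  refine ⟨i4, ?_⟩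
  refine (integral_mono_ae i4 i3 hpt).trans_eq ?_
  simp only [Pi.add_apply]
  rw [integral_add (i2.const_mul _) (i1.const_mul _), integral_const_mul, integral_const_mul]

/-- After splitting κ_s, the part with κ_{s/2} is estimated by the pointwise bound on the datum and
the part with κ_1 by its L¹ norm. The crude factor (1+y)⁻¹ absorbs (1+y)^{β+s/2} for every β > -1
and is removed in `abs_solDeriv_le_small`, where it is used only away from -1. -/
lemma abs_fL_datum_le_small {α β s η : ℝ} (hs0 : 0 < s) (hs1 : s < 1) (hα : -1 < α)
    (hβ : -1 < β) (hη : 0 < η) :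
    ∃ C, 0 ≤ C ∧ ∀ (G : ℝ → ℝ) (K : ℝ), AEStronglyMeasurable G volI → 0 ≤ K →
      (∀ᵐ x ∂volI, |G x| ≤ K * (1 - x) ^ α) → ∀ y ∈ Ioo (-1 : ℝ) 1,
      |fL s (datum α β G) y| ≤
        (η * K + C * ∫ z, (1 - z) ^ α * |datum α β G z|) * (1 + y)⁻¹ := by
  have hs2 : 0 < s / 2 := half_pos hs0
  have g1 := Real.Gamma_pos_of_pos (show 0 < β + 1 by linarith)
  have g2 := Real.Gamma_pos_of_pos (show 0 < s / 2 + (β + 1) by linarith)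
  -- The tolerances η/(2 a1) here and η/(4(C1 W + 1)) below are chosen so that the two parts
  -- contribute at most η/2 each; the second one loses a factor 2 through 1 ≤ 2(1+y)⁻¹.
  set a1 := Real.Gamma (β + 1) / Real.Gamma (s / 2 + (β + 1)) * 2 ^ (s / 2 + (β + 1)) with ha1
  have ha1' : 0 < a1 := by positivity
  obtain ⟨C1, hC1, h1⟩ := kap_le_add hs0 hs1 (η := η / (2 * a1)) (by positivity)
  set W := ∫ z, cut (weight (-1 / 2) β) z with hW
  have hW0 : 0 ≤ W := integral_nonneg fun z => by
    by_cases hz : z ∈ Ioo (-1 : ℝ) 1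
    · rw [cut_of_mem hz]; exact (weight_pos hz).le
    · rw [cut_of_notMem hz]; rfl
  obtain ⟨C2, hC2, h2⟩ := integral_abs_datum_le hα hβ (η := η / (4 * (C1 * W + 1)))
    (by positivity)
  refine ⟨2 * C1 * C2, by positivity, fun G K hG hK0 hK y hy => ?_⟩
  set N := ∫ z, (1 - z) ^ α * |datum α β G z| with hN
  have hN0 : 0 ≤ N := integral_rpow_mul_datum_nonneg
  obtain ⟨i1, h3⟩ := h2 G K hG hK0 hK
  have hy0 : 0 < 1 + y := by linarith [hy.1]
  have hbd := abs_datum_le hβ hK0 hK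
  have hdm := aestronglyMeasurable_datum (α := α) (β := β) hG
  have i2 : ∀ a : ℝ, 0 < a → Integrable fun z => kap a (y - z) * |datum α β G z| := fun a ha => by
    refine ((integrable_kap_mul_kap ha (b := β + 1) (by linarith) y (-1)).const_mul
      (K * Real.Gamma (β + 1))).mono'
        ((Measurable.aestronglyMeasurable (by fun_prop)).mul hdm.norm) ?_
    filter_upwards [hbd] with z hz
    rw [Real.norm_of_nonneg (mul_nonneg (kap_nonneg ha _) (abs_nonneg _)), mul_left_comm]
    exact mul_le_mul_of_nonneg_left hz (kap_nonneg ha _)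
  have e1 : |fL s (datum α β G) y| ≤ ∫ z, kap s (y - z) * |datum α β G z| :=
    abs_fL_le hs0 (Eventually.of_forall fun z => le_rfl) (i2 s hs0)
  have e2 : ∫ z, kap s (y - z) * |datum α β G z| ≤ η / (2 * a1) *
      (∫ z, kap (s / 2) (y - z) * |datum α β G z|) + C1 * ∫ z, |datum α β G z| := by
    rw [← integral_const_mul, ← integral_const_mul, ← integral_add ((i2 _ hs2).const_mul _)
      (i1.const_mul _)]
    refine integral_mono (i2 s hs0) (((i2 _ hs2).const_mul _).add (i1.const_mul _)) fun z => ?_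
    have h5 : kap 1 (y - z) ≤ 1 := by rw [kap_one]; split_ifs <;> norm_num
    calc kap s (y - z) * |datum α β G z|
        ≤ (η / (2 * a1) * kap (s / 2) (y - z) + C1 * 1) * |datum α β G z| := by
          gcongr
          exact (h1 _).trans (by gcongr)
      _ = _ := by ring
  have e3 : ∫ z, kap (s / 2) (y - z) * |datum α β G z| ≤ K * a1 * (1 + y)⁻¹ := by
    have h5 : ∫ z, kap (s / 2) (y - z) * |datum α β G z| ≤
        K * Real.Gamma (β + 1) * kap (s / 2 + (β + 1)) (y - -1) := by
      rw [← integral_kap_mul_kap hs2 (by linarith), ← integral_const_mul]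
      refine integral_mono_ae (i2 _ hs2) ((integrable_kap_mul_kap hs2 (by linarith) _ _).const_mul
        _) ?_
      filter_upwards [hbd] with z hz
      rw [mul_left_comm]
      exact mul_le_mul_of_nonneg_left hz (kap_nonneg hs2 _)
    refine h5.trans ?_
    rw [sub_neg_eq_add, add_comm y 1, kap_of_pos hy0, Real.rpow_sub_one hy0.ne', ha1]
    have h6 : (1 + y) ^ (s / 2 + (β + 1)) ≤ 2 ^ (s / 2 + (β + 1)) :=
      Real.rpow_le_rpow hy0.le (by linarith [hy.2]) (by linarith)
    calc K * Real.Gamma (β + 1) * ((1 + y) ^ (s / 2 + (β + 1)) / (1 + y) /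
          Real.Gamma (s / 2 + (β + 1)))
        = K * Real.Gamma (β + 1) / Real.Gamma (s / 2 + (β + 1)) * (1 + y)⁻¹ *
          (1 + y) ^ (s / 2 + (β + 1)) := by ring
      _ ≤ K * Real.Gamma (β + 1) / Real.Gamma (s / 2 + (β + 1)) * (1 + y)⁻¹ *
          2 ^ (s / 2 + (β + 1)) := by gcongr
      _ = _ := by ring
  have hy1 : 1 ≤ 2 * (1 + y)⁻¹ := by
    rw [← div_eq_mul_inv, one_le_div hy0]
    linarith [hy.2]
  have hinv : 0 < (1 + y)⁻¹ := by positivity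
  have e4 : C1 * ∫ z, |datum α β G z| ≤ (η / 2 * K + 2 * C1 * C2 * N) * (1 + y)⁻¹ := by
    have h7 : C1 * (η / (4 * (C1 * W + 1)) * K * W) ≤ η / 4 * K := by
      rw [show C1 * (η / (4 * (C1 * W + 1)) * K * W) =
        η / 4 * K * (C1 * W / (C1 * W + 1)) by field_simp]
      refine mul_le_of_le_one_right (by positivity) ?_
      rw [div_le_one (by positivity)]
      linarith
    calc C1 * ∫ z, |datum α β G z| ≤ C1 * (η / (4 * (C1 * W + 1)) * K * W + C2 * N) := by gcongr
      _ = C1 * (η / (4 * (C1 * W + 1)) * K * W) + C1 * C2 * N := by ring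
      _ ≤ (η / 4 * K + C1 * C2 * N) * 1 := by linarith
      _ ≤ (η / 4 * K + C1 * C2 * N) * (2 * (1 + y)⁻¹) := by gcongr
      _ = _ := by ring
  calc |fL s (datum α β G) y| ≤ η / (2 * a1) * (K * a1 * (1 + y)⁻¹) +
        (η / 2 * K + 2 * C1 * C2 * N) * (1 + y)⁻¹ := by
        refine e1.trans (e2.trans ?_)
        gcongr
    _ = _ := by field_simp; ring

/-- For 1+y ≤ δ the plain bound suffices, since (1+y)^{-s/2} is large there and supplies the small
factor; for 1+y > δ all powers of 1+y are bounded and `abs_fL_datum_le_small` applies. The price is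
a singularity (1+y)^{-s/2} at -1, mild enough to survive the last fractional integration. -/
lemma abs_solDeriv_le_small {α β s ε : ℝ} (hs0 : 0 < s) (hs1 : s < 1) (hα : s - 1 < α)
    (hβ : -1 < β) (hε : 0 < ε) :
    ∃ C, 0 ≤ C ∧ ∀ (G : ℝ → ℝ) (K : ℝ), AEStronglyMeasurable G volI → 0 ≤ K →
      (∀ᵐ x ∂volI, |G x| ≤ K * (1 - x) ^ α) → ∀ y ∈ Ioo (-1 : ℝ) 1,
      |solDeriv α β s G y| ≤ (ε * K + C * ∫ z, (1 - z) ^ α * |datum α β G z|) *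
        weight (α - s) (-s / 2) y := by
  have g1 := Real.Gamma_pos_of_pos (show 0 < β + 1 by linarith)
  have g2 := Real.Gamma_pos_of_pos (show 0 < s + (β + 1) by linarith)
  set c1 := Real.Gamma (β + 1) / Real.Gamma (s + (β + 1)) with hc1
  have hc1' : 0 < c1 := by positivity
  set δ := (ε / c1) ^ (2 / s) with hδ
  have hδ0 : 0 < δ := by positivity
  set B := δ ^ (-1 - β - s / 2) + 2 ^ (-1 - β - s / 2) with hB
  have hB0 : 0 < B := by positivity
  obtain ⟨C, hC, h1⟩ := abs_fL_datum_le_small hs0 hs1 (show -1 < α by linarith) hβ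
    (η := ε / B) (by positivity)
  refine ⟨C * B, by positivity, fun G K hG hK0 hK y hy => ?_⟩
  set N := ∫ z, (1 - z) ^ α * |datum α β G z| with hN
  have hN0 : 0 ≤ N := integral_rpow_mul_datum_nonneg
  have hy0 : 0 < 1 + y := by linarith [hy.1]
  have hw := weight_pos (a := α - s) (b := -s / 2) hy
  rcases le_or_gt (1 + y) δ with h | h
  · have h2 := abs_solDeriv_le hs0 hβ hK0 hK y (s := s)
    rw [cut_of_mem hy, ← hc1] at h2
    have h3 : c1 ≤ ε * (1 + y) ^ (-s / 2) := by
      have h4 : (1 + y) ^ (s / 2) ≤ ε / c1 := by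
        have := Real.rpow_le_rpow hy0.le h (show 0 ≤ s / 2 by positivity)
        rwa [hδ, ← Real.rpow_mul (by positivity), show 2 / s * (s / 2) = 1 by field_simp,
          Real.rpow_one] at this
      rw [neg_div, Real.rpow_neg hy0.le, ← div_eq_mul_inv, le_div_iff₀ (by positivity), mul_comm]
      rwa [le_div_iff₀ hc1'] at h4
    have h5 : weight (α - s) (-s / 2) y = (1 + y) ^ (-s / 2) * weight (α - s) 0 y := by
      rw [weight, weight, Real.rpow_zero]; ring
    have hw0 := weight_pos (a := α - s) (b := 0) hy
    calc |solDeriv α β s G y| ≤ K * c1 * weight (α - s) 0 y := h2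
      _ ≤ K * (ε * (1 + y) ^ (-s / 2)) * weight (α - s) 0 y := by gcongr
      _ = ε * K * weight (α - s) (-s / 2) y := by rw [h5]; ring
      _ ≤ _ := by
        gcongr
        have : 0 ≤ C * B * N := by positivity
        linarith
  · have h2 := h1 G K hG hK0 hK y hy
    rw [← hN] at h2
    have h3 := rpow_le_add hδ0 h.le (by linarith [hy.2]) (-1 - β - s / 2)
    rw [solDeriv, cut_of_mem hy, abs_mul, abs_of_pos (weight_pos hy)]
    have h4 : weight (α - s) (-β - s) y * (1 + y)⁻¹ =
        (1 + y) ^ (-1 - β - s / 2) * weight (α - s) (-s / 2) y := by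
      rw [weight, weight, ← Real.rpow_neg_one, mul_assoc, mul_left_comm ((1 + y) ^ _),
        ← Real.rpow_add hy0, ← Real.rpow_add hy0]
      ring_nf
    have hww := weight_pos (a := α - s) (b := -β - s) hy
    calc weight (α - s) (-β - s) y * |fL s (datum α β G) y|
        ≤ weight (α - s) (-β - s) y * ((ε / B * K + C * N) * (1 + y)⁻¹) := by gcongr
      _ = (ε / B * K + C * N) * ((1 + y) ^ (-1 - β - s / 2) * weight (α - s) (-s / 2) y) := by
          rw [← h4]; ring
      _ ≤ (ε / B * K + C * N) * (B * weight (α - s) (-s / 2) y) := by gcongr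
      _ = _ := by field_simp

/-- Where 1+y ≥ 1/2 the extra factor (1+y)^{-s/2} is bounded. Where 1+y < 1/2 it is at most
(y-x)^{-s/2}, which only lowers the order of the kernel from s to s/2. -/
lemma fR_weight_le {α s : ℝ} (hs0 : 0 < s) (hα : s - 1 < α) :
    ∃ C, 0 ≤ C ∧ ∀ x ∈ Ioo (-1 : ℝ) 1,
      (Integrable fun y => kap s (y - x) * cut (weight (α - s) (-s / 2)) y) ∧
      fR s (cut (weight (α - s) (-s / 2))) x ≤ C * (1 - x) ^ α := by
  have hs2 : 0 < s / 2 := half_pos hs0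
  have g0 := Real.Gamma_pos_of_pos hs0
  have g0' := Real.Gamma_pos_of_pos hs2
  have g1 := Real.Gamma_pos_of_pos (show 0 < α - s + 1 by linarith)
  have g2 := Real.Gamma_pos_of_pos (show 0 < α + 1 by linarith)
  have g3 := Real.Gamma_pos_of_pos (show 0 < α - s / 2 + 1 by linarith)
  set c := Real.Gamma (s / 2) / Real.Gamma s with hc
  have hc0 : 0 < c := by positivity
  refine ⟨2 ^ (s / 2) * (Real.Gamma (α - s + 1) / Real.Gamma (α + 1)) +
    c * (Real.Gamma (α - s + 1) / Real.Gamma (α - s / 2 + 1)), by positivity, fun x hx => ?_⟩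
  obtain ⟨i1, e1⟩ := integrable_kap_mul_cut_weight hs0 (c := α - s) (by linarith) hx.1.le
  obtain ⟨i2, e2⟩ := integrable_kap_mul_cut_weight hs2 (c := α - s) (by linarith) hx.1.le
  -- The second case needs x < y < -1/2. Then 1 - x ≥ 1, so the power (1-x)^{α-s/2} coming from
  -- order s/2 is at most (1-x)^α; θ switches that term off for all other x.
  set θ : ℝ := if x < -1 / 2 then 1 else 0 with hθ
  have hθ0 : 0 ≤ θ := by rw [hθ]; split_ifs <;> norm_num
  have hpt : ∀ y, kap s (y - x) * cut (weight (α - s) (-s / 2)) y ≤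
      2 ^ (s / 2) * (kap s (y - x) * cut (weight (α - s) 0) y) +
        θ * c * (kap (s / 2) (y - x) * cut (weight (α - s) 0) y) := fun y => by
    by_cases hy : y ∈ Ioo (-1 : ℝ) 1
    · have hw := weight_pos (a := α - s) (b := 0) hy
      have hy0 : 0 < 1 + y := by linarith [hy.1]
      have h5 : weight (α - s) (-s / 2) y = (1 + y) ^ (-s / 2) * weight (α - s) 0 y := by
        rw [weight, weight, Real.rpow_zero]; ring
      rw [cut_of_mem hy, cut_of_mem hy, h5]
      rcases le_or_gt y x with hxy | hxy
      · simp [kap_of_nonpos (show y - x ≤ 0 by linarith)]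
      have hyx : 0 < y - x := by linarith
      have k1 := kap_nonneg hs0 (y - x)
      have k2 := kap_nonneg hs2 (y - x)
      rcases le_or_gt (1 / 2) (1 + y) with h | h
      · have h6 : (1 + y) ^ (-s / 2) ≤ 2 ^ (s / 2) := by
          have := Real.rpow_le_rpow_of_nonpos (by norm_num) h (show -s / 2 ≤ 0 by linarith)
          refine this.trans_eq ?_
          rw [neg_div, Real.rpow_neg (by norm_num), ← Real.inv_rpow (by norm_num)]
          norm_num
        have h7 : 0 ≤ θ * c * (kap (s / 2) (y - x) * weight (α - s) 0 y) := by positivity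
        calc kap s (y - x) * ((1 + y) ^ (-s / 2) * weight (α - s) 0 y)
            ≤ kap s (y - x) * (2 ^ (s / 2) * weight (α - s) 0 y) := by gcongr
          _ ≤ _ := by linarith
      · have hxx : θ = 1 := by rw [hθ, if_pos (by linarith)]
        have h6 : (1 + y) ^ (-s / 2) ≤ (y - x) ^ (-s / 2) :=
          Real.rpow_le_rpow_of_nonpos hyx (by linarith [hx.1]) (by linarith)
        have h7 : kap s (y - x) * (y - x) ^ (-s / 2) = c * kap (s / 2) (y - x) := by
          rw [kap_of_pos hyx, kap_of_pos hyx, div_mul_eq_mul_div, ← Real.rpow_add hyx, hc]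
          rw [show s - 1 + -s / 2 = s / 2 - 1 by ring]
          field_simp
        have h8 : 0 ≤ 2 ^ (s / 2) * (kap s (y - x) * weight (α - s) 0 y) := by positivity
        calc kap s (y - x) * ((1 + y) ^ (-s / 2) * weight (α - s) 0 y)
            ≤ kap s (y - x) * ((y - x) ^ (-s / 2) * weight (α - s) 0 y) := by gcongr
          _ = kap s (y - x) * (y - x) ^ (-s / 2) * weight (α - s) 0 y := by ring
          _ = θ * c * (kap (s / 2) (y - x) * weight (α - s) 0 y) := by rw [h7, hxx]; ring
          _ ≤ _ := by linarith
    · simp [cut_of_notMem hy]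
  have i3 := (i1.const_mul (2 ^ (s / 2))).add (i2.const_mul (θ * c))
  have i4 : Integrable fun y => kap s (y - x) * cut (weight (α - s) (-s / 2)) y := by
    refine i3.mono' (((measurable_kap s).comp (measurable_id.sub_const x)).aestronglyMeasurable.mul
      (aestronglyMeasurable_cut.2 (measurable_weight _ _).aestronglyMeasurable)) ?_
    refine Eventually.of_forall fun y => ?_
    rw [Real.norm_of_nonneg]
    · exact hpt y
    · refine mul_nonneg (kap_nonneg hs0 _) ?_
      by_cases hy : y ∈ Ioo (-1 : ℝ) 1
      · rw [cut_of_mem hy]; exact (weight_pos hy).le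
      · rw [cut_of_notMem hy]
  refine ⟨i4, ?_⟩
  have h1 : fR s (cut (weight (α - s) (-s / 2))) x ≤
      2 ^ (s / 2) * fR s (cut (weight (α - s) 0)) x +
        θ * c * fR (s / 2) (cut (weight (α - s) 0)) x := by
    refine (integral_mono i4 i3 hpt).trans_eq ?_
    simp only [Pi.add_apply]
    rw [integral_add (i1.const_mul _) (i2.const_mul _), integral_const_mul, integral_const_mul]
    rfl
  refine h1.trans ?_
  have hx0 : 0 < 1 - x := by linarith [hx.2]
  rw [e1, e2, kap_of_pos hx0, kap_of_pos hx0, show s + (α - s + 1) - 1 = α by ring,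
    show s + (α - s + 1) = α + 1 by ring, show s / 2 + (α - s + 1) = α - s / 2 + 1 by ring,
    show α - s / 2 + 1 - 1 = α + -(s / 2) by ring]
  have h2 : θ * (1 - x) ^ (α + -(s / 2)) ≤ (1 - x) ^ α := by
    rw [hθ]
    split_ifs with h
    · rw [one_mul]
      exact Real.rpow_le_rpow_of_exponent_le (by linarith) (by linarith)
    · rw [zero_mul]; positivity
  calc 2 ^ (s / 2) * (Real.Gamma (α - s + 1) * ((1 - x) ^ α / Real.Gamma (α + 1))) +
      θ * c * (Real.Gamma (α - s + 1) * ((1 - x) ^ (α + -(s / 2)) / Real.Gamma (α - s / 2 + 1)))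
      = 2 ^ (s / 2) * (Real.Gamma (α - s + 1) / Real.Gamma (α + 1)) * (1 - x) ^ α +
        c * (Real.Gamma (α - s + 1) / Real.Gamma (α - s / 2 + 1)) *
          (θ * (1 - x) ^ (α + -(s / 2))) := by ring
    _ ≤ 2 ^ (s / 2) * (Real.Gamma (α - s + 1) / Real.Gamma (α + 1)) * (1 - x) ^ α +
        c * (Real.Gamma (α - s + 1) / Real.Gamma (α - s / 2 + 1)) * (1 - x) ^ α := by gcongr
    _ = _ := by ring

/-- The solution operator is small in the weighted sup norm up to an `L¹` term. -/
lemma abs_solOp_le_small {α β s ε : ℝ} (hs0 : 0 < s) (hs1 : s < 1) (hα : s - 1 < α)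
    (hβ : -1 < β) (hε : 0 < ε) :
    ∃ C, 0 ≤ C ∧ ∀ (G : ℝ → ℝ) (K : ℝ), AEStronglyMeasurable G volI → 0 ≤ K →
      (∀ᵐ x ∂volI, |G x| ≤ K * (1 - x) ^ α) → ∀ x ∈ Ioo (-1 : ℝ) 1,
      |solOp α β s G x| ≤
        (ε * K + C * ∫ z, (1 - z) ^ α * |datum α β G z|) * (1 - x) ^ α := by
  obtain ⟨C1, hC1, h1⟩ := fR_weight_le hs0 hα
  obtain ⟨C2, hC2, h2⟩ := abs_solDeriv_le_small hs0 hs1 hα hβ (ε := ε / (C1 + 1))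
    (by positivity)
  refine ⟨C2 * C1, by positivity, fun G K hG hK0 hK x hx => ?_⟩
  set N := ∫ z, (1 - z) ^ α * |datum α β G z| with hN
  obtain ⟨i1, h3⟩ := h1 x hx
  have h4 : ∀ y, |solDeriv α β s G y| ≤ (ε / (C1 + 1) * K + C2 * N) *
      cut (weight (α - s) (-s / 2)) y := fun y => by
    by_cases hy : y ∈ Ioo (-1 : ℝ) 1
    · rw [cut_of_mem hy]; exact h2 G K hG hK0 hK y hy
    · rw [cut_of_notMem hy, solDeriv, cut_of_notMem hy]; simp
  have hN0 : 0 ≤ N := integral_rpow_mul_datum_nonneg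
  have hx0 : 0 ≤ (1 - x) ^ α := Real.rpow_nonneg (by linarith [hx.2]) _
  have h5 : |solOp α β s G x| ≤ (ε / (C1 + 1) * K + C2 * N) *
      fR s (cut (weight (α - s) (-s / 2))) x := by
    rw [← fR_const_mul]
    exact abs_fR_le hs0 (Eventually.of_forall h4)
      (by simpa only [mul_left_comm] using i1.const_mul (ε / (C1 + 1) * K + C2 * N))
  have h6 : ε / (C1 + 1) * K * C1 ≤ ε * K := by
    rw [show ε / (C1 + 1) * K * C1 = ε * K * (C1 / (C1 + 1)) by field_simp]
    refine mul_le_of_le_one_right (by positivity) ?_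
    rw [div_le_one (by positivity)]
    linarith
  calc |solOp α β s G x| ≤ (ε / (C1 + 1) * K + C2 * N) * (C1 * (1 - x) ^ α) :=
        h5.trans (by gcongr)
    _ = (ε / (C1 + 1) * K * C1 + C2 * C1 * N) * (1 - x) ^ α := by ring
    _ ≤ _ := by gcongr

/-! ### Existence: the solution operator produces solutions. -/

lemma absolutelyContinuousOnInterval_congr {f g : ℝ → ℝ} {a b : ℝ}
    (hf : AbsolutelyContinuousOnInterval f a b) (h : ∀ x ∈ uIcc a b, f x = g x) :
    AbsolutelyContinuousOnInterval g a b := by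
  rw [absolutelyContinuousOnInterval_iff] at hf ⊢
  intro ε hε
  obtain ⟨δ, hδ, H⟩ := hf ε hε
  refine ⟨δ, hδ, fun E hE hlt => ?_⟩
  have hE' := hE
  simp only [AbsolutelyContinuousOnInterval.disjWithin, mem_ofPred_eq] at hE'
  refine (Finset.sum_congr rfl fun i hi => ?_).trans_lt (H E hE hlt)
  obtain ⟨h1, h2⟩ := hE'.1 i hi
  rw [h _ h1, h _ h2]

lemma LocAC.congr {f g : ℝ → ℝ} (hf : LocAC f) (h : ∀ x ∈ Ioo (-1 : ℝ) 1, f x = g x) :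
    LocAC g := fun a b ha hab hb =>
  absolutelyContinuousOnInterval_congr (hf a b ha hab hb) fun x hx => by
    rw [uIcc_of_le hab] at hx
    exact h x ⟨ha.trans_le hx.1, hx.2.trans_lt hb⟩

lemma locAC_integral {h : ℝ → ℝ} (hi : Integrable h) :
    LocAC fun x => ∫ t in (-1)..x, h t := fun a b ha hab hb => by
  have : IntervalIntegrable h volume (-1) b := hi.intervalIntegrable
  refine (this.absolutelyContinuousOnInterval_intervalIntegral left_mem_uIcc).mono ?_
  rw [uIcc_of_le hab, uIcc_of_le (by linarith)]
  exact Icc_subset_Icc ha.le le_rfl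

lemma integral_left_one {h : ℝ → ℝ} (hi : Integrable h) (x : ℝ) :
    ∫ t in x..1, h t = (∫ t in (-1)..1, h t) - ∫ t in (-1)..x, h t := by
  rw [intervalIntegral.integral_interval_sub_left hi.intervalIntegrable hi.intervalIntegrable]

/-- The flux is identified only almost everywhere, but its boundary condition at 1 is pointwise. A
local Lipschitz bound for the primitive bounds `deriv` at every point; where the primitive is not
differentiable, `deriv` is 0. -/
lemma abs_deriv_integral_le {h g : ℝ → ℝ} (hi : Integrable h) {x : ℝ} (hx : x ∈ Ioo (-1 : ℝ) 1)
    (hg : ContinuousAt g x) (hgx : 0 < g x) (hb : ∀ t ∈ Ioo (-1 : ℝ) 1, |h t| ≤ g t) :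
    |deriv (fun x => ∫ t in (-1)..x, h t) x| ≤ 2 * g x := by
  have h1 : ∀ᶠ t in 𝓝 x, g t ≤ 2 * g x := hg.eventually (Iic_mem_nhds (by linarith))
  obtain ⟨δ, hδ, H⟩ := Metric.eventually_nhds_iff_ball.1 (h1.and (isOpen_Ioo.mem_nhds hx))
  rw [← Real.norm_eq_abs]
  refine norm_deriv_le_of_lip' (by linarith) ?_
  filter_upwards [Metric.ball_mem_nhds x hδ] with y hy
  rw [intervalIntegral.integral_interval_sub_left hi.intervalIntegrable hi.intervalIntegrable,
    Real.norm_eq_abs (y - x)]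
  refine intervalIntegral.norm_integral_le_of_norm_le_const fun t ht => ?_
  have htb : t ∈ Metric.ball x δ := by
    have := (convex_ball x δ).ordConnected.uIcc_subset (Metric.mem_ball_self hδ) hy
    exact this (uIoc_subset_uIcc ht)
  exact (hb t (H t htb).2).trans (H t htb).1

section Existence

variable {α β s : ℝ} {G : ℝ → ℝ}

lemma integrable_datum_of_bound {K : ℝ} (hα : -1 < α) (hβ : -1 < β)
    (hG : AEStronglyMeasurable G volI) (hK0 : 0 ≤ K)
    (hK : ∀ᵐ x ∂volI, |G x| ≤ K * (1 - x) ^ α) : Integrable (datum α β G) := by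
  obtain ⟨C, -, h⟩ := integral_abs_datum_le hα hβ one_pos
  exact (integrable_norm_iff (aestronglyMeasurable_datum hG)).1 (h G K hG hK0 hK).1

lemma integrable_solDeriv_of_bound {K : ℝ} (hs0 : 0 < s) (hα : s - 1 < α) (hβ : -1 < β)
    (hG : AEStronglyMeasurable G volI) (hK0 : 0 ≤ K)
    (hK : ∀ᵐ x ∂volI, |G x| ≤ K * (1 - x) ^ α) : Integrable (solDeriv α β s G) :=
  ((integrable_cut_weight (a := α - s) (b := 0) (by linarith) (by norm_num)).const_mul _).mono'
    (aestronglyMeasurable_solDeriv hG)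
    (Eventually.of_forall fun y => abs_solDeriv_le hs0 hβ hK0 hK y)

/-- I^{1-s} I^s = I^1 collapses the fractional integral of the solution to an ordinary primitive, so
its derivative can be read off by Lebesgue's theorem. `leftInt_flux_solOp` is the same argument on
the left. -/
lemma rightInt_solOp (hs0 : 0 < s) (hs1 : s < 1) (hG : AEStronglyMeasurable G volI)
    (hi : Integrable (solDeriv α β s G)) {x : ℝ} (hx : x ∈ Ioo (-1 : ℝ) 1) :
    rightInt s (solOp α β s G) x = ∫ t in x..1, solDeriv α β s G t := by
  have h1 : fR (1 - s) (cut (solOp α β s G)) x = fR (1 - s) (solOp α β s G) x :=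
    fR_congr_gt fun y hy => by
      rcases lt_or_ge y 1 with h | h
      · exact cut_of_mem ⟨hx.1.trans hy, h⟩
      · rw [solOp_of_one_le h, cut_of_notMem fun h' => h'.2.not_ge h]
  have h2 : fR (1 - s) (fR s (solDeriv α β s G)) x = fR 1 (solDeriv α β s G) x := by
    have := (fR_fR (a := 1 - s) (b := s) (by linarith) hs0 (aestronglyMeasurable_solDeriv hG)
      (x := x) (by rw [sub_add_cancel]; exact integrable_kap_one_iff'.2 hi.integrableOn)).2
    rwa [sub_add_cancel] at this
  have h3 : solDeriv α β s G = cut (solDeriv α β s G) := by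
    ext y
    by_cases hy : y ∈ Ioo (-1 : ℝ) 1
    · rw [cut_of_mem hy]
    · rw [cut_of_notMem hy, solDeriv, cut_of_notMem hy]
  rw [rightInt_eq hx, h1, solOp, h2, fR_one]
  conv_lhs => rw [h3]
  rw [integral_Ioi_cut hx]

lemma deriv_rightInt_solOp (hs0 : 0 < s) (hs1 : s < 1) (hG : AEStronglyMeasurable G volI)
    (hi : Integrable (solDeriv α β s G)) {x : ℝ} (hx : x ∈ Ioo (-1 : ℝ) 1) :
    rightDeriv s (solOp α β s G) x = deriv (fun x => ∫ t in (-1)..x, solDeriv α β s G t) x := by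
  have : rightInt s (solOp α β s G) =ᶠ[𝓝 x] fun x => (∫ t in (-1)..1, solDeriv α β s G t) -
      ∫ t in (-1)..x, solDeriv α β s G t := by
    filter_upwards [isOpen_Ioo.mem_nhds hx] with y hy
    rw [rightInt_solOp hs0 hs1 hG hi hy, integral_left_one hi]
  rw [rightDeriv, this.deriv_eq, deriv_const_sub, neg_neg]

lemma flux_solOp_ae (hs0 : 0 < s) (hs1 : s < 1) (hG : AEStronglyMeasurable G volI)
    (hi : Integrable (solDeriv α β s G)) :
    flux α β s (solOp α β s G) =ᵐ[volI] fL s (datum α β G) := by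
  have h1 : ∀ᵐ x ∂volI, ∀ c, HasDerivAt (fun x => ∫ t in c..x, solDeriv α β s G t)
      (solDeriv α β s G x) x := ae_restrict_of_ae
      (LocallyIntegrable.ae_hasDerivAt_integral hi.locallyIntegrable)
  filter_upwards [h1, ae_volI_mem] with x hx hxI
  rw [flux, deriv_rightInt_solOp hs0 hs1 hG hi hxI, (hx (-1)).deriv, solDeriv, cut_of_mem hxI,
    ← mul_assoc, weight_mul_weight hxI]
  rw [show -α + s + (α - s) = 0 by ring, show β + s + (-β - s) = 0 by ring, weight_zero_zero,
    one_mul]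

lemma fL_datum_of_le {x : ℝ} (hx : x ≤ -1) : fL s (datum α β G) x = 0 := by
  rw [fL_congr_lt (f := datum α β G) (g := fun _ => 0)
    fun y hy => cut_of_notMem fun h => h.1.not_gt (hy.trans_le hx)]
  simp [fL]

lemma leftInt_flux_solOp (hs0 : 0 < s) (hs1 : s < 1) (hG : AEStronglyMeasurable G volI)
    (hi : Integrable (solDeriv α β s G)) (hd : Integrable (datum α β G)) {x : ℝ}
    (hx : x ∈ Ioo (-1 : ℝ) 1) :
    leftInt s (flux α β s (solOp α β s G)) x = ∫ t in (-1)..x, datum α β G t := by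
  have h1 : fL (1 - s) (cut (fL s (datum α β G))) x = fL (1 - s) (fL s (datum α β G)) x :=
    fL_congr_lt fun y hy => by
      rcases lt_or_ge (-1) y with h | h
      · exact cut_of_mem ⟨h, hy.trans hx.2⟩
      · rw [fL_datum_of_le h, cut_of_notMem fun h' => h'.1.not_ge h]
  have h2 : fL (1 - s) (fL s (datum α β G)) x = fL 1 (datum α β G) x := by
    have := (fL_fL (a := 1 - s) (b := s) (by linarith) hs0 (aestronglyMeasurable_datum hG)
      (x := x) (by rw [sub_add_cancel]; exact integrable_kap_one_iff.2 hd.integrableOn)).2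
    rwa [sub_add_cancel] at this
  have h3 : datum α β G = cut (datum α β G) := by
    ext y
    by_cases hy : y ∈ Ioo (-1 : ℝ) 1
    · rw [cut_of_mem hy]
    · rw [cut_of_notMem hy, datum, cut_of_notMem hy]
  rw [leftInt_eq hx, fL_congr_ae (cut_congr_ae (flux_solOp_ae hs0 hs1 hG hi)), h1, h2, fL_one]
  conv_lhs => rw [h3]
  rw [integral_Iic_cut hx]

/-- For a datum dominated by `(1-x)^α` the solution operator yields a solution. -/
lemma isSolution_solOp {K : ℝ} (hs0 : 0 < s) (hs1 : s < 1) (hα : s - 1 < α) (hβ : -1 < β)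
    (hG : AEStronglyMeasurable G volI) (hK0 : 0 ≤ K)
    (hK : ∀ᵐ x ∂volI, |G x| ≤ K * (1 - x) ^ α) {G' : ℝ → ℝ} (hG' : G' =ᵐ[volI] G) :
    IsSolution α β s (solOp α β s G) G' := by
  have hi := integrable_solDeriv_of_bound hs0 hα hβ hG hK0 hK
  have hd := integrable_datum_of_bound (show -1 < α by linarith) hβ hG hK0 hK
  have hb : ∀ x ∈ Ioo (-1 : ℝ) 1, |solOp α β s G x| ≤ K * solConst α β s * (1 - x) ^ α :=
    fun x hx => abs_solOp_le hs0 hα hβ hK0 hK hx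
  have hC0 : 0 ≤ K * solConst α β s := mul_nonneg hK0 (solConst_nonneg hs0 hα hβ)
  have hleft : ∀ᶠ x in 𝓝[>] (-1 : ℝ), x ∈ Ioo (-1 : ℝ) 0 := Ioo_mem_nhdsGT (by norm_num)
  have hright : ∀ᶠ x in 𝓝[<] (1 : ℝ), x ∈ Ioo (0 : ℝ) 1 := Ioo_mem_nhdsLT (by norm_num)
  refine ⟨?_, ?_, ?_, ?_, ?_, ?_, ?_, ?_, ?_, ?_, ?_⟩
  · exact memLp_two_of_bound (by linarith) hβ (aestronglyMeasurable_solOp hG).restrict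
      (ae_volI_mem.mono hb)
  · refine LocAC.congr (f := fun x => (∫ t in (-1)..1, solDeriv α β s G t) -
      ∫ t in (-1)..x, solDeriv α β s G t) (fun a b ha hab hb' => ?_) fun x hx => ?_
    · have h1 : AbsolutelyContinuousOnInterval (fun _ : ℝ => ∫ t in (-1)..1, solDeriv α β s G t)
          a b := by
        rw [absolutelyContinuousOnInterval_iff]
        exact fun ε hε => ⟨1, one_pos, fun E _ _ => by simpa using hε⟩
      exact h1.sub (locAC_integral hi a b ha hab hb')
    · rw [rightInt_solOp hs0 hs1 hG hi hx, integral_left_one hi x]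
  · intro x hx
    rw [intervalIntegrable_iff_integrableOn_Ioo_of_le hx.1.le]
    have hsub : Ioo (-1 : ℝ) x ⊆ Ioo (-1) 1 := Ioo_subset_Ioo le_rfl hx.2.le
    have h2 : IntegrableOn (fL s (datum α β G)) (Ioo (-1) x) := by
      -- By the semigroup law this reduces to integrability of the datum against κ_{1+s}, which is
      -- bounded on the interval.
      have h3 : Integrable fun y => kap 1 (x - y) * fL s (datum α β G) y :=
        (fL_fL one_pos hs0 (aestronglyMeasurable_datum hG) (x := x) (by
          refine (hd.bdd_mul (c := 2 ^ s / Real.Gamma (1 + s)) (f := fun z =>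
            if -1 < z then kap (1 + s) (x - z) else 0)
            (Measurable.aestronglyMeasurable (Measurable.ite measurableSet_Ioi (by fun_prop)
              measurable_const)) (Eventually.of_forall fun z => ?_)).congr
              (Eventually.of_forall fun z => ?_)
          · have hΓ := Real.Gamma_pos_of_pos (show 0 < 1 + s by linarith)
            have h0 : 0 ≤ (2 : ℝ) ^ s / Real.Gamma (1 + s) := by positivity
            split_ifs with hz
            · rw [Real.norm_of_nonneg (kap_nonneg (by linarith) _)]
              rcases le_or_gt (x - z) 0 with h | h
              · rwa [kap_of_nonpos h]
              · rw [kap_of_pos h, add_sub_cancel_left]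
                have := hx.2
                gcongr
                linarith
            · simpa using h0
          · simp only
            split_ifs with hz
            · rfl
            · rw [datum, cut_of_notMem fun h => hz h.1]; simp)).1
      exact (integrable_kap_one_iff.1 h3).mono_set Ioo_subset_Iio_self
    have h3 : flux α β s (solOp α β s G) =ᵐ[volume.restrict (Ioo (-1) x)] fL s (datum α β G) :=
      ae_restrict_of_ae_restrict_of_subset hsub (flux_solOp_ae hs0 hs1 hG hi)
    exact h2.congr h3.symm
  · exact (locAC_integral hd).congr fun x hx => (leftInt_flux_solOp hs0 hs1 hG hi hd hx).symm
  · have h1 : ∀ᵐ x ∂volI, ∀ c, HasDerivAt (fun x => ∫ t in c..x, datum α β G t)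
        (datum α β G x) x := ae_restrict_of_ae
      (LocallyIntegrable.ae_hasDerivAt_integral hd.locallyIntegrable)
    filter_upwards [h1, ae_volI_mem, hG'] with x hx hxI hGx
    have h2 : leftInt s (flux α β s (solOp α β s G)) =ᶠ[𝓝 x]
        fun x => ∫ t in (-1)..x, datum α β G t := by
      filter_upwards [isOpen_Ioo.mem_nhds hxI] with y hy
      exact leftInt_flux_solOp hs0 hs1 hG hi hd hy
    rw [jacobiOp, leftDeriv, h2.deriv_eq, (hx (-1)).deriv, datum, cut_of_mem hxI, ← mul_assoc,
      weight_mul_weight hxI, add_neg_cancel, neg_add_cancel, weight_zero_zero, one_mul, hGx]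
  · refine ⟨K * solConst α β s * (1 ^ α + 2 ^ α), ?_⟩
    filter_upwards [hleft] with x hx
    refine (hb x ⟨hx.1, by linarith [hx.2]⟩).trans ?_
    exact mul_le_mul_of_nonneg_left
      (rpow_le_add one_pos (by linarith [hx.2]) (by linarith [hx.1]) α) hC0
  · intro hα0
    have h1 : Tendsto (fun x : ℝ => K * solConst α β s * (1 - x) ^ α) (𝓝[<] 1) (𝓝 0) := by
      have h2 : Tendsto (fun x : ℝ => K * solConst α β s * (1 - x) ^ α) (𝓝 1)
          (𝓝 (K * solConst α β s * (1 - 1) ^ α)) :=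
        ((continuous_const.mul ((Real.continuous_rpow_const hα0.le).comp
          (continuous_const.sub continuous_id))).tendsto _)
      rw [sub_self, Real.zero_rpow hα0.ne', mul_zero] at h2
      exact h2.mono_left nhdsWithin_le_nhds
    refine squeeze_zero_norm' ?_ h1
    filter_upwards [hright] with x hx
    exact hb x ⟨by linarith [hx.1], hx.2⟩
  · intro hα0
    refine ⟨K * solConst α β s, ?_⟩
    filter_upwards [hright] with x hx
    have := hb x ⟨by linarith [hx.1], hx.2⟩
    rwa [show (1 - x) ^ α = 1 by rw [hα0, Real.rpow_zero], mul_one] at this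
  · intro _
    set C := K * (Real.Gamma (β + 1) / Real.Gamma (s + (β + 1))) with hC
    have hΓ1 := Real.Gamma_pos_of_pos (show 0 < β + 1 by linarith)
    have hΓ2 := Real.Gamma_pos_of_pos (show 0 < s + (β + 1) by linarith)
    have hCC : 0 ≤ C := by positivity
    refine ⟨2 * (C + 1) * (1 ^ (β + s) + 2 ^ (β + s)), ?_⟩
    filter_upwards [hright] with x hx
    have hxI : x ∈ Ioo (-1 : ℝ) 1 := ⟨by linarith [hx.1], hx.2⟩
    have hx0 : 0 < 1 - x := by linarith [hx.2]
    -- C + 1 replaces C because the majorant must be strictly positive, also when K = 0.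
    have h1 := abs_deriv_integral_le hi hxI (g := fun t => (C + 1) * (1 - t) ^ (α - s))
      ((continuousAt_const.sub continuousAt_id).rpow_const (Or.inl hx0.ne') |>.const_mul _)
      (by positivity) (fun t ht => by
        have h2 := abs_solDeriv_le (s := s) hs0 hβ hK0 hK t
        rw [cut_of_mem ht, ← hC, weight, Real.rpow_zero, mul_one] at h2
        have : 0 ≤ (1 - t) ^ (α - s) := Real.rpow_nonneg (by linarith [ht.2]) _
        linarith)
    have h3 := rpow_le_add one_pos (show 1 ≤ 1 + x by linarith [hx.1]) (by linarith [hx.2]) (β + s)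
    rw [flux, deriv_rightInt_solOp hs0 hs1 hG hi hxI, abs_mul, abs_of_pos (weight_pos hxI)]
    have h4 : weight (-α + s) (β + s) x * (1 - x) ^ (α - s) = (1 + x) ^ (β + s) := by
      rw [mul_comm, one_sub_rpow_mul_weight hxI]
      simp [weight]
    calc _ ≤ weight (-α + s) (β + s) x * (2 * ((C + 1) * (1 - x) ^ (α - s))) :=
          mul_le_mul_of_nonneg_left h1 (weight_pos hxI).le
      _ = 2 * (C + 1) * (weight (-α + s) (β + s) x * (1 - x) ^ (α - s)) := by ring
      _ ≤ _ := by rw [h4]; gcongr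
  · have h1 : Tendsto (fun x => (∫ t in (-1)..1, solDeriv α β s G t) -
        ∫ t in (-1)..x, solDeriv α β s G t) (𝓝[<] 1) (𝓝 0) := by
      have := (tendsto_const_nhds (x := ∫ t in (-1)..1, solDeriv α β s G t)).sub
        ((intervalIntegral.continuous_primitive (fun a b => hi.intervalIntegrable) (-1)).tendsto 1)
      rw [sub_self] at this
      exact this.mono_left nhdsWithin_le_nhds
    refine h1.congr' ?_
    filter_upwards [hright] with x hx
    rw [rightInt_solOp hs0 hs1 hG hi ⟨by linarith [hx.1], hx.2⟩, integral_left_one hi x]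
  · have h1 : Tendsto (fun x => ∫ t in (-1)..x, datum α β G t) (𝓝[>] (-1)) (𝓝 0) := by
      have := (intervalIntegral.continuous_primitive
        (fun a b => hd.intervalIntegrable (a := a) (b := b)) (-1)).tendsto (-1)
      rw [intervalIntegral.integral_same] at this
      exact this.mono_left nhdsWithin_le_nhds
    refine h1.congr' ?_
    filter_upwards [hleft] with x hx
    rw [leftInt_flux_solOp hs0 hs1 hG hi hd ⟨hx.1, by linarith [hx.2]⟩]

end Existence

/-! ### Symmetry of the solution operator, and uniqueness. -/

lemma cut_weight_zero_nonneg (c y : ℝ) : 0 ≤ cut (weight c 0) y := by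
  by_cases hy : y ∈ Ioo (-1 : ℝ) 1
  · rw [cut_of_mem hy]; exact (weight_pos hy).le
  · rw [cut_of_notMem hy]

lemma cut_weight_zero_le {c : ℝ} (hc : -1 < c) (y : ℝ) :
    cut (weight c 0) y ≤ Real.Gamma (c + 1) * kap (c + 1) (1 - y) := by
  by_cases hy : y ∈ Ioo (-1 : ℝ) 1
  · rw [cut_of_mem hy, weight, Real.rpow_zero, mul_one,
      rpow_eq_kap (by linarith) (by linarith [hy.2])]
  · rw [cut_of_notMem hy]
    exact mul_nonneg (Real.Gamma_pos_of_pos (by linarith)).le (kap_nonneg (by linarith) _)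

section Uniqueness

variable {α β s : ℝ} {G : ℝ → ℝ}

lemma datum_of_notMem {z : ℝ} (hz : z ∉ Ioo (-1 : ℝ) 1) : datum α β G z = 0 := cut_of_notMem hz

lemma solDeriv_of_notMem {z : ℝ} (hz : z ∉ Ioo (-1 : ℝ) 1) : solDeriv α β s G z = 0 :=
  cut_of_notMem hz

/-- Integration by parts against the left fractional integral of a datum. -/
lemma integral_mul_fL_datum (hs0 : 0 < s) (hα : s - 1 < α) (hG : AEStronglyMeasurable G volI)
    (hD : Integrable fun z => (1 - z) ^ α * |datum α β G z|) {f : ℝ → ℝ}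
    (hf : AEStronglyMeasurable f) {B : ℝ} (hB : ∀ y, |f y| ≤ B * kap (α - s + 1) (1 - y)) :
    (Integrable fun y => f y * fL s (datum α β G) y) ∧
      ∫ y, f y * fL s (datum α β G) y = ∫ z, fR s f z * datum α β G z := by
  have hc : 0 < α - s + 1 := by linarith
  have i1 : ∀ z, Integrable fun y => kap s (y - z) * (B * kap (α - s + 1) (1 - y)) := fun z => by
    simpa only [mul_left_comm] using (integrable_fR_kap hs0 hc 1 z).const_mul B
  refine integral_mul_fL hs0 hf (aestronglyMeasurable_datum hG) (fun z => ?_) ?_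
  · refine (i1 z).mono' ((Measurable.aestronglyMeasurable (by fun_prop)).mul hf)
      (Eventually.of_forall fun y => ?_)
    rw [norm_mul, Real.norm_of_nonneg (kap_nonneg hs0 _)]
    exact mul_le_mul_of_nonneg_left (hB y) (kap_nonneg hs0 _)
  · refine (hD.const_mul (B / Real.Gamma (α + 1))).mono'
      ((aestronglyMeasurable_fR hf.norm).mul (aestronglyMeasurable_datum hG))
      (Eventually.of_forall fun z => ?_)
    by_cases hz : z ∈ Ioo (-1 : ℝ) 1
    · have h1 : |fR s (fun y => |f y|) z| ≤ B * kap (s + (α - s + 1)) (1 - z) := by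
        rw [← fR_kap hs0 hc, ← fR_const_mul]
        exact abs_fR_le hs0 (Eventually.of_forall fun y => by simpa using hB y) (i1 z)
      rw [kap_of_pos (by linarith [hz.2]), show s + (α - s + 1) - 1 = α by ring,
        show s + (α - s + 1) = α + 1 by ring] at h1
      rw [norm_mul]
      calc _ ≤ B * ((1 - z) ^ α / Real.Gamma (α + 1)) * |datum α β G z| :=
            mul_le_mul_of_nonneg_right h1 (abs_nonneg _)
        _ = _ := by ring
    · simp [datum_of_notMem hz]

/-- The solution operator is symmetric. -/
lemma integral_solOp_mul_datum {K : ℝ} (hs0 : 0 < s) (hα : s - 1 < α) (hβ : -1 < β)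
    (hG : AEStronglyMeasurable G volI)
    (hD : Integrable fun z => (1 - z) ^ α * |datum α β G z|) {h : ℝ → ℝ}
    (hh : AEStronglyMeasurable h volI) (hK0 : 0 ≤ K)
    (hK : ∀ᵐ x ∂volI, |h x| ≤ K * (1 - x) ^ α) :
    ∫ z, datum α β h z * solOp α β s G z = ∫ z, datum α β G z * solOp α β s h z := by
  have hc : -1 < α - s := by linarith
  have hΓ := Real.Gamma_pos_of_pos (show 0 < α - s + 1 by linarith)
  have hΓ1 := Real.Gamma_pos_of_pos (show 0 < β + 1 by linarith)
  have hΓ2 := Real.Gamma_pos_of_pos (show 0 < s + (β + 1) by linarith)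
  have hbd := abs_datum_le hβ hK0 hK
  have i1 : ∀ z, Integrable fun y =>
      kap s (z - y) * (K * Real.Gamma (β + 1) * kap (β + 1) (y - -1)) := fun z => by
    simpa only [mul_left_comm] using (integrable_kap_mul_kap hs0 (b := β + 1) (by linarith) z
      (-1)).const_mul (K * Real.Gamma (β + 1))
  -- Since |I^s(datum of h)| ≤ const · (1+y)^{β+s}, the weight ω^{(α-s,-β-s)} times it is at most a
  -- multiple of ω^{(α-s,0)}. Integrability of this one product therefore dominates what the first
  -- integration by parts needs.
  have hfull := (integral_mul_fL_datum hs0 hα hG hD (f := cut (weight (α - s) 0))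
    (aestronglyMeasurable_cut.2 (measurable_weight _ _).aestronglyMeasurable)
    (B := Real.Gamma (α - s + 1)) (fun y => by
      rw [abs_of_nonneg (cut_weight_zero_nonneg _ _)]
      exact cut_weight_zero_le hc y)).1
  have h1 := (integral_mul_fR hs0 (aestronglyMeasurable_datum hh)
    (aestronglyMeasurable_solDeriv (s := s) (α := α) (β := β) hG) (fun z => by
      refine (i1 z).mono' ((Measurable.aestronglyMeasurable (by fun_prop)).mul
        (aestronglyMeasurable_datum (α := α) (β := β) hh)) ?_
      filter_upwards [hbd] with y hy
      rw [norm_mul, Real.norm_of_nonneg (kap_nonneg hs0 _)]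
      exact mul_le_mul_of_nonneg_left hy (kap_nonneg hs0 _)) (by
      refine (hfull.norm.const_mul (K * (Real.Gamma (β + 1) / Real.Gamma (s + (β + 1))))).mono'
        ((aestronglyMeasurable_fL (aestronglyMeasurable_datum hh).norm).mul
          (aestronglyMeasurable_solDeriv hG)) (Eventually.of_forall fun y => ?_)
      by_cases hy : y ∈ Ioo (-1 : ℝ) 1
      · have h2 : |fL s (fun z => |datum α β h z|) y| ≤
            K * Real.Gamma (β + 1) * kap (s + (β + 1)) (y - -1) := by
          rw [← fL_kap hs0 (by linarith), ← fL_const_mul]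
          exact abs_fL_le hs0 (hbd.mono fun z hz => by simpa using hz) (i1 y)
        have h0 : 0 < y - -1 := by linarith [hy.1]
        have h3 : kap (s + (β + 1)) (y - -1) * weight (α - s) (-β - s) y =
            1 / Real.Gamma (s + (β + 1)) * weight (α - s) 0 y := by
          rw [← show weight 0 (β + s) y * weight (α - s) (-β - s) y = weight (α - s) 0 y by
            rw [weight_mul_weight hy]; ring_nf, kap_of_pos h0,
            show weight 0 (β + s) y = (y - -1) ^ (s + (β + 1) - 1) by
              rw [weight, Real.rpow_zero, one_mul]; ring_nf]
          ring
        rw [norm_mul, solDeriv, cut_of_mem hy, norm_mul, norm_mul, cut_of_mem hy,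
          Real.norm_of_nonneg (weight_pos hy).le, Real.norm_of_nonneg (weight_pos hy).le]
        calc _ ≤ K * Real.Gamma (β + 1) * kap (s + (β + 1)) (y - -1) *
              (weight (α - s) (-β - s) y * ‖fL s (datum α β G) y‖) :=
              mul_le_mul_of_nonneg_right h2 (mul_nonneg (weight_pos hy).le (norm_nonneg _))
          _ = K * Real.Gamma (β + 1) * (kap (s + (β + 1)) (y - -1) *
              weight (α - s) (-β - s) y) * ‖fL s (datum α β G) y‖ := by ring
          _ = _ := by rw [h3]; ring
      · simp [solDeriv_of_notMem hy, cut_of_notMem hy])).2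
  have h2 := (integral_mul_fL_datum hs0 hα hG hD (f := solDeriv α β s h)
    (aestronglyMeasurable_solDeriv hh)
    (B := K * (Real.Gamma (β + 1) / Real.Gamma (s + (β + 1))) * Real.Gamma (α - s + 1))
    (fun y => by
      refine (abs_solDeriv_le hs0 hβ hK0 hK y).trans ?_
      rw [mul_assoc _ (Real.Gamma (α - s + 1))]
      exact mul_le_mul_of_nonneg_left (cut_weight_zero_le hc y) (by positivity))).2
  -- After one integration by parts the pairing is ∫ ω^{(α-s,-β-s)} I^s(datum of h) I^s(datum of G),
  -- which is symmetric in h and G.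
  calc _ = ∫ z, fL s (datum α β h) z * solDeriv α β s G z := h1
    _ = ∫ z, solDeriv α β s h z * fL s (datum α β G) z := by
        refine integral_congr_ae (Eventually.of_forall fun z => ?_)
        by_cases hz : z ∈ Ioo (-1 : ℝ) 1
        · simp only [solDeriv, cut_of_mem hz]; ring
        · simp [solDeriv_of_notMem hz]
    _ = ∫ z, solOp α β s h z * datum α β G z := h2
    _ = _ := by simp only [mul_comm]

lemma integrableOn_Iic_datum (hG : AEStronglyMeasurable G volI)
    (hD : Integrable fun z => (1 - z) ^ α * |datum α β G z|) {x : ℝ} (hx : x < 1) :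
    IntegrableOn (datum α β G) (Iic x) := by
  refine (hD.const_mul ((1 - x) ^ (-α) + 2 ^ (-α))).integrableOn.mono'
    (aestronglyMeasurable_datum hG).restrict ?_
  filter_upwards [ae_restrict_mem measurableSet_Iic] with z hz
  by_cases hzI : z ∈ Ioo (-1 : ℝ) 1
  · have h0 : 0 < 1 - z := by linarith [hzI.2]
    have h1 := rpow_le_add (t := 1 - z) (by linarith) (sub_le_sub_left hz 1)
      (by linarith [hzI.1]) (-α)
    have h2 : (1 - z) ^ (-α) * (1 - z) ^ α = 1 := by
      rw [← Real.rpow_add h0, neg_add_cancel, Real.rpow_zero]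
    calc ‖datum α β G z‖ = (1 - z) ^ (-α) * ((1 - z) ^ α * |datum α β G z|) := by
          rw [← mul_assoc, h2, one_mul, Real.norm_eq_abs]
      _ ≤ _ := by gcongr
  · simp [datum_of_notMem hzI]

lemma integrableOn_Ioi_cut_of_datum {u : ℝ → ℝ} (hu : AEStronglyMeasurable u volI)
    (hD : Integrable fun z => (1 - z) ^ α * |datum α β u z|) {x : ℝ} (hx : -1 < x) :
    IntegrableOn (cut u) (Ioi x) := by
  refine (hD.const_mul ((1 + x) ^ (-β) + 2 ^ (-β))).integrableOn.mono'
    (aestronglyMeasurable_cut.2 hu).restrict ?_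
  filter_upwards [ae_restrict_mem measurableSet_Ioi] with z hz
  by_cases hzI : z ∈ Ioo (-1 : ℝ) 1
  · have h0 : 0 < 1 + z := by linarith [hzI.1]
    have h1 := rpow_le_add (t := 1 + z) (δ := 1 + x) (by linarith)
      (by linarith [mem_Ioi.1 hz]) (by linarith [hzI.2]) (-β)
    rw [cut_of_mem hzI, datum, cut_of_mem hzI, abs_mul, abs_of_pos (weight_pos hzI),
      ← mul_assoc ((1 - z) ^ α), one_sub_rpow_mul_weight hzI, add_neg_cancel, weight, Real.rpow_zero, one_mul]
    have h2 : (1 + z) ^ (-β) * (1 + z) ^ β = 1 := by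
      rw [← Real.rpow_add h0, neg_add_cancel, Real.rpow_zero]
    calc ‖u z‖ = (1 + z) ^ (-β) * ((1 + z) ^ β * |u z|) := by
          rw [← mul_assoc, h2, one_mul, Real.norm_eq_abs]
      _ ≤ _ := by gcongr
  · simp [datum_of_notMem hzI, cut_of_notMem hzI]

lemma integrableOn_Ioi_solDeriv (hs0 : 0 < s) (hα : s - 1 < α) (hG : AEStronglyMeasurable G volI)
    (hD : Integrable fun z => (1 - z) ^ α * |datum α β G z|) {x : ℝ} (hx : -1 < x) :
    IntegrableOn (solDeriv α β s G) (Ioi x) := by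
  have hc : -1 < α - s := by linarith
  set B := (1 + x) ^ (-β - s) + 2 ^ (-β - s) with hB
  have hB0 : 0 ≤ B := add_nonneg (Real.rpow_nonneg (by linarith) _) (by positivity)
  have h1 := (integral_mul_fL_datum hs0 hα hG hD
    (f := indicator (Ioi x) (cut (weight (α - s) (-β - s))))
    ((aestronglyMeasurable_cut.2 (measurable_weight _ _).aestronglyMeasurable).indicator
      measurableSet_Ioi) (B := B * Real.Gamma (α - s + 1)) (fun y => by
      rw [mul_assoc]
      refine le_trans ?_ (mul_le_mul_of_nonneg_left (cut_weight_zero_le hc y) hB0)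
      by_cases hy : y ∈ Ioi x
      · rw [indicator_of_mem hy]
        by_cases hyI : y ∈ Ioo (-1 : ℝ) 1
        · rw [cut_of_mem hyI, cut_of_mem hyI, abs_of_pos (weight_pos hyI), weight, weight,
            Real.rpow_zero, mul_one, mul_comm]
          refine mul_le_mul_of_nonneg_right ?_ (Real.rpow_nonneg (by linarith [hyI.2]) _)
          exact rpow_le_add (by linarith) (by linarith [mem_Ioi.1 hy]) (by linarith [hyI.2]) _
        · simp [cut_of_notMem hyI]
      · rw [indicator_of_notMem hy, abs_zero]
        exact mul_nonneg hB0 (cut_weight_zero_nonneg _ _))).1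
  rw [← integrable_indicator_iff measurableSet_Ioi]
  refine h1.congr (Eventually.of_forall fun y => ?_)
  by_cases hy : y ∈ Ioi x
  · simp only [indicator_of_mem hy]
    by_cases hyI : y ∈ Ioo (-1 : ℝ) 1
    · rw [solDeriv, cut_of_mem hyI, cut_of_mem hyI]
    · rw [solDeriv_of_notMem hyI, cut_of_notMem hyI, zero_mul]
  · simp only [indicator_of_notMem hy, zero_mul]

/-- Absolute continuity is available only on compact subintervals, so the fundamental theorem is
applied on [a,x] and a → -1; the vanishing limit fixes the constant of integration. -/
lemma LocAC.eq_integral_left {f g : ℝ → ℝ} (hf : LocAC f) (hg : ∀ᵐ x ∂volI, deriv f x = g x)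
    (h0 : Tendsto f (𝓝[>] (-1)) (𝓝 0)) {x : ℝ} (hx : x ∈ Ioo (-1 : ℝ) 1)
    (hi : IntegrableOn g (Iic x)) : f x = ∫ t in (-1)..x, g t := by
  have hi' : Integrable (indicator (Iic x) g) := (integrable_indicator_iff measurableSet_Iic).2 hi
  have key : ∀ a ∈ Ioo (-1) x, f x - f a = (∫ t in (-1)..x, indicator (Iic x) g t) -
      ∫ t in (-1)..a, indicator (Iic x) g t := fun a ha => by
    rw [intervalIntegral.integral_interval_sub_left hi'.intervalIntegrable hi'.intervalIntegrable,
      ← (hf a x ha.1 ha.2.le hx.2).integral_deriv_eq_sub]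
    refine intervalIntegral.integral_congr_ae ?_
    filter_upwards [ae_volI_iff.1 hg] with t ht htm
    rw [uIoc_of_le ha.2.le] at htm
    rw [ht ⟨ha.1.trans htm.1, htm.2.trans_lt hx.2⟩, indicator_of_mem (mem_Iic.2 htm.2)]
  have l1 : Tendsto (fun a => f x - f a) (𝓝[>] (-1)) (𝓝 (f x - 0)) :=
    tendsto_const_nhds.sub h0
  have l2 : Tendsto (fun a => (∫ t in (-1)..x, indicator (Iic x) g t) -
      ∫ t in (-1)..a, indicator (Iic x) g t) (𝓝[>] (-1))
      (𝓝 ((∫ t in (-1)..x, indicator (Iic x) g t) -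
        ∫ t in (-1)..(-1), indicator (Iic x) g t)) :=
    (tendsto_const_nhds.sub ((intervalIntegral.continuous_primitive
      (fun a b => hi'.intervalIntegrable) (-1)).tendsto (-1))).mono_left nhdsWithin_le_nhds
  rw [intervalIntegral.integral_same, sub_zero] at l2
  rw [sub_zero] at l1
  have := tendsto_nhds_unique (l1.congr' (by
    filter_upwards [Ioo_mem_nhdsGT hx.1] with a ha using key a ha)) l2
  rw [this]
  refine intervalIntegral.integral_congr fun t ht => ?_
  rw [uIcc_of_le hx.1.le] at ht
  exact indicator_of_mem (mem_Iic.2 ht.2) _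

lemma LocAC.eq_integral_right {f g : ℝ → ℝ} (hf : LocAC f)
    (hg : ∀ᵐ x ∂volI, deriv f x = -g x)
    (h0 : Tendsto f (𝓝[<] 1) (𝓝 0)) {x : ℝ} (hx : x ∈ Ioo (-1 : ℝ) 1)
    (hi : IntegrableOn g (Ioi x)) : f x = ∫ t in x..1, g t := by
  have hi' : Integrable (indicator (Ioi x) g) := (integrable_indicator_iff measurableSet_Ioi).2 hi
  have key : ∀ b ∈ Ioo x 1, f x - f b = ∫ t in x..b, indicator (Ioi x) g t := fun b hb => by
    rw [← neg_sub, ← (hf x b hx.1 hb.1.le hb.2).integral_deriv_eq_sub,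
      ← intervalIntegral.integral_neg]
    refine intervalIntegral.integral_congr_ae ?_
    filter_upwards [ae_volI_iff.1 hg] with t ht htm
    rw [uIoc_of_le hb.1.le] at htm
    rw [ht ⟨hx.1.trans htm.1, htm.2.trans_lt hb.2⟩, neg_neg, indicator_of_mem (mem_Ioi.2 htm.1)]
  have l1 : Tendsto (fun b => f x - f b) (𝓝[<] 1) (𝓝 (f x - 0)) :=
    tendsto_const_nhds.sub h0
  have l2 : Tendsto (fun b => ∫ t in x..b, indicator (Ioi x) g t) (𝓝[<] 1)
      (𝓝 (∫ t in x..1, indicator (Ioi x) g t)) :=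
    ((intervalIntegral.continuous_primitive
      (fun a b => hi'.intervalIntegrable) x).tendsto 1).mono_left nhdsWithin_le_nhds
  rw [sub_zero] at l1
  have := tendsto_nhds_unique (l1.congr' (by
    filter_upwards [Ioo_mem_nhdsLT hx.2] with a ha using key a ha)) l2
  rw [this, intervalIntegral.integral_of_le hx.2.le, intervalIntegral.integral_of_le hx.2.le]
  exact setIntegral_congr_fun measurableSet_Ioc fun t ht => indicator_of_mem (mem_Ioi.2 ht.1) _

/-- The kernel of order 1 + s is t^s/Γ(1+s), bounded for t ≤ 2, the length of the interval. It
supplies the integrability hypotheses of Abel's inversion. -/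
lemma integrable_kap_succ_mul (hs0 : 0 < s) {f : ℝ → ℝ} {t : ℝ → ℝ} (ht : Measurable t) {S : Set ℝ}
    (hS : MeasurableSet S) (hf : IntegrableOn f S) (h0 : ∀ z ∉ S, kap (1 + s) (t z) * f z = 0)
    (h2 : ∀ z ∈ S, f z ≠ 0 → t z ≤ 2) : Integrable fun z => kap (1 + s) (t z) * f z := by
  have hΓ := Real.Gamma_pos_of_pos (show 0 < 1 + s by linarith)
  have hf' := (integrable_indicator_iff hS).2 hf
  refine (hf'.norm.const_mul (2 ^ s / Real.Gamma (1 + s))).mono' ?_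
    (Eventually.of_forall fun z => ?_)
  · have : (fun z => kap (1 + s) (t z) * f z) = fun z => kap (1 + s) (t z) * indicator S f z := by
      ext z
      by_cases hz : z ∈ S
      · rw [indicator_of_mem hz]
      · rw [indicator_of_notMem hz, h0 z hz, mul_zero]
    rw [this]
    exact ((measurable_kap _).comp ht).aestronglyMeasurable.mul hf'.1
  · by_cases hz : z ∈ S
    · rw [indicator_of_mem hz, norm_mul, Real.norm_of_nonneg (kap_nonneg (by linarith) _)]
      rcases eq_or_ne (f z) 0 with hfz | hfz
      · simp [hfz]
      refine mul_le_mul_of_nonneg_right ?_ (norm_nonneg _)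
      rcases le_or_gt (t z) 0 with h | h
      · rw [kap_of_nonpos h]; positivity
      · rw [kap_of_pos h, add_sub_cancel_left]
        have := h2 z hz hfz
        gcongr
    · rw [h0 z hz, norm_zero]
      positivity

/-- A solution is given by the solution operator. -/
lemma IsSolution.ae_eq_solOp (hs0 : 0 < s) (hs1 : s < 1) (hα : s - 1 < α) (hβ : -1 < β)
    {u : ℝ → ℝ} (hu : IsSolution α β s u G) (hG : MemLp G 2 (weightMeasure (-α) β)) :
    u =ᵐ[volI] solOp α β s G := by
  have hα1 : -1 < α := by linarith
  have hGm : AEStronglyMeasurable G volI := aestronglyMeasurable_weightMeasure_iff.1 hG.1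
  have hum : AEStronglyMeasurable u volI := aestronglyMeasurable_weightMeasure_iff.1 hu.memLp.1
  have hD := (integrable_rpow_mul_datum hα1 hβ hG).1
  have hDu := (integrable_rpow_mul_datum hα1 hβ hu.memLp).1
  have hfm : Measurable (flux α β s u) :=
    (measurable_weight _ _).mul (measurable_deriv _).neg
  have hdm := aestronglyMeasurable_datum (α := α) (β := β) hGm
  have hpm := aestronglyMeasurable_solDeriv (α := α) (β := β) (s := s) hGm
  have hcutd : cut (datum α β G) = datum α β G := by
    ext y
    by_cases hy : y ∈ Ioo (-1 : ℝ) 1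
    · rw [cut_of_mem hy]
    · rw [cut_of_notMem hy, datum_of_notMem hy]
  have hcutp : cut (solDeriv α β s G) = solDeriv α β s G := by
    ext y
    by_cases hy : y ∈ Ioo (-1 : ℝ) 1
    · rw [cut_of_mem hy]
    · rw [cut_of_notMem hy, solDeriv_of_notMem hy]
  have hderiv : ∀ᵐ x ∂volI, deriv (leftInt s (flux α β s u)) x = datum α β G x := by
    filter_upwards [hu.eqn, ae_volI_mem] with x hx hxI
    rw [datum, cut_of_mem hxI, ← hx, jacobiOp, ← mul_assoc, weight_mul_weight hxI, neg_add_cancel,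
      add_neg_cancel, weight_zero_zero, one_mul, leftDeriv]
  -- The equation integrated once from -1. The limit condition excludes a constant here, which after
  -- inversion would be a multiple of (1+x)^{s-1} in the flux; the same happens at 1 in `hB`.
  have hA : ∀ x ∈ Ioo (-1 : ℝ) 1,
      leftInt s (flux α β s u) x = ∫ t in (-1)..x, datum α β G t := fun x hx =>
    hu.ac_left.eq_integral_left hderiv hu.no_sing_left hx (integrableOn_Iic_datum hGm hD hx.2)
  have hflux := abel_fL (c := 1) hs0 hs1 (f := cut (flux α β s u)) (g := datum α β G)
    (aestronglyMeasurable_cut.2 hfm.aestronglyMeasurable) hdm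
    (fun x hx => by
      rcases le_or_gt x (-1) with h | h
      · refine (integrableOn_zero (μ := volume) (ε' := ℝ)).congr_fun (fun y hy => ?_)
          measurableSet_Iio
        rw [cut_of_notMem fun h' => (h'.1.trans hy).not_ge h]
      · exact (integrableOn_Iio_cut ⟨h, hx⟩).2 (hu.flux_integrable x ⟨h, hx⟩))
    (fun x hx => integrable_kap_succ_mul hs0 (t := fun z => x - z) (by fun_prop)
      measurableSet_Iic (integrableOn_Iic_datum hGm hD hx)
      (fun z hz => by rw [kap_of_nonpos (by linarith [not_le.1 (mt mem_Iic.2 hz)]), zero_mul])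
      (fun z _ hz => by
        have : z ∈ Ioo (-1 : ℝ) 1 := by
          by_contra h
          exact hz (datum_of_notMem h)
        linarith [this.1]))
    (fun x hx => by
      rcases le_or_gt x (-1) with h | h
      · rw [fL_congr_lt (g := fun _ => 0)
          fun y hy => cut_of_notMem fun h' => (h'.1.trans hy).not_ge h,
          fL_congr_lt (f := datum α β G) (g := fun _ => 0)
          fun y hy => datum_of_notMem fun h' => (h'.1.trans hy).not_ge h]
        simp [fL]
      · rw [← leftInt_eq ⟨h, hx⟩, hA x ⟨h, hx⟩, fL_one, ← integral_Iic_cut ⟨h, hx⟩, hcutd])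
  have hderiv2 : ∀ᵐ x ∂volI, deriv (rightInt s u) x = -solDeriv α β s G x := by
    filter_upwards [ae_restrict_of_ae hflux, ae_volI_mem] with x hx hxI
    have h1 := hx hxI.2
    rw [cut_of_mem hxI] at h1
    rw [solDeriv, cut_of_mem hxI, ← h1, flux, ← mul_assoc, weight_mul_weight hxI,
      show α - s + (-α + s) = 0 by ring, show -β - s + (β + s) = 0 by ring, weight_zero_zero,
      one_mul, rightDeriv, neg_neg]
  have hB : ∀ x ∈ Ioo (-1 : ℝ) 1, rightInt s u x = ∫ t in x..1, solDeriv α β s G t :=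
    fun x hx => hu.ac_right.eq_integral_right hderiv2 hu.no_sing_right hx
      (integrableOn_Ioi_solDeriv hs0 hα hGm hD hx.1)
  have hfin := abel_fR (c := -1) hs0 hs1 (f := cut u) (g := solDeriv α β s G)
    (aestronglyMeasurable_cut.2 hum) hpm
    (fun x hx => integrableOn_Ioi_cut_of_datum hum hDu hx)
    (fun x hx => integrable_kap_succ_mul hs0 (t := fun z => z - x) (by fun_prop)
      measurableSet_Ioi (integrableOn_Ioi_solDeriv hs0 hα hGm hD hx)
      (fun z hz => by rw [kap_of_nonpos (by linarith [not_lt.1 (mt mem_Ioi.2 hz)]), zero_mul])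
      (fun z _ hz => by
        have : z ∈ Ioo (-1 : ℝ) 1 := by
          by_contra h
          exact hz (solDeriv_of_notMem h)
        linarith [this.2]))
    (fun x hx => by
      rcases le_or_gt 1 x with h | h
      · rw [fR_congr_gt (g := fun _ => 0)
          fun y hy => cut_of_notMem fun h' => (hy.trans h'.2).not_ge h,
          fR_congr_gt (f := solDeriv α β s G) (g := fun _ => 0)
          fun y hy => solDeriv_of_notMem fun h' => (hy.trans h'.2).not_ge h]
        simp [fR]
      · rw [← rightInt_eq ⟨hx, h⟩, hB x ⟨hx, h⟩, fR_one, ← integral_Ioi_cut ⟨hx, h⟩, hcutp])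
  filter_upwards [ae_restrict_of_ae hfin, ae_volI_mem] with x hx hxI
  rw [← cut_of_mem (f := u) hxI, hx hxI.1, solOp]

end Uniqueness

/-! ### Double factorials, Catalan numbers and Wallis' product. -/

/-- The ratio `(2m-1)‼ / (2m+2)‼`. -/
def facRatio (m : ℕ) : ℝ := ((2 * m - 1)‼ : ℝ) / ((2 * m + 2)‼ : ℝ)

/-- Truncated subtraction gives (2·0-1)‼ = 0‼ = 1, in agreement with (-1)!! = 1. -/
lemma facRatio_zero : facRatio 0 = 1 / 2 := by
  simp [facRatio, Nat.doubleFactorial]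

lemma facRatio_succ (m : ℕ) : facRatio (m + 1) = facRatio m * ((2 * m + 1) / (2 * m + 4)) := by
  have h1 : (2 * (m + 1) - 1)‼ = (2 * m + 1) * (2 * m - 1)‼ := by
    rcases m with _ | m
    · rfl
    · exact Nat.doubleFactorial_add_two (2 * m + 1)
  have h2 : (2 * (m + 1) + 2)‼ = (2 * m + 4) * (2 * m + 2)‼ :=
    Nat.doubleFactorial_add_two (2 * m + 2)
  rw [facRatio, facRatio, h1, h2, div_mul_div_comm, Nat.cast_mul, Nat.cast_mul]
  push_cast
  rw [mul_comm (2 * (m : ℝ) + 1), mul_comm (2 * (m : ℝ) + 4)]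

lemma facRatio_pos (m : ℕ) : 0 < facRatio m := by
  unfold facRatio
  have := Nat.doubleFactorial_pos (2 * m - 1)
  have := Nat.doubleFactorial_pos (2 * m + 2)
  positivity

lemma facRatio_antitone : Antitone facRatio := by
  refine antitone_nat_of_succ_le fun m => ?_
  rw [facRatio_succ]
  refine mul_le_of_le_one_right (facRatio_pos m).le ?_
  rw [div_le_one (by positivity)]
  linarith

lemma facRatio_le (m : ℕ) : facRatio m ≤ 1 / (m + 2) := by
  induction m with
  | zero => simp [facRatio_zero]
  | succ m ih =>
    rw [facRatio_succ]
    have hm : (0 : ℝ) ≤ m := Nat.cast_nonneg m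
    refine (mul_le_mul_of_nonneg_right ih (by positivity)).trans ?_
    push_cast
    rw [div_mul_div_comm, div_le_div_iff₀ (by positivity) (by positivity)]
    nlinarith

lemma tendsto_facRatio : Tendsto facRatio atTop (𝓝 0) := by
  refine squeeze_zero (fun m => (facRatio_pos m).le) (fun m => (facRatio_le m).trans ?_)
    tendsto_one_div_add_atTop_nhds_zero_nat
  gcongr
  norm_num

/-- Both sides satisfy (m+2)c_{m+1} = 2(2m+1)c_m. The factor 4^m is the source of the 4 in the
convergence ratio. -/
lemma catalan_eq_facRatio (m : ℕ) : (catalan m : ℝ) = 2 * 4 ^ m * facRatio m := by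
  induction m with
  | zero => simp [facRatio_zero]
  | succ m ih =>
    have h1 : ((m : ℝ) + 1) * catalan m = m.centralBinom := by
      exact_mod_cast succ_mul_catalan_eq_centralBinom m
    have h2 : ((m : ℝ) + 1 + 1) * catalan (m + 1) = (m + 1).centralBinom := by
      exact_mod_cast succ_mul_catalan_eq_centralBinom (m + 1)
    have h3 : ((m : ℝ) + 1) * (m + 1).centralBinom = 2 * (2 * m + 1) * m.centralBinom := by
      exact_mod_cast Nat.succ_mul_centralBinom_succ m
    rw [← h2, ← h1, ih] at h3
    have hm : (m : ℝ) + 1 ≠ 0 := by positivity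
    have hm2 : (m : ℝ) + 1 + 1 ≠ 0 := by positivity
    have h4 : (catalan (m + 1) : ℝ) = 2 * (2 * m + 1) * (2 * 4 ^ m * facRatio m) / (m + 1 + 1) := by
      rw [eq_div_iff hm2]
      refine mul_left_cancel₀ hm ?_
      linear_combination h3
    rw [h4, facRatio_succ, show (2 * (m : ℝ) + 4) = 2 * (m + 1 + 1) by ring]
    field_simp
    ring

/-- (2m+2) `facRatio m` is (2m-1)!!/(2m)!!, whose square times 2m+1 is the reciprocal of the m-th
Wallis product. -/
lemma W_mul_facRatio (m : ℕ) :
    Real.Wallis.W m * ((2 * m + 1) * ((2 * m + 2) * facRatio m) ^ 2) = 1 := by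
  induction m with
  | zero => simp [Real.Wallis.W, facRatio_zero]
  | succ m ih =>
    rw [Real.Wallis.W_succ, facRatio_succ]
    refine Eq.trans ?_ ih
    push_cast
    have h1 : (2 * (m : ℝ) + 1) ≠ 0 := by positivity
    have h2 : (2 * (m : ℝ) + 3) ≠ 0 := by positivity
    rw [show (2 * (m : ℝ) + 4) = 2 * (m + 2) by ring,
      show (2 * ((m : ℝ) + 1) + 2) = 2 * (m + 2) by ring,
      show (2 * ((m : ℝ) + 1) + 1) = 2 * m + 3 by ring]
    field_simp

/-- Insert the lower bound W_m ≥ (2m+1)/(2m+2) · π/2 and use (2m+1)² ≥ 2m(2m+2). -/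
lemma two_mul_facRatio_le {m : ℕ} (hm : 1 ≤ m) :
    2 * facRatio m ≤ 1 / ((m + 1) * √(Real.pi * m)) := by
  have hm0 : (0 : ℝ) < m := by exact_mod_cast hm
  have hπ := Real.pi_pos
  have hF := facRatio_pos m
  have h1 := Real.Wallis.le_W m
  have h2 := W_mul_facRatio m
  set F := facRatio m
  have h3 : ((2 * (m : ℝ) + 1) / (2 * m + 2) * (Real.pi / 2)) *
      ((2 * m + 1) * ((2 * m + 2) * F) ^ 2) ≤ 1 := by
    exact (mul_le_mul_of_nonneg_right h1 (by positivity)).trans h2.le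
  have h4 : Real.pi * m * ((2 * m + 2) * F) ^ 2 ≤ 1 := by
    refine le_trans ?_ h3
    rw [show ((2 * (m : ℝ) + 1) / (2 * m + 2) * (Real.pi / 2)) *
      ((2 * m + 1) * ((2 * m + 2) * F) ^ 2) =
      Real.pi * ((2 * m + 1) ^ 2 / (2 * (2 * m + 2))) * ((2 * m + 2) * F) ^ 2 by field_simp]
    gcongr
    rw [le_div_iff₀ (by positivity)]
    nlinarith
  rw [le_div_iff₀ (by positivity)]
  have h5 : 0 < √(Real.pi * m) := by positivity
  have h6 : (√(Real.pi * m) * ((2 * m + 2) * F)) ^ 2 ≤ 1 := by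
    rwa [mul_pow, Real.sq_sqrt (by positivity)]
  have h7 := abs_le_of_sq_le_sq' (a := √(Real.pi * m) * ((2 * m + 2) * F)) (b := 1)
    (by simpa using h6) zero_le_one
  linarith [h7.2]

/-! ### The FD recursion for a diagonal operator in a Hilbert space. -/

section Hilbert

variable {H : Type*} [NormedAddCommGroup H] [InnerProductSpace ℝ H]
  (b : HilbertBasis ℕ ℝ H)

lemma hilbertBasis_ext {x y : H} (h : ∀ m, inner ℝ (b m) x = inner ℝ (b m) y) : x = y := by
  refine b.repr.injective (lp.ext (funext fun m => ?_))
  rw [b.repr_apply_apply, b.repr_apply_apply, h]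

lemma hasSum_sq_coeff (x : H) : HasSum (fun m => (inner ℝ (b m) x) ^ 2) (‖x‖ ^ 2) := by
  have := b.hasSum_inner_mul_inner x x
  rw [real_inner_self_eq_norm_sq] at this
  refine this.congr_fun fun m => ?_
  rw [real_inner_comm, sq]

/-- Parseval's identity for both vectors. -/
lemma norm_le_of_coeff_le {x y : H} {M : ℝ} (hM : 0 ≤ M)
    (h : ∀ m, |inner ℝ (b m) y| ≤ M * |inner ℝ (b m) x|) : ‖y‖ ≤ M * ‖x‖ := by
  have h1 := hasSum_le (fun m => by
    have := mul_self_le_mul_self (abs_nonneg _) (h m)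
    calc (inner ℝ (b m) y) ^ 2 = |inner ℝ (b m) y| * |inner ℝ (b m) y| := by
          rw [← sq, sq_abs]
      _ ≤ _ := this
      _ = M ^ 2 * (inner ℝ (b m) x) ^ 2 := by rw [← sq_abs (inner ℝ (b m) x)]; ring)
    (hasSum_sq_coeff b y) ((hasSum_sq_coeff b x).mul_left (M ^ 2))
  rw [← mul_pow] at h1
  exact (sq_le_sq₀ (norm_nonneg _) (by positivity)).1 h1

/-- Diagonal operators with bounded coefficients. -/
lemma exists_diag {c : ℕ → ℝ} {M : ℝ} (hc : ∀ m, |c m| ≤ M) :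
    ∃ D : H →L[ℝ] H, (∀ x m, inner ℝ (b m) (D x) = c m * inner ℝ (b m) x) ∧
      ∀ x, ‖D x‖ ≤ M * ‖x‖ := by
  have hM : 0 ≤ M := (abs_nonneg _).trans (hc 0)
  have hex : ∀ x : H, ∃ y : H, ∀ m, inner ℝ (b m) y = c m * inner ℝ (b m) x := fun x => by
    have hmem : Memℓp (fun m => c m * inner ℝ (b m) x) 2 := by
      refine memℓp_gen ?_
      refine Summable.of_nonneg_of_le (fun m => by positivity) (fun m => ?_)
        ((hasSum_sq_coeff b x).summable.mul_left (M ^ 2))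
      have h1 : |c m| ^ 2 ≤ M ^ 2 := by gcongr; exact hc m
      simp only [ENNReal.toReal_ofNat, Real.rpow_ofNat, norm_mul, mul_pow, Real.norm_eq_abs,
        sq_abs]
      rw [sq_abs] at h1
      gcongr
    refine ⟨b.repr.symm ⟨_, hmem⟩, fun m => ?_⟩
    rw [← b.repr_apply_apply, LinearIsometryEquiv.apply_symm_apply]
  choose D hD using hex
  let L : H →ₗ[ℝ] H :=
    { toFun := D
      map_add' := fun x y => hilbertBasis_ext b fun m => by
        rw [inner_add_right, hD, hD, hD, inner_add_right, mul_add]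
      map_smul' := fun r x => hilbertBasis_ext b fun m => by
        rw [RingHom.id_apply, inner_smul_right, hD, hD, inner_smul_right]; ring }
  have hn : ∀ x, ‖L x‖ ≤ M * ‖x‖ := fun x => norm_le_of_coeff_le b hM fun m => by
    have : inner ℝ (b m) (L x) = c m * inner ℝ (b m) x := hD x m
    rw [this, abs_mul]
    exact mul_le_mul_of_nonneg_right (hc m) (abs_nonneg _)
  exact ⟨L.mkContinuous M hn, fun x m => hD x m, hn⟩

/-- The abstract form of the FD recursion at the `n`-th eigenvalue of an operator with eigenvalues
`ev` and eigenbasis `b`, perturbed by `Q`. -/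
structure AbsFD (ev : ℕ → ℝ) (Q : H →L[ℝ] H) (n : ℕ) (Λ : ℕ → ℝ) (U : ℕ → H) : Prop where
  lam_zero : Λ 0 = ev n
  u_zero : U 0 = b n
  step : ∀ j m, ev m * inner ℝ (b m) (U (j + 1)) = ev n * inner ℝ (b m) (U (j + 1)) +
    inner ℝ (b m) (∑ p ∈ Finset.range (j + 1), Λ (j + 1 - p) • U p - Q (U j))
  orth : ∀ j, inner ℝ (b n) (U (j + 1)) = 0

variable {b} {ev : ℕ → ℝ} {Q : H →L[ℝ] H} {n : ℕ} {Λ : ℕ → ℝ} {U : ℕ → H}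

lemma inner_basis (m k : ℕ) : inner ℝ (b m) (b k) = if m = k then (1 : ℝ) else 0 :=
  orthonormal_iff_ite.1 b.orthonormal m k

/-- The n-th coefficient of the step is its solvability condition: the left side cancels, and by
orthogonality only p = 0 survives in the sum. -/
lemma AbsFD.lam_succ (h : AbsFD b ev Q n Λ U) (j : ℕ) :
    Λ (j + 1) = inner ℝ (b n) (Q (U j)) := by
  have h1 := h.step j n
  rw [h.orth j, mul_zero, zero_add, inner_sub_right, inner_sum, Finset.sum_range_succ',
    Finset.sum_eq_zero fun p _ => by rw [inner_smul_right, h.orth p, mul_zero]] at h1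
  rw [h.u_zero, inner_smul_right, inner_basis, if_pos rfl] at h1
  rw [Nat.sub_zero] at h1
  linarith

lemma AbsFD.norm_zero (h : AbsFD b ev Q n Λ U) : ‖U 0‖ = 1 := by
  rw [h.u_zero]
  exact b.orthonormal.1 n

lemma AbsFD.abs_lam_le (h : AbsFD b ev Q n Λ U) {κ : ℝ} (hQ : ∀ x, ‖Q x‖ ≤ κ * ‖x‖) (j : ℕ) :
    |Λ (j + 1)| ≤ κ * ‖U j‖ := by
  rw [h.lam_succ]
  refine (abs_real_inner_le_norm _ _).trans ?_
  rw [b.orthonormal.1 n, one_mul]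
  exact hQ _

/-- The p = 0 term is a multiple of b_n and affects only the coefficient where U_{j+1} vanishes, so
it is dropped. The remaining coefficients are divided by the gaps. With |Λ_{i+1}| ≤ κ‖U_i‖, and with
Q U_j counted as the missing term since ‖U_0‖ = 1, a full convolution results. -/
lemma AbsFD.norm_succ_le (h : AbsFD b ev Q n Λ U) {κ M : ℝ} (hQ : ∀ x, ‖Q x‖ ≤ κ * ‖x‖)
    (hM : ∀ m, m ≠ n → 1 ≤ M * |ev m - ev n|) (hM0 : 0 ≤ M) (j : ℕ) :
    ‖U (j + 1)‖ ≤ M * κ * ∑ p ∈ Finset.range (j + 1), ‖U p‖ * ‖U (j - p)‖ := by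
  set F : H := ∑ p ∈ Finset.range j, Λ (j - p) • U (p + 1) - Q (U j) with hF
  have e : ∑ p ∈ Finset.range (j + 1), Λ (j + 1 - p) • U p - Q (U j) =
      Λ (j + 1) • b n + F := by
    rw [Finset.sum_range_succ', hF, h.u_zero, Nat.sub_zero]
    simp only [Nat.add_sub_add_right]
    abel
  have h1 : ‖U (j + 1)‖ ≤ M * ‖F‖ := by
    refine norm_le_of_coeff_le b hM0 fun m => ?_
    rcases eq_or_ne m n with rfl | hm
    · rw [h.orth, abs_zero]
      positivity
    · have h2 := h.step j m
      rw [e, inner_add_right, inner_smul_right, inner_basis, if_neg hm, mul_zero, zero_add] at h2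
      have h3 : |ev m - ev n| * |inner ℝ (b m) (U (j + 1))| = |inner ℝ (b m) F| := by
        rw [← abs_mul]
        congr 1
        linarith
      rw [← h3, ← mul_assoc]
      exact le_mul_of_one_le_left (abs_nonneg _) (hM m hm)
  have h4 : ‖F‖ ≤ κ * ∑ p ∈ Finset.range (j + 1), ‖U p‖ * ‖U (j - p)‖ := by
    rw [Finset.sum_range_succ', mul_add, Finset.mul_sum, h.norm_zero, one_mul, Nat.sub_zero]
    refine (norm_sub_le _ _).trans (add_le_add ?_ (hQ _))
    refine (norm_sum_le _ _).trans (Finset.sum_le_sum fun p hp => ?_)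
    obtain ⟨i, rfl⟩ := Nat.exists_eq_add_of_lt (Finset.mem_range.1 hp)
    rw [norm_smul, show p + i + 1 - p = i + 1 by omega, Real.norm_eq_abs,
      show p + i + 1 - (p + 1) = i by omega]
    calc |Λ (i + 1)| * ‖U (p + 1)‖ ≤ κ * ‖U i‖ * ‖U (p + 1)‖ := by
          gcongr
          exact h.abs_lam_le hQ i
      _ = _ := by ring
  calc _ ≤ M * ‖F‖ := h1
    _ ≤ M * (κ * ∑ p ∈ Finset.range (j + 1), ‖U p‖ * ‖U (j - p)‖) := by gcongr
    _ = _ := by ring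

/-- The Catalan numbers solve the convolution recursion with equality, so (Mκ)^j C_j is a majorant
by strong induction. -/
lemma AbsFD.norm_le (h : AbsFD b ev Q n Λ U) {κ M : ℝ} (hκ : 0 ≤ κ)
    (hQ : ∀ x, ‖Q x‖ ≤ κ * ‖x‖)
    (hM : ∀ m, m ≠ n → 1 ≤ M * |ev m - ev n|) (hM0 : 0 ≤ M) (j : ℕ) :
    ‖U j‖ ≤ 2 * (4 * κ * M) ^ j * facRatio j := by
  have key : ∀ j, ‖U j‖ ≤ (M * κ) ^ j * catalan j := fun j => by
    induction j using Nat.strong_induction_on with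
    | _ j ih =>
      rcases j with _ | j
      · simp [h.norm_zero]
      · refine (h.norm_succ_le hQ hM hM0 j).trans ?_
        have e : (catalan (j + 1) : ℝ) =
            ∑ p ∈ Finset.range (j + 1), (catalan p : ℝ) * catalan (j - p) := by
          rw [catalan_succ, Finset.sum_range]
          push_cast
          rfl
        rw [e, pow_succ', mul_assoc (M * κ), Finset.mul_sum _ _ ((M * κ) ^ j)]
        refine mul_le_mul_of_nonneg_left (Finset.sum_le_sum fun p hp => ?_) (by positivity)
        have hp' : p ≤ j := Finset.mem_range_succ_iff.1 hp
        calc ‖U p‖ * ‖U (j - p)‖ ≤ ((M * κ) ^ p * catalan p) *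
              ((M * κ) ^ (j - p) * catalan (j - p)) := by
              gcongr
              · exact ih p (by omega)
              · exact ih (j - p) (by omega)
          _ = ((M * κ) ^ p * (M * κ) ^ (j - p)) * (catalan p * catalan (j - p)) := by ring
          _ = _ := by rw [← pow_add, Nat.add_sub_cancel' hp']
  refine (key j).trans_eq ?_
  rw [catalan_eq_facRatio, mul_assoc 4 κ, mul_pow 4, mul_comm κ M]
  ring

lemma tail_bound {E : Type*} [NormedAddCommGroup E] {f : ℕ → E} {A r : ℝ}
    (hr0 : 0 ≤ r) (hr1 : r < 1) {k : ℕ} (hf : ∀ j, ‖f (j + k)‖ ≤ A * r ^ j) {a : E}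
    (ha : HasSum f a) : ‖a - ∑ j ∈ Finset.range k, f j‖ ≤ A / (1 - r) := by
  have h1 : HasSum (fun j => f (j + k)) (a - ∑ j ∈ Finset.range k, f j) :=
    (hasSum_nat_add_iff' k).2 ha
  have h2 := (hasSum_geometric_of_lt_one hr0 hr1).mul_left A
  rw [← h1.tsum_eq, div_eq_mul_inv]
  exact tsum_of_norm_bounded h2 hf

section Convergence

variable {κ M : ℝ}

lemma AbsFD.summable (h : AbsFD b ev Q n Λ U) (hκ : 0 ≤ κ) (hQ : ∀ x, ‖Q x‖ ≤ κ * ‖x‖)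
    (hM : ∀ m, m ≠ n → 1 ≤ M * |ev m - ev n|) (hM0 : 0 ≤ M) (hr : 4 * κ * M < 1) :
    Summable (fun j => ‖U j‖) ∧ Summable fun j => ‖Λ j‖ := by
  have hr0 : 0 ≤ 4 * κ * M := by positivity
  have h1 : Summable fun j => ‖U j‖ := by
    refine Summable.of_nonneg_of_le (fun j => norm_nonneg _) (fun j => ?_)
      (summable_geometric_of_lt_one hr0 hr)
    refine (h.norm_le hκ hQ hM hM0 j).trans ?_
    have h2 : facRatio j ≤ 1 / 2 := facRatio_zero ▸ facRatio_antitone (Nat.zero_le j)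
    calc 2 * (4 * κ * M) ^ j * facRatio j ≤ 2 * (4 * κ * M) ^ j * (1 / 2) := by gcongr
      _ = _ := by ring
  refine ⟨h1, ?_⟩
  rw [← summable_nat_add_iff 1]
  exact Summable.of_nonneg_of_le (fun j => norm_nonneg _) (fun j => h.abs_lam_le hQ j)
    (h1.mul_left κ)

lemma AbsFD.norm_sub_le (h : AbsFD b ev Q n Λ U) (hκ : 0 ≤ κ) (hQ : ∀ x, ‖Q x‖ ≤ κ * ‖x‖)
    (hM : ∀ m, m ≠ n → 1 ≤ M * |ev m - ev n|) (hM0 : 0 ≤ M) (hr : 4 * κ * M < 1) {a : H}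
    (ha : HasSum U a) (m : ℕ) : ‖a - ∑ j ∈ Finset.range (m + 1), U j‖ ≤
      2 * ((4 * κ * M) ^ (m + 1) / (1 - 4 * κ * M)) * facRatio (m + 1) := by
  have hr0 : 0 ≤ 4 * κ * M := by positivity
  refine (tail_bound (A := 2 * (4 * κ * M) ^ (m + 1) * facRatio (m + 1)) hr0 hr
    (fun j => ?_) ha).trans_eq (by ring)
  refine (h.norm_le hκ hQ hM hM0 _).trans ?_
  have := facRatio_antitone (show m + 1 ≤ j + (m + 1) by omega)
  calc 2 * (4 * κ * M) ^ (j + (m + 1)) * facRatio (j + (m + 1))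
      ≤ 2 * (4 * κ * M) ^ (j + (m + 1)) * facRatio (m + 1) := by gcongr
    _ = _ := by rw [pow_add]; ring

lemma AbsFD.abs_sub_le (h : AbsFD b ev Q n Λ U) (hκ : 0 ≤ κ) (hQ : ∀ x, ‖Q x‖ ≤ κ * ‖x‖)
    (hM : ∀ m, m ≠ n → 1 ≤ M * |ev m - ev n|) (hM0 : 0 ≤ M) (hr : 4 * κ * M < 1) {a : ℝ}
    (ha : HasSum Λ a) (m : ℕ) : |a - ∑ j ∈ Finset.range (m + 1), Λ j| ≤
      2 * κ * ((4 * κ * M) ^ m / (1 - 4 * κ * M)) * facRatio m := by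
  have hr0 : 0 ≤ 4 * κ * M := by positivity
  refine (tail_bound (A := 2 * κ * (4 * κ * M) ^ m * facRatio m) hr0 hr
    (fun j => ?_) ha).trans_eq (by ring)
  refine (h.abs_lam_le hQ (j + m)).trans ?_
  have h1 := h.norm_le hκ hQ hM hM0 (j + m)
  have := facRatio_antitone (show m ≤ j + m by omega)
  calc κ * ‖U (j + m)‖ ≤ κ * (2 * (4 * κ * M) ^ (j + m) * facRatio m) := by
        gcongr
        exact h1.trans (by gcongr)
    _ = _ := by rw [pow_add]; ring

/-- With Λ_0 = λ_n moved into the sum, the right side of the step is a Cauchy product minus Q U_j.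
Summing over j and adding the zeroth order identity gives the equation; it is stated coefficientwise
because the diagonal operator may be unbounded. -/
lemma AbsFD.limit_eq [CompleteSpace H] (h : AbsFD b ev Q n Λ U) (hU : Summable fun j => ‖U j‖)
    (hΛ : Summable fun j => ‖Λ j‖) (m : ℕ) :
    ev m * inner ℝ (b m) (∑' j, U j) =
      inner ℝ (b m) ((∑' j, Λ j) • (∑' j, U j) - Q (∑' j, U j)) := by
  have hUs : HasSum U (∑' j, U j) := hU.of_norm.hasSum
  have ha : HasSum (fun j => inner ℝ (b m) (U j)) (inner ℝ (b m) (∑' j, U j)) :=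
    hUs.mapL (innerSL ℝ (b m))
  have hq : HasSum (fun j => inner ℝ (b m) (Q (U j))) (inner ℝ (b m) (Q (∑' j, U j))) :=
    (hUs.mapL Q).mapL (innerSL ℝ (b m))
  have han : Summable fun j => ‖inner ℝ (b m) (U j)‖ := by
    refine Summable.of_nonneg_of_le (fun j => norm_nonneg _) (fun j => ?_) hU
    refine (abs_real_inner_le_norm _ _).trans ?_
    rw [b.orthonormal.1 m, one_mul]
  have hprod := hasSum_sum_range_mul_of_summable_norm han hΛ
  rw [ha.tsum_eq] at hprod
  have h1 : HasSum (fun j => ev m * inner ℝ (b m) (U (j + 1)))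
      (ev m * inner ℝ (b m) (∑' j, U j) - ev m * inner ℝ (b m) (U 0)) := by
    have := (hasSum_nat_add_iff' 1).2 (ha.mul_left (ev m))
    simpa using this
  have h2 : HasSum (fun j => ∑ k ∈ Finset.range (j + 1 + 1),
      inner ℝ (b m) (U k) * Λ (j + 1 - k))
      (inner ℝ (b m) (∑' j, U j) * (∑' j, Λ j) - inner ℝ (b m) (U 0) * Λ 0) := by
    have := (hasSum_nat_add_iff' 1).2 hprod
    simpa using this
  have h3 := h1.unique ((h2.sub hq).congr_fun fun j => by
    rw [h.step j m, inner_sub_right, inner_sum, Finset.sum_range_succ _ (j + 1), Nat.sub_self,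
      h.lam_zero]
    simp only [inner_smul_right, mul_comm (Λ _)]
    ring)
  have h4 : ev m * inner ℝ (b m) (U 0) = inner ℝ (b m) (U 0) * Λ 0 := by
    rw [h.u_zero, h.lam_zero, inner_basis]
    split_ifs with hmn
    · rw [hmn, mul_comm]
    · ring
  rw [inner_sub_right, inner_smul_right]
  linarith

end Convergence

/-- The recursion for the FD corrections in terms of the reduced resolvent `D`. -/
def fdSeq (e : H) (D Q : H →L[ℝ] H) : ℕ → H
  | 0 => e
  | j + 1 => D (∑ p : Fin (j + 1), inner ℝ e (Q (fdSeq e D Q (j - p))) • fdSeq e D Q p -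
      Q (fdSeq e D Q j))
  decreasing_by all_goals omega

/-- The reduced resolvent D has coefficients 1/(λ_m - λ_n), and 0 at m = n. The gap condition bounds
it, its zero gives the orthogonality, and the choice of Λ makes the n-th equation hold. -/
lemma exists_absFD {M : ℝ} (hM : ∀ m, m ≠ n → 1 ≤ M * |ev m - ev n|) (hM0 : 0 ≤ M) :
    ∃ Λ U, AbsFD b ev Q n Λ U := by
  obtain ⟨D, hD, -⟩ := exists_diag b (c := fun m => if m = n then 0 else (ev m - ev n)⁻¹) (M := M)
    (fun m => by
      split_ifs with h
      · simpa using hM0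
      · rw [abs_inv]
        have := hM m h
        have h0 : 0 < |ev m - ev n| := by
          by_contra h'
          have h1 : |ev m - ev n| = 0 := le_antisymm (not_lt.1 h') (abs_nonneg _)
          rw [h1, mul_zero] at this
          linarith
        rwa [inv_le_iff_one_le_mul₀ h0])
  set U := fdSeq (b n) D Q with hU
  set Λ : ℕ → ℝ := fun k => if k = 0 then ev n else inner ℝ (b n) (Q (U (k - 1))) with hΛ
  have hU1 : ∀ j, U (j + 1) = D (∑ p ∈ Finset.range (j + 1), Λ (j + 1 - p) • U p - Q (U j)) :=
    fun j => by
      rw [hU, fdSeq, Finset.sum_range]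
      congr 2
      refine Finset.sum_congr rfl fun p _ => ?_
      have : j + 1 - (p : ℕ) ≠ 0 := by omega
      rw [hΛ]
      simp only [if_neg this]
      rw [show j + 1 - (p : ℕ) - 1 = j - p by omega]
  have horth : ∀ j, inner ℝ (b n) (U (j + 1)) = 0 := fun j => by
    rw [hU1, hD, if_pos rfl, zero_mul]
  have h0 : U 0 = b n := by rw [hU, fdSeq]
  refine ⟨Λ, U, by simp [hΛ], h0, fun j m => ?_, horth⟩
  rcases eq_or_ne m n with rfl | hm
  · rw [horth, mul_zero, zero_add, inner_sub_right, inner_sum, Finset.sum_range_succ',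
      Finset.sum_eq_zero fun p _ => by rw [inner_smul_right, horth p, mul_zero], h0,
      inner_smul_right, inner_basis, if_pos rfl]
    simp [hΛ]
  · have h1 : ev m - ev n ≠ 0 := fun h => by
      have := hM m hm
      rw [h, abs_zero, mul_zero] at this
      linarith
    have h2 := hD (∑ p ∈ Finset.range (j + 1), Λ (j + 1 - p) • U p - Q (U j)) m
    rw [← hU1, if_neg hm] at h2
    rw [h2]
    field_simp
    ring

end Hilbert

/-! ### The weighted L² space: orthonormality and completeness of the base functions. -/

variable {α β s : ℝ}

lemma wInner_comm (u v : ℝ → ℝ) : wInner α β u v = wInner α β v u := by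
  simp only [wInner, mul_comm]

lemma wInner_congr {u u' v v' : ℝ → ℝ} (hu : u =ᵐ[volI] u') (hv : v =ᵐ[volI] v') :
    wInner α β u v = wInner α β u' v' := by
  refine integral_congr_ae (ae_weightMeasure_iff.2 ?_)
  filter_upwards [hu, hv] with x h1 h2
  rw [h1, h2]

lemma wInner_const_mul_right (c : ℝ) (u v : ℝ → ℝ) :
    wInner α β u (fun x => c * v x) = c * wInner α β u v := by
  simp only [wInner, mul_left_comm _ c, integral_const_mul]

lemma wInner_eq_integral_datum (u v : ℝ → ℝ) : wInner α β u v = ∫ z, datum α β u z * v z := by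
  rw [wInner, integral_weightMeasure]
  congr 1
  ext z
  by_cases hz : z ∈ Ioo (-1 : ℝ) 1
  · rw [datum, cut_of_mem hz, cut_of_mem hz, mul_assoc]
  · rw [datum, cut_of_notMem hz, cut_of_notMem hz, zero_mul]

/-- Measurable functions on `(-1,1)` that are bounded by a multiple of `(1-x)^α`. -/
def WeightBounded (α : ℝ) (w : ℝ → ℝ) : Prop :=
  AEStronglyMeasurable w volI ∧ ∃ K : ℝ, 0 ≤ K ∧ ∀ᵐ x ∂volI, |w x| ≤ K * (1 - x) ^ α

lemma WeightBounded.memLp {w : ℝ → ℝ} (h : WeightBounded α w) (hα : -1 < α) (hβ : -1 < β) :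
    MemLp w 2 (weightMeasure (-α) β) := by
  obtain ⟨hm, K, -, hK⟩ := h
  exact memLp_two_of_bound hα hβ hm hK

lemma WeightBounded.congr {w w' : ℝ → ℝ} (h : WeightBounded α w) (h' : w =ᵐ[volI] w') :
    WeightBounded α w' := by
  obtain ⟨hm, K, hK0, hK⟩ := h
  refine ⟨hm.congr h', K, hK0, ?_⟩
  filter_upwards [hK, h'] with x h1 h2
  rwa [← h2]

lemma WeightBounded.add {v w : ℝ → ℝ} (hv : WeightBounded α v) (hw : WeightBounded α w) :
    WeightBounded α fun x => v x + w x := by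
  obtain ⟨hm, K, hK0, hK⟩ := hv
  obtain ⟨hm', K', hK0', hK'⟩ := hw
  refine ⟨hm.add hm', K + K', add_nonneg hK0 hK0', ?_⟩
  filter_upwards [hK, hK'] with x h1 h2
  rw [add_mul]
  exact (abs_add_le _ _).trans (add_le_add h1 h2)

lemma WeightBounded.mul_left {p w : ℝ → ℝ} {P : ℝ} (hw : WeightBounded α w)
    (hpm : AEStronglyMeasurable p volI) (hp : ∀ᵐ x ∂volI, |p x| ≤ P) :
    WeightBounded α fun x => p x * w x := by
  obtain ⟨hm, K, hK0, hK⟩ := hw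
  refine ⟨hpm.mul hm, |P| * K, by positivity, ?_⟩
  filter_upwards [hK, hp] with x h1 h2
  rw [abs_mul, mul_assoc]
  exact mul_le_mul (h2.trans (le_abs_self _)) h1 (abs_nonneg _) (abs_nonneg _)

lemma WeightBounded.const_mul {w : ℝ → ℝ} (hw : WeightBounded α w) (c : ℝ) :
    WeightBounded α fun x => c * w x :=
  hw.mul_left (P := |c|) aestronglyMeasurable_const (Eventually.of_forall fun _ => le_rfl)

lemma weightBounded_zero : WeightBounded α fun _ => 0 :=
  ⟨aestronglyMeasurable_const, 0, le_rfl, by simp⟩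

lemma WeightBounded.sum {ι : Type*} (t : Finset ι) {w : ι → ℝ → ℝ}
    (h : ∀ i ∈ t, WeightBounded α (w i)) : WeightBounded α fun x => ∑ i ∈ t, w i x := by
  classical
  induction t using Finset.induction_on with
  | empty => simpa using weightBounded_zero
  | insert i t hi ih =>
    simp only [Finset.sum_insert hi]
    exact (h i (by simp)).add (ih fun j hj => h j (by simp [hj]))

lemma WeightBounded.solOp {w : ℝ → ℝ} (h : WeightBounded α w) (hs0 : 0 < s) (hα : s - 1 < α)
    (hβ : -1 < β) : WeightBounded α (solOp α β s w) := by
  obtain ⟨hm, K, hK0, hK⟩ := h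
  refine ⟨(aestronglyMeasurable_solOp hm).restrict, K * solConst α β s,
    mul_nonneg hK0 (solConst_nonneg hs0 hα hβ), ?_⟩
  filter_upwards [ae_volI_mem] with x hx using abs_solOp_le hs0 hα hβ hK0 hK hx

lemma measurable_baseFun (α β : ℝ) (n : ℕ) : Measurable (baseFun α β n) := by
  have := (continuous_jacobiP α β n).measurable
  unfold baseFun
  fun_prop

lemma weightBounded_baseFun (α β : ℝ) (n : ℕ) : WeightBounded α (baseFun α β n) := by
  obtain ⟨C, hC0, hC⟩ := exists_bound_jacobiP α β n
  refine ⟨(measurable_baseFun α β n).aestronglyMeasurable, (√(jacobiGamma α β n))⁻¹ * C,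
    by positivity, ?_⟩
  filter_upwards [ae_volI_mem] with x hx
  have h0 : 0 < (1 - x) ^ α := Real.rpow_pos_of_pos (by linarith [hx.2]) _
  rw [baseFun, abs_mul, abs_mul, abs_of_nonneg (by positivity : 0 ≤ (√(jacobiGamma α β n))⁻¹),
    abs_of_pos h0, mul_assoc, mul_comm C]
  have := hC x hx
  gcongr

lemma wInner_solOp (hs0 : 0 < s) (hα : s - 1 < α) (hβ : -1 < β) {G h : ℝ → ℝ}
    (hG : MemLp G 2 (weightMeasure (-α) β)) (hh : WeightBounded α h) :
    wInner α β h (solOp α β s G) = wInner α β G (solOp α β s h) := by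
  obtain ⟨hm, K, hK0, hK⟩ := hh
  rw [wInner_eq_integral_datum, wInner_eq_integral_datum]
  exact integral_solOp_mul_datum hs0 hα hβ (aestronglyMeasurable_weightMeasure_iff.1 hG.1)
    (integrable_rpow_mul_datum (by linarith) hβ hG).1 hm hK0 hK

lemma solOp_baseFun_ae (hs0 : 0 < s) (hα : s - 1 < α) (hβ : -1 < β) (n : ℕ) :
    solOp α β s (baseFun α β n) =ᵐ[volI] fun x => (baseEig α β s n)⁻¹ * baseFun α β n x := by
  filter_upwards [ae_volI_mem] with x hx using solOp_baseFun hs0 hα hβ hx n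

lemma wInner_baseFun_solOp (hs0 : 0 < s) (hα : s - 1 < α) (hβ : -1 < β) {G : ℝ → ℝ}
    (hG : MemLp G 2 (weightMeasure (-α) β)) (m : ℕ) :
    wInner α β (baseFun α β m) (solOp α β s G) =
      (baseEig α β s m)⁻¹ * wInner α β (baseFun α β m) G := by
  rw [wInner_solOp hs0 hα hβ hG (weightBounded_baseFun α β m),
    wInner_congr EventuallyEq.rfl (solOp_baseFun_ae hs0 hα hβ m), wInner_const_mul_right,
    wInner_comm G]

/-- The bridge from the fractional boundary value problem to Fourier coefficients: u = TG by
uniqueness, and T is symmetric with known eigenfunctions. -/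
lemma IsSolution.wInner_baseFun (hs0 : 0 < s) (hs1 : s < 1) (hα : s - 1 < α) (hβ : -1 < β)
    {u G : ℝ → ℝ} (hu : IsSolution α β s u G) (hG : MemLp G 2 (weightMeasure (-α) β)) (m : ℕ) :
    baseEig α β s m * wInner α β (baseFun α β m) u = wInner α β (baseFun α β m) G := by
  rw [wInner_congr EventuallyEq.rfl (hu.ae_eq_solOp hs0 hs1 hα hβ hG),
    wInner_baseFun_solOp hs0 hα hβ hG, mul_inv_cancel_left₀ (baseEig_pos hs0 hα hβ m).ne']

/-- If the integral were 0, the polynomial would vanish on [-1,1] by continuity, contradicting its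
positive value at 1. -/
lemma jacobiGamma_pos (hα : -1 < α) (hβ : -1 < β) (n : ℕ) : 0 < jacobiGamma α β n := by
  have hi : Integrable (fun x => jacobiP α β n x ^ 2) (weightMeasure α β) := by
    obtain ⟨C, hC0, hC⟩ := exists_bound_jacobiP α β n
    rw [integrable_weightMeasure_iff]
    have hm := (continuous_jacobiP α β n).measurable
    refine ((integrable_cut_weight hα hβ).const_mul (C ^ 2)).mono'
      (aestronglyMeasurable_cut.2 (Measurable.aestronglyMeasurable (by fun_prop)))
      (Eventually.of_forall fun x => ?_)
    by_cases hx : x ∈ Ioo (-1 : ℝ) 1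
    · rw [cut_of_mem hx, cut_of_mem hx, Real.norm_of_nonneg
        (mul_nonneg (weight_pos hx).le (sq_nonneg _)), mul_comm, ← sq_abs]
      have h0 := (weight_pos (a := α) (b := β) hx).le
      have := hC x hx
      gcongr
    · simp [cut_of_notMem hx]
  have h0 : 0 ≤ jacobiGamma α β n := integral_nonneg fun x => sq_nonneg _
  refine lt_of_le_of_ne h0 fun h => ?_
  have h1 := (integral_eq_zero_iff_of_nonneg (fun x => sq_nonneg _) hi).1 h.symm
  have h2 : jacobiP α β n =ᵐ[volI] fun _ => 0 :=
    (ae_weightMeasure_iff.1 h1).mono fun x hx => by simpa using hx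
  have h3 : EqOn (jacobiP α β n) (fun _ => 0) (Ioo (-1) 1) :=
    Measure.eqOn_open_of_ae_eq h2 isOpen_Ioo (continuous_jacobiP α β n).continuousOn
      continuousOn_const
  have h4 := h3.closure (continuous_jacobiP α β n) continuous_const
  rw [closure_Ioo (by norm_num)] at h4
  exact (jacobiP_one_pos (b := β) hα n).ne' (h4 (right_mem_Icc.2 (by norm_num)))

lemma wInner_baseFun_self (hα : -1 < α) (hβ : -1 < β) (n : ℕ) :
    wInner α β (baseFun α β n) (baseFun α β n) = 1 := by
  have hγ := jacobiGamma_pos hα hβ n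
  have e : ∀ x ∈ Ioo (-1 : ℝ) 1, weight (-α) β x * (baseFun α β n x * baseFun α β n x) =
      (jacobiGamma α β n)⁻¹ * (weight α β x * jacobiP α β n x ^ 2) := fun x hx => by
    have h1 : (√(jacobiGamma α β n))⁻¹ * (√(jacobiGamma α β n))⁻¹ = (jacobiGamma α β n)⁻¹ := by
      rw [← mul_inv, Real.mul_self_sqrt hγ.le]
    rw [← h1, show weight α β x = (1 - x) ^ α * ((1 - x) ^ α * weight (-α) β x) by
      rw [one_sub_rpow_mul_weight hx, one_sub_rpow_mul_weight hx]; ring_nf, baseFun]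
    ring
  rw [wInner, integral_weightMeasure, integral_cut, setIntegral_congr_fun measurableSet_Ioo e,
    integral_const_mul, ← integral_cut, ← integral_weightMeasure]
  exact inv_mul_cancel₀ hγ.ne'

/-- Orthogonality comes from the symmetry of T and the distinctness of its eigenvalues. -/
lemma wInner_baseFun (hs0 : 0 < s) (hα : s - 1 < α) (hβ : -1 < β) (m n : ℕ) :
    wInner α β (baseFun α β m) (baseFun α β n) = if m = n then 1 else 0 := by
  split_ifs with h
  · rw [h, wInner_baseFun_self (by linarith) hβ]
  · have h1 := wInner_baseFun_solOp hs0 hα hβ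
      ((weightBounded_baseFun α β n).memLp (by linarith) hβ) m
    rw [wInner_congr EventuallyEq.rfl (solOp_baseFun_ae hs0 hα hβ n),
      wInner_const_mul_right] at h1
    by_contra h2
    exact h ((baseEig_strictMono hs0 hα hβ).injective (inv_injective (mul_right_cancel₀ h2 h1))).symm

/-- The integral moments determine an integrable function. -/
lemma ae_eq_zero_of_moments {μ : Measure ℝ} (hμ : ∀ᵐ x ∂μ, x ∈ Ioo (-1 : ℝ) 1) {g : ℝ → ℝ}
    (hg : Integrable g μ) (h : ∀ k : ℕ, ∫ x, ((x - 1) / 2) ^ k * g x ∂μ = 0) :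
    ∀ᵐ x ∂μ, g x = 0 := by
  have hbdd : ∀ {f : ℝ → ℝ} {C : ℝ}, Continuous f → (∀ x ∈ Ioo (-1 : ℝ) 1, |f x| ≤ C) →
      Integrable (fun x => f x * g x) μ := fun {f C} hf hC =>
    hg.bdd_mul hf.aestronglyMeasurable (hμ.mono fun x hx => hC x hx)
  have hcont : ∀ {f : ℝ → ℝ}, Continuous f → Integrable (fun x => f x * g x) μ := fun {f} hf => by
    obtain ⟨C, hC⟩ := isCompact_Icc.exists_bound_of_continuousOn (s := Icc (-1 : ℝ) 1)
      hf.continuousOn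
    exact hbdd hf fun x hx => hC x (Ioo_subset_Icc_self hx)
  have hpoly : ∀ p : Polynomial ℝ, ∫ x, p.eval ((x - 1) / 2) * g x ∂μ = 0 := fun p => by
    simp only [Polynomial.eval_eq_sum_range, Finset.sum_mul]
    rw [integral_finsetSum _ fun k _ => hcont (by fun_prop)]
    refine Finset.sum_eq_zero fun k _ => ?_
    simp only [mul_assoc, integral_const_mul, h, mul_zero]
  refine ae_eq_zero_of_integral_contDiff_smul_eq_zero hg.locallyIntegrable fun θ hθ _ => ?_
  have hθc : Continuous θ := hθ.continuous
  simp only [smul_eq_mul]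
  -- Weierstrass approximation of the test function in the variable (x-1)/2, which ranges over
  -- [-1,0].
  have key : ∀ ε > 0, |∫ x, θ x * g x ∂μ| ≤ ε * ∫ x, |g x| ∂μ := fun ε hε => by
    obtain ⟨p, hp⟩ := exists_polynomial_near_of_continuousOn (-1) 0 (fun t => θ (2 * t + 1))
      (by fun_prop) ε hε
    rw [← sub_zero (∫ x, θ x * g x ∂μ), ← hpoly p, ← integral_sub (hcont hθc)
      (hcont (by fun_prop)), ← integral_const_mul, ← Real.norm_eq_abs]
    refine norm_integral_le_of_norm_le (hg.abs.const_mul ε) ?_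
    filter_upwards [hμ] with x hx
    have h1 := hp ((x - 1) / 2) ⟨by linarith [hx.1], by linarith [hx.2]⟩
    rw [show 2 * ((x - 1) / 2) + 1 = x by ring, abs_sub_comm] at h1
    rw [← sub_mul, norm_mul, Real.norm_eq_abs, Real.norm_eq_abs]
    gcongr
  have hlim : Tendsto (fun ε => ε * ∫ x, |g x| ∂μ) (𝓝[>] 0) (𝓝 (0 * ∫ x, |g x| ∂μ)) :=
    (tendsto_id.mono_left nhdsWithin_le_nhds).mul_const _
  rw [zero_mul] at hlim
  exact abs_nonpos_iff.1 (ge_of_tendsto hlim (eventually_mem_nhdsWithin.mono key))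

/-- A triangular system in the powers of (x-1)/2, with nonzero diagonal by
`jacobiCoeff_self_ne_zero`. -/
lemma moments_of_jacobi {μ : Measure ℝ} (hμ : ∀ᵐ x ∂μ, x ∈ Ioo (-1 : ℝ) 1) {g : ℝ → ℝ}
    (hg : Integrable g μ) (hab : -2 < α + β) (h : ∀ m, ∫ x, jacobiP α β m x * g x ∂μ = 0)
    (k : ℕ) : ∫ x, ((x - 1) / 2) ^ k * g x ∂μ = 0 := by
  induction k using Nat.strong_induction_on with
  | _ k ih =>
    have hi : ∀ j : ℕ, Integrable (fun x => jacobiCoeff α β k j * ((x - 1) / 2) ^ j * g x) μ :=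
      fun j => by
        refine hg.bdd_mul (c := |jacobiCoeff α β k j|)
          (Continuous.aestronglyMeasurable (by fun_prop)) (hμ.mono fun x hx => ?_)
        rw [norm_mul, norm_pow, Real.norm_eq_abs, Real.norm_eq_abs]
        refine mul_le_of_le_one_right (abs_nonneg _) (pow_le_one₀ (abs_nonneg _) ?_)
        rw [abs_le]
        constructor <;> linarith [hx.1, hx.2]
    have h1 := h k
    simp only [jacobiP_eq_sum, Finset.sum_mul] at h1
    rw [integral_finsetSum _ fun j _ => hi j, Finset.sum_range_succ,
      Finset.sum_eq_zero fun j hj => by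
        simp only [mul_assoc, integral_const_mul, ih j (Finset.mem_range.1 hj), mul_zero],
      zero_add] at h1
    simp only [mul_assoc, integral_const_mul] at h1
    exact (mul_eq_zero.1 h1).resolve_left (jacobiCoeff_self_ne_zero hab k)

/-- The coefficients of f are multiples of the integrals of Jacobi polynomials against (1-x)^α f,
which is integrable as a product of two L² functions. All its moments therefore vanish. -/
lemma ae_eq_zero_of_wInner_baseFun (hα : -1 < α) (hβ : -1 < β) {f : ℝ → ℝ}
    (hf : MemLp f 2 (weightMeasure (-α) β)) (h : ∀ m, wInner α β (baseFun α β m) f = 0) :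
    f =ᵐ[volI] 0 := by
  have hg : Integrable (fun x => (1 - x) ^ α * f x) (weightMeasure (-α) β) :=
    (memLp_rpow hα hβ).integrable_mul hf
  have hμ : ∀ᵐ x ∂weightMeasure (-α) β, x ∈ Ioo (-1 : ℝ) 1 := ae_weightMeasure_iff.2 ae_volI_mem
  have h1 := ae_eq_zero_of_moments hμ hg (moments_of_jacobi (α := α) (β := β) hμ hg (by linarith) fun m => by
    have h2 := h m
    have e : ∀ x, baseFun α β m x * f x =
      (√(jacobiGamma α β m))⁻¹ * (jacobiP α β m x * ((1 - x) ^ α * f x)) := fun x => by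
      rw [baseFun]; ring
    rw [wInner] at h2
    simp only [e, integral_const_mul] at h2
    exact (mul_eq_zero.1 h2).resolve_left
      (inv_ne_zero (Real.sqrt_pos.2 (jacobiGamma_pos hα hβ m)).ne'))
  filter_upwards [ae_weightMeasure_iff.1 h1, ae_volI_mem] with x hx hxI
  exact (mul_eq_zero.1 hx).resolve_left (Real.rpow_pos_of_pos (by linarith [hxI.2]) _).ne'

/-- The Hilbert space `L²_ω`. -/
abbrev WL2 (α β : ℝ) : Type := Lp ℝ 2 (weightMeasure (-α) β)

lemma inner_eq_wInner (f g : WL2 α β) : inner ℝ f g = wInner α β f g := by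
  rw [L2.inner_def, wInner]
  simp [mul_comm]

lemma norm_eq_wNorm (f : WL2 α β) : ‖f‖ = wNorm α β f := by
  rw [norm_eq_sqrt_real_inner, inner_eq_wInner, wInner, wNorm]
  simp only [sq]

lemma wNorm_congr {u u' : ℝ → ℝ} (hu : u =ᵐ[volI] u') : wNorm α β u = wNorm α β u' := by
  rw [wNorm, wNorm, integral_congr_ae (ae_weightMeasure_iff.2 (hu.mono fun x hx => by rw [hx]))]

lemma coeFn_toLp_volI {f : ℝ → ℝ} (hf : MemLp f 2 (weightMeasure (-α) β)) :
    hf.toLp f =ᵐ[volI] f := ae_weightMeasure_iff.1 hf.coeFn_toLp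

lemma WL2.ext {f g : WL2 α β} (h : f =ᵐ[volI] g) : f = g := Lp.ext (ae_weightMeasure_iff.2 h)

/-- The generalized Jacobi functions form a Hilbert basis of `L²_ω`. -/
lemma exists_hilbertBasis_baseFun (hs0 : 0 < s) (hα : s - 1 < α) (hβ : -1 < β) :
    ∃ b : HilbertBasis ℕ ℝ (WL2 α β), ∀ m, b m =ᵐ[volI] baseFun α β m := by
  have hα1 : -1 < α := by linarith
  have hmem : ∀ m, MemLp (baseFun α β m) 2 (weightMeasure (-α) β) := fun m =>
    (weightBounded_baseFun α β m).memLp hα1 hβ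
  have ho : Orthonormal ℝ fun m => (hmem m).toLp (baseFun α β m) := by
    rw [orthonormal_iff_ite]
    intro m n
    rw [inner_eq_wInner, wInner_congr (coeFn_toLp_volI _) (coeFn_toLp_volI _),
      wInner_baseFun hs0 hα hβ]
  refine ⟨HilbertBasis.mkOfOrthogonalEqBot ho ?_, fun m => ?_⟩
  · rw [eq_bot_iff]
    intro f hf
    rw [Submodule.mem_bot]
    have h0 : ((0 : WL2 α β) : ℝ → ℝ) =ᵐ[volI] 0 := ae_weightMeasure_iff.1 (Lp.coeFn_zero ℝ 2 _)
    refine WL2.ext ((ae_eq_zero_of_wInner_baseFun hα1 hβ (Lp.memLp f) fun m => ?_).trans h0.symm)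
    have h1 := (Submodule.mem_orthogonal _ f).1 hf _ (Submodule.subset_span ⟨m, rfl⟩)
    rwa [inner_eq_wInner, wInner_congr (coeFn_toLp_volI _) EventuallyEq.rfl] at h1
  · rw [HilbertBasis.coe_mkOfOrthogonalEqBot]
    exact coeFn_toLp_volI _

/-! ### Regularity: from L² solutions to bounds by (1-x)^α. -/

variable {α β s : ℝ}

/-- Multiplication by a bounded function. -/
lemma exists_mulOp {p : ℝ → ℝ} {P : ℝ} (hpm : AEStronglyMeasurable p volI)
    (hp : ∀ᵐ x ∂volI, |p x| ≤ P) :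
    ∃ Q : WL2 α β →L[ℝ] WL2 α β, (∀ w : WL2 α β, Q w =ᵐ[volI] fun x => p x * w x) ∧
      ∀ w, ‖Q w‖ ≤ P * ‖w‖ := by
  have hmem : ∀ w : WL2 α β, MemLp (fun x => p x * w x) 2 (weightMeasure (-α) β) := fun w => by
    refine (Lp.memLp w).of_le_mul (c := P)
      ((aestronglyMeasurable_weightMeasure_iff.2 hpm).mul (Lp.memLp w).1)
      (ae_weightMeasure_iff.2 (hp.mono fun x hx => ?_))
    rw [norm_mul]
    exact mul_le_mul_of_nonneg_right hx (norm_nonneg _)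
  have hco : ∀ w, (hmem w).toLp _ =ᵐ[volI] fun x => p x * w x := fun w => coeFn_toLp_volI _
  have hn : ∀ w, ‖(hmem w).toLp _‖ ≤ P * ‖w‖ := fun w => by
    refine Lp.norm_le_mul_norm_of_ae_le_mul (ae_weightMeasure_iff.2 ?_)
    filter_upwards [hco w, hp] with x h1 h2
    rw [h1, norm_mul]
    exact mul_le_mul_of_nonneg_right h2 (norm_nonneg _)
  let L : WL2 α β →ₗ[ℝ] WL2 α β :=
    { toFun := fun w => (hmem w).toLp _
      map_add' := fun v w => WL2.ext <| by
        filter_upwards [hco v, hco w, hco (v + w), ae_weightMeasure_iff.1 (Lp.coeFn_add v w),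
          ae_weightMeasure_iff.1 (Lp.coeFn_add ((hmem v).toLp _) ((hmem w).toLp _))]
          with x h1 h2 h3 h4 h5
        rw [h3, h5, Pi.add_apply, h1, h2, h4, Pi.add_apply, mul_add]
      map_smul' := fun c w => WL2.ext <| by
        filter_upwards [hco w, hco (c • w), ae_weightMeasure_iff.1 (Lp.coeFn_smul c w),
          ae_weightMeasure_iff.1 (Lp.coeFn_smul c ((hmem w).toLp _))] with x h1 h2 h3 h4
        rw [RingHom.id_apply, h4, h2, Pi.smul_apply, h1, h3, Pi.smul_apply, smul_eq_mul,
          smul_eq_mul]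
        ring }
  exact ⟨L.mkContinuous P hn, hco, hn⟩

/-- Pointwise bounds by a multiple of `(1-x)^α` are closed under `L²` limits. -/
lemma bound_of_tendsto {x : ℕ → WL2 α β} {U : WL2 α β} (h : Tendsto x atTop (𝓝 U)) {K : ℝ}
    (hx : ∀ j, ∀ᵐ t ∂volI, |x j t| ≤ K * (1 - t) ^ α) :
    ∀ᵐ t ∂volI, |U t| ≤ K * (1 - t) ^ α := by
  obtain ⟨ns, -, hns⟩ := (tendstoInMeasure_of_tendsto_Lp h).exists_seq_tendsto_ae
  filter_upwards [ae_weightMeasure_iff.1 hns, ae_all_iff.2 hx] with t h1 h2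
  exact le_of_tendsto h1.abs (Eventually.of_forall fun j => h2 (ns j))

lemma coeFn_sum_smul (t : Finset ℕ) (c : ℕ → ℝ) (f : ℕ → WL2 α β) :
    (↑(∑ m ∈ t, c m • f m) : ℝ → ℝ) =ᵐ[volI] fun x => ∑ m ∈ t, c m * f m x := by
  filter_upwards [ae_weightMeasure_iff.1 (Lp.coeFn_finsetSum t fun m => c m • f m),
    ae_all_iff.2 fun m => ae_weightMeasure_iff.1 (Lp.coeFn_smul (c m) (f m))] with x h1 h2
  rw [h1, Finset.sum_apply]
  exact Finset.sum_congr rfl fun m _ => h2 m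

lemma coeFn_sub_volI (f g : WL2 α β) : ↑(f - g) =ᵐ[volI] fun x => f x - g x :=
  ae_weightMeasure_iff.1 (Lp.coeFn_sub f g)

lemma coeFn_add_volI (f g : WL2 α β) : ↑(f + g) =ᵐ[volI] fun x => f x + g x :=
  ae_weightMeasure_iff.1 (Lp.coeFn_add f g)

lemma coeFn_smul_volI (c : ℝ) (f : WL2 α β) : ↑(c • f) =ᵐ[volI] fun x => c * f x :=
  ae_weightMeasure_iff.1 (Lp.coeFn_smul c f)

variable {b : HilbertBasis ℕ ℝ (WL2 α β)}

lemma coeFn_sum_smul_basis (hb : ∀ m, b m =ᵐ[volI] baseFun α β m) (t : Finset ℕ) (c : ℕ → ℝ) :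
    (↑(∑ m ∈ t, c m • b m) : ℝ → ℝ) =ᵐ[volI] fun x => ∑ m ∈ t, c m * baseFun α β m x := by
  filter_upwards [coeFn_sum_smul t c fun m => b m, ae_all_iff.2 hb] with x h1 h2
  simp only [h1, h2]

lemma inner_basis_eq (hb : ∀ m, b m =ᵐ[volI] baseFun α β m) {f : WL2 α β} {u : ℝ → ℝ}
    (h : f =ᵐ[volI] u) (m : ℕ) : inner ℝ (b m) f = wInner α β (baseFun α β m) u := by
  rw [inner_eq_wInner, wInner_congr (hb m) h]

/-- A weak solution with weight-bounded data is given by the solution operator. -/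
lemma ae_eq_solOp_of_coeff (hs0 : 0 < s) (hα : s - 1 < α) (hβ : -1 < β)
    (hb : ∀ m, b m =ᵐ[volI] baseFun α β m) {U F : WL2 α β} (hF : WeightBounded α F)
    (h : ∀ m, baseEig α β s m * inner ℝ (b m) U = inner ℝ (b m) F) :
    U =ᵐ[volI] solOp α β s F := by
  have hα1 : -1 < α := by linarith
  have hm := (hF.solOp hs0 hα hβ).memLp hα1 hβ
  have e : U = hm.toLp _ := hilbertBasis_ext b fun m => by
    have h1 := (baseEig_pos hs0 hα hβ m).ne'
    rw [inner_basis_eq hb (coeFn_toLp_volI hm), wInner_baseFun_solOp hs0 hα hβ (hF.memLp hα1 hβ),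
      ← inner_basis_eq hb (f := F) EventuallyEq.rfl, ← h, inv_mul_cancel_left₀ h1]
  rw [e]
  exact coeFn_toLp_volI hm

/-- The solution operator with the first `N` modes removed gains an arbitrarily small factor in the
weighted sup norm. -/
lemma truncated_solOp_bound (hs0 : 0 < s) (hs1 : s < 1) (hα : s - 1 < α) (hβ : -1 < β)
    (hb : ∀ m, b m =ᵐ[volI] baseFun α β m) (N : ℕ) {D : WL2 α β →L[ℝ] WL2 α β}
    (hD : ∀ x m, inner ℝ (b m) (D x) = (if m < N then 0 else (baseEig α β s m)⁻¹) *
      inner ℝ (b m) x) {ε : ℝ} (hε : 0 < ε) :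
    ∃ C, 0 ≤ C ∧ ∀ (w : WL2 α β) (K : ℝ), 0 ≤ K → (∀ᵐ x ∂volI, |w x| ≤ K * (1 - x) ^ α) →
      ∀ᵐ x ∂volI, |D w x| ≤ (ε * K + C * ‖w‖) * (1 - x) ^ α := by
  have hα1 : -1 < α := by linarith
  obtain ⟨C, hC0, hC⟩ := abs_solOp_le_small hs0 hs1 hα hβ hε
  choose B hB0 hB using fun m => (weightBounded_baseFun α β m).2
  set W := wNorm α β fun x => (1 - x) ^ α
  have hW : 0 ≤ W := Real.sqrt_nonneg _
  have hev := baseEig_pos hs0 hα hβ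
  refine ⟨C * W + ∑ m ∈ Finset.range N, (baseEig α β s m)⁻¹ * B m,
    add_nonneg (mul_nonneg hC0 hW) (Finset.sum_nonneg fun m _ =>
      mul_nonneg (inv_pos.2 (hev m)).le (hB0 m)), fun w K hK0 hK => ?_⟩
  have hwm : AEStronglyMeasurable w volI := aestronglyMeasurable_weightMeasure_iff.1 (Lp.memLp w).1
  have hw : WeightBounded α w := ⟨hwm, K, hK0, hK⟩
  have hm := (hw.solOp hs0 hα hβ).memLp hα1 hβ
  -- D is T minus finitely many modes. T is small up to an L² term, and each mode is bounded by ‖w‖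
  -- times a multiple of (1-x)^α.
  have e : D w = hm.toLp _ - ∑ m ∈ Finset.range N, ((baseEig α β s m)⁻¹ * inner ℝ (b m) w) • b m :=
    hilbertBasis_ext b fun k => by
      rw [hD, inner_sub_right, inner_basis_eq hb (coeFn_toLp_volI hm),
        wInner_baseFun_solOp hs0 hα hβ (Lp.memLp w), ← inner_basis_eq hb (f := w) EventuallyEq.rfl,
        inner_sum]
      simp only [inner_smul_right, inner_basis]
      simp only [mul_ite, mul_one, mul_zero, Finset.sum_ite_eq, Finset.mem_range]
      split_ifs <;> ring
  have hsum : (↑(∑ m ∈ Finset.range N, ((baseEig α β s m)⁻¹ * inner ℝ (b m) w) • b m) : ℝ → ℝ)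
      =ᵐ[volI] fun x => ∑ m ∈ Finset.range N,
        ((baseEig α β s m)⁻¹ * inner ℝ (b m) w) * baseFun α β m x :=
    coeFn_sum_smul_basis hb _ _
  have hsub := coeFn_sub_volI (hm.toLp _)
    (∑ m ∈ Finset.range N, ((baseEig α β s m)⁻¹ * inner ℝ (b m) w) • b m)
  filter_upwards [hsub, hsum, coeFn_toLp_volI hm, ae_volI_mem, ae_all_iff.2 hB] with x h1 h2 h3 hx h4
  have hp : 0 ≤ (1 - x) ^ α := Real.rpow_nonneg (by linarith [hx.2]) _
  rw [e, h1, h2, h3]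
  have h5 := hC w K hwm hK0 hK x hx
  have h6 : |∑ m ∈ Finset.range N, ((baseEig α β s m)⁻¹ * inner ℝ (b m) w) * baseFun α β m x| ≤
      (∑ m ∈ Finset.range N, (baseEig α β s m)⁻¹ * B m) * ‖w‖ * (1 - x) ^ α := by
    rw [Finset.sum_mul, Finset.sum_mul]
    refine (Finset.abs_sum_le_sum_abs _ _).trans (Finset.sum_le_sum fun m _ => ?_)
    rw [abs_mul, abs_mul, abs_of_pos (inv_pos.2 (hev m))]
    have h7 : |inner ℝ (b m) w| ≤ ‖w‖ := by
      simpa [b.orthonormal.1 m] using abs_real_inner_le_norm (b m) w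
    have := inv_pos.2 (hev m)
    calc (baseEig α β s m)⁻¹ * |inner ℝ (b m) w| * |baseFun α β m x| ≤
        (baseEig α β s m)⁻¹ * ‖w‖ * (B m * (1 - x) ^ α) := by
          gcongr
          exact h4 m
      _ = _ := by ring
  have h8 : ∫ z, (1 - z) ^ α * |datum α β w z| ≤ ‖w‖ * W := by
    rw [norm_eq_wNorm]
    exact (integrable_rpow_mul_datum hα1 hβ (Lp.memLp w)).2
  calc _ ≤ (ε * K + C * ∫ z, (1 - z) ^ α * |datum α β w z|) * (1 - x) ^ α +
        (∑ m ∈ Finset.range N, (baseEig α β s m)⁻¹ * B m) * ‖w‖ * (1 - x) ^ α :=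
        (abs_sub _ _).trans (add_le_add h5 h6)
    _ ≤ (ε * K + C * (‖w‖ * W)) * (1 - x) ^ α +
        (∑ m ∈ Finset.range N, (baseEig α β s m)⁻¹ * B m) * ‖w‖ * (1 - x) ^ α := by gcongr
    _ = _ := by ring

/-- Regularity: `L²_ω` solutions of `L U = p U + h`, in the sense of Fourier coefficients, with
bounded `p` and weight-bounded `h` are weight-bounded. -/
lemma weightBounded_of_coeff (hs0 : 0 < s) (hs1 : s < 1) (hα : s - 1 < α) (hβ : -1 < β)
    (hb : ∀ m, b m =ᵐ[volI] baseFun α β m) {p : ℝ → ℝ} {P : ℝ} (hP0 : 0 ≤ P)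
    (hpm : AEStronglyMeasurable p volI) (hp : ∀ᵐ x ∂volI, |p x| ≤ P) {U F h : WL2 α β}
    (hh : WeightBounded α h) (hF : F =ᵐ[volI] fun x => p x * U x + h x)
    (hU : ∀ m, baseEig α β s m * inner ℝ (b m) U = inner ℝ (b m) F) : WeightBounded α U := by
  have hev := baseEig_pos hs0 hα hβ
  obtain ⟨Q, hQ, hQn⟩ := exists_mulOp (α := α) (β := β) hpm hp
  -- λ_N ≥ 2P makes D ∘ Q a contraction with factor 1/2 on L². The choice ε = 1/(2(P+1)) below gives
  -- the same factor for the weighted sup norm.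
  obtain ⟨N, hN⟩ := ((tendsto_baseEig hs0 hα hβ).eventually_ge_atTop (2 * P)).exists
  obtain ⟨D, hD, hDn⟩ := exists_diag b (M := (baseEig α β s N)⁻¹)
    (c := fun m => if m < N then 0 else (baseEig α β s m)⁻¹) fun m => by
      split_ifs with hm
      · simpa using (hev N).le
      · rw [abs_of_pos (inv_pos.2 (hev m))]
        exact inv_anti₀ (hev N) ((baseEig_strictMono hs0 hα hβ).monotone (not_lt.1 hm))
  obtain ⟨C, hC0, hC⟩ := truncated_solOp_bound hs0 hs1 hα hβ hb N hD
    (show 0 < 1 / (2 * (P + 1)) by positivity)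
  have hFQ : F = Q U + h := WL2.ext <| by
    filter_upwards [hF, hQ U, coeFn_add_volI (Q U) h] with x h1 h2 h3
    rw [h1, h3, h2]
  set R : WL2 α β := ∑ m ∈ Finset.range N, inner ℝ (b m) U • b m with hR
  -- The modes below N are collected in R; above N, D divides by λ_m.
  have hUeq : U = D (Q U) + (D h + R) := by
    rw [← add_assoc, ← map_add, ← hFQ]
    refine hilbertBasis_ext b fun k => ?_
    rw [inner_add_right, hD, ← hU, hR, inner_sum]
    simp only [inner_smul_right, inner_basis, mul_ite, mul_one, mul_zero, Finset.sum_ite_eq,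
      Finset.mem_range]
    split_ifs
    · ring
    · rw [inv_mul_cancel_left₀ (hev k).ne', add_zero]
  set g := D h + R with hg
  have hA : ∀ w, ‖D (Q w)‖ ≤ 1 / 2 * ‖w‖ := fun w => by
    refine (hDn _).trans ?_
    have h1 := hQn w
    have h2 := inv_pos.2 (hev N)
    calc (baseEig α β s N)⁻¹ * ‖Q w‖ ≤ (baseEig α β s N)⁻¹ * (P * ‖w‖) := by gcongr
      _ = (baseEig α β s N)⁻¹ * P * ‖w‖ := by ring
      _ ≤ 1 / 2 * ‖w‖ := by
        gcongr
        rw [inv_mul_le_iff₀ (hev N)]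
        linarith
  have hgb : ∃ B, 0 ≤ B ∧ ∀ᵐ x ∂volI, |g x| ≤ B * (1 - x) ^ α := by
    obtain ⟨-, K, hK0, hK⟩ := hh
    obtain ⟨-, B, hB0, hB⟩ := WeightBounded.sum (Finset.range N) fun m _ =>
      (weightBounded_baseFun α β m).const_mul (inner ℝ (b m) U)
    have hRe : (R : ℝ → ℝ) =ᵐ[volI] fun x =>
        ∑ m ∈ Finset.range N, inner ℝ (b m) U * baseFun α β m x :=
      coeFn_sum_smul_basis hb _ _
    refine ⟨1 / (2 * (P + 1)) * K + C * ‖h‖ + B, by positivity, ?_⟩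
    filter_upwards [hC h K hK0 hK, hB, hRe, coeFn_add_volI (D h) R] with x h1 h2 h3 h4
    rw [h4, h3, add_mul]
    exact (abs_add_le _ _).trans (add_le_add h1 h2)
  obtain ⟨B, hB0, hB⟩ := hgb
  -- Whether U has a weighted sup bound is not known in advance, so the fixed point equation is
  -- iterated from 0: the iterates have such bounds, uniformly in j, and converge to U in L².
  let x : ℕ → WL2 α β := fun j => (fun w => D (Q w) + g)^[j] 0
  have hx0 : x 0 = 0 := rfl
  have hx1 : ∀ j, x (j + 1) = D (Q (x j)) + g := fun j =>
    Function.iterate_succ_apply' (fun w => D (Q w) + g) j 0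
  have hxn : ∀ j, ‖x j‖ ≤ 2 * ‖g‖ := fun j => by
    induction j with
    | zero => rw [hx0, norm_zero]; positivity
    | succ j ih =>
      rw [hx1]
      refine (norm_add_le _ _).trans ?_
      linarith [hA (x j)]
  have hxU : ∀ j, ‖x j - U‖ ≤ (1 / 2) ^ j * ‖U‖ := fun j => by
    induction j with
    | zero => simp [hx0]
    | succ j ih =>
      have e : x (j + 1) - U = D (Q (x j - U)) := by
        rw [hx1, map_sub, map_sub]
        nth_rewrite 1 [hUeq]
        abel
      rw [e, pow_succ]
      refine (hA _).trans ?_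
      linarith
  -- K solves K = K/2 + C(2P‖g‖) + B, so the bound reproduces itself in the induction.
  set K := 2 * (C * (P * (2 * ‖g‖)) + B) with hK
  have hK0 : 0 ≤ K := by positivity
  have hxb : ∀ j, ∀ᵐ t ∂volI, |x j t| ≤ K * (1 - t) ^ α := fun j => by
    induction j with
    | zero =>
      have h0 : ((0 : WL2 α β) : ℝ → ℝ) =ᵐ[volI] 0 :=
        ae_weightMeasure_iff.1 (Lp.coeFn_zero ℝ 2 _)
      filter_upwards [h0, ae_volI_mem] with t h1 ht
      have hp : 0 ≤ (1 - t) ^ α := Real.rpow_nonneg (by linarith [ht.2]) _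
      rw [hx0, h1]
      simpa using mul_nonneg hK0 hp
    | succ j ih =>
      have hQb : ∀ᵐ t ∂volI, |Q (x j) t| ≤ (P * K) * (1 - t) ^ α := by
        filter_upwards [hQ (x j), ih, hp] with t h1 h2 h3
        rw [h1, abs_mul, mul_assoc]
        gcongr
      filter_upwards [hC (Q (x j)) (P * K) (by positivity) hQb, hB, ae_volI_mem,
        coeFn_add_volI (D (Q (x j))) g] with t h1 h2 ht h3
      have hp0 : 0 ≤ (1 - t) ^ α := Real.rpow_nonneg (by linarith [ht.2]) _
      rw [hx1, h3]
      refine (abs_add_le _ _).trans ((add_le_add h1 h2).trans ?_)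
      rw [← add_mul]
      refine mul_le_mul_of_nonneg_right ?_ hp0
      have h4 : 1 / (2 * (P + 1)) * (P * K) ≤ K / 2 := by
        rw [div_mul_eq_mul_div, div_le_div_iff₀ (by positivity) (by positivity)]
        nlinarith
      have h5 : C * ‖Q (x j)‖ ≤ C * (P * (2 * ‖g‖)) := by
        gcongr
        exact (hQn _).trans (mul_le_mul_of_nonneg_left (hxn j) hP0)
      linarith
  have hlim : Tendsto x atTop (𝓝 U) := by
    rw [tendsto_iff_norm_sub_tendsto_zero]
    refine squeeze_zero (fun j => norm_nonneg _) hxU ?_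
    simpa using (tendsto_pow_atTop_nhds_zero_of_lt_one (by norm_num : (0 : ℝ) ≤ 1 / 2)
      (by norm_num)).mul_const ‖U‖
  exact ⟨aestronglyMeasurable_weightMeasure_iff.1 (Lp.memLp U).1, K, hK0,
    bound_of_tendsto hlim hxb⟩

/-! ### Assembling the scheme, the eigenpair and the error bounds. -/

variable {α β s : ℝ}

lemma cut_congr {f g : ℝ → ℝ} (h : EqOn f g (Ioo (-1) 1)) : cut f = cut g :=
  indicator_congr h

lemma memI_nhdsLT : Ioo (-1 : ℝ) 1 ∈ 𝓝[<] (1 : ℝ) := Ioo_mem_nhdsLT (by norm_num)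

lemma memI_nhdsGT : Ioo (-1 : ℝ) 1 ∈ 𝓝[>] (-1 : ℝ) := Ioo_mem_nhdsGT (by norm_num)

/-- All conditions depend only on the values in (-1,1); almost everywhere equality would not do,
because some boundary conditions are pointwise. -/
lemma IsSolution.congr {u v G : ℝ → ℝ} (h : IsSolution α β s u G) (e : EqOn u v (Ioo (-1) 1)) :
    IsSolution α β s v G := by
  have e1 : EqOn (rightInt s u) (rightInt s v) (Ioo (-1) 1) := fun x hx => by
    rw [rightInt_eq hx, rightInt_eq hx, cut_congr e]
  have e2 : EqOn (flux α β s u) (flux α β s v) (Ioo (-1) 1) := fun x hx => by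
    rw [flux, flux, rightDeriv, rightDeriv,
      (e1.eventuallyEq_of_mem (isOpen_Ioo.mem_nhds hx)).deriv_eq]
  have e3 : EqOn (leftInt s (flux α β s u)) (leftInt s (flux α β s v)) (Ioo (-1) 1) :=
    fun x hx => by rw [leftInt_eq hx, leftInt_eq hx, cut_congr e2]
  have e4 : EqOn (jacobiOp α β s u) (jacobiOp α β s v) (Ioo (-1) 1) := fun x hx => by
    rw [jacobiOp, jacobiOp, leftDeriv, leftDeriv,
      (e3.eventuallyEq_of_mem (isOpen_Ioo.mem_nhds hx)).deriv_eq]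
  exact
    { memLp := h.memLp.ae_eq (ae_weightMeasure_iff.2 (ae_volI_mem.mono fun x hx => e hx))
      ac_right := h.ac_right.congr e1
      flux_integrable := fun x hx => (h.flux_integrable x hx).congr fun y hy => by
        rw [uIoc_of_le hx.1.le] at hy
        exact e2 ⟨hy.1, hy.2.trans_lt hx.2⟩
      ac_left := h.ac_left.congr e3
      eqn := by
        filter_upwards [h.eqn, ae_volI_mem] with x h1 hx
        rw [← e4 hx, h1]
      bdd_left := h.bdd_left.imp fun C hC => by
        filter_upwards [hC, memI_nhdsGT] with x h1 hx
        rwa [← e hx]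
      bc_pos := fun hα => (h.bc_pos hα).congr' (e.eventuallyEq_of_mem memI_nhdsLT)
      bc_zero := fun hα => (h.bc_zero hα).imp fun C hC => by
        filter_upwards [hC, memI_nhdsLT] with x h1 hx
        rwa [← e hx]
      bc_neg := fun hα => (h.bc_neg hα).imp fun C hC => by
        filter_upwards [hC, memI_nhdsLT] with x h1 hx
        rwa [← e2 hx]
      no_sing_right := h.no_sing_right.congr' (e1.eventuallyEq_of_mem memI_nhdsLT)
      no_sing_left := h.no_sing_left.congr' (e3.eventuallyEq_of_mem memI_nhdsGT) }

lemma solOp_const_mul (c : ℝ) (G : ℝ → ℝ) (x : ℝ) :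
    solOp α β s (fun y => c * G y) x = c * solOp α β s G x := by
  have h1 : datum α β (fun y => c * G y) = fun y => c * datum α β G y := by
    ext y
    by_cases hy : y ∈ Ioo (-1 : ℝ) 1
    · rw [datum, datum, cut_of_mem hy, cut_of_mem hy, mul_left_comm]
    · rw [datum, datum, cut_of_notMem hy, cut_of_notMem hy, mul_zero]
  have h2 : solDeriv α β s (fun y => c * G y) = fun y => c * solDeriv α β s G y := by
    ext y
    rw [solDeriv, solDeriv, h1]
    by_cases hy : y ∈ Ioo (-1 : ℝ) 1
    · rw [cut_of_mem hy, cut_of_mem hy, fL_const_mul, mul_left_comm]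
    · rw [cut_of_notMem hy, cut_of_notMem hy, mul_zero]
  rw [solOp, h2, fR_const_mul, solOp]

lemma WeightBounded.isSolution {G G' : ℝ → ℝ} (hG : WeightBounded α G) (hs0 : 0 < s) (hs1 : s < 1)
    (hα : s - 1 < α) (hβ : -1 < β) (hG' : G' =ᵐ[volI] G) :
    IsSolution α β s (FracJacobi.solOp α β s G) G' := by
  obtain ⟨hm, K, hK0, hK⟩ := hG
  exact isSolution_solOp hs0 hs1 hα hβ hm hK0 hK hG'

lemma wNorm_baseFun (hα : -1 < α) (hβ : -1 < β) (n : ℕ) : wNorm α β (baseFun α β n) = 1 := by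
  have h := wInner_baseFun_self hα hβ n
  rw [wInner] at h
  simp only [wNorm, sq, h, Real.sqrt_one]

/-- On (-1,1) the base function equals T applied to λ_n times itself, at every point, so
`isSolution_solOp` applies. -/
lemma isEigenpair_baseFun (hs0 : 0 < s) (hs1 : s < 1) (hα : s - 1 < α) (hβ : -1 < β) (n : ℕ) :
    IsEigenpair α β s (fun _ => 0) (baseEig α β s n) (baseFun α β n) := by
  refine ⟨by rw [wNorm_baseFun (by linarith) hβ]; exact one_ne_zero, ?_⟩
  refine (((weightBounded_baseFun α β n).const_mul (baseEig α β s n)).isSolution hs0 hs1 hα hβ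
    (Eventually.of_forall fun x => by ring)).congr fun x hx => ?_
  rw [solOp_const_mul, solOp_baseFun hs0 hα hβ hx,
    mul_inv_cancel_left₀ (baseEig_pos hs0 hα hβ n).ne']

lemma supNorm_nonneg (q : ℝ → ℝ) : 0 ≤ supNorm q :=
  Real.sSup_nonneg fun _ ⟨_, _, hy⟩ => hy ▸ abs_nonneg _

lemma abs_le_supNorm {q : ℝ → ℝ} (hq : BddAbove ((fun x => |q x|) '' Icc (-1 : ℝ) 1)) :
    ∀ᵐ x ∂volI, |q x| ≤ supNorm q :=
  ae_volI_mem.mono fun x hx => le_csSup hq ⟨x, Ioo_subset_Icc_self hx, rfl⟩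

lemma gapRecip_nonneg (hs0 : 0 < s) (hα : s - 1 < α) (hβ : -1 < β) (n : ℕ) :
    0 ≤ gapRecip α β s n := by
  have h := baseEig_strictMono hs0 hα hβ
  rcases n with _ | n
  · have := h zero_lt_one
    exact one_div_nonneg.2 (by linarith)
  · have := h (Nat.lt_succ_self n)
    exact le_max_of_le_left (one_div_nonneg.2 (by simp only [Nat.succ_eq_add_one] at this; linarith))

/-- By monotonicity the distance from λ_n to any other eigenvalue is at least the neighbouring gap
on that side. -/
lemma one_le_gapRecip_mul (hs0 : 0 < s) (hα : s - 1 < α) (hβ : -1 < β) {m n : ℕ} (hmn : m ≠ n) :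
    1 ≤ gapRecip α β s n * |baseEig α β s m - baseEig α β s n| := by
  have h := baseEig_strictMono hs0 hα hβ
  have key : ∀ {a d g : ℝ}, 0 < d → 1 / d ≤ g → d ≤ a → 1 ≤ g * a := fun {a d g} hd hg ha => by
    have h1 := mul_le_mul hg ha hd.le ((one_div_pos.2 hd).le.trans hg)
    rwa [one_div_mul_cancel hd.ne'] at h1
  rcases lt_or_gt_of_ne hmn with hlt | hgt
  · obtain ⟨k, rfl⟩ := Nat.exists_eq_succ_of_ne_zero (Nat.ne_zero_of_lt hlt)
    have h1 := h (Nat.lt_succ_self k)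
    have h2 := h.monotone (Nat.lt_succ_iff.1 hlt)
    refine key (sub_pos.2 h1) (le_max_left _ _) ?_
    rw [abs_sub_comm]
    exact le_trans (by linarith) (le_abs_self _)
  · have h1 := h (Nat.lt_succ_self n)
    have h2 := h.monotone (Nat.succ_le_of_lt hgt)
    refine key (d := baseEig α β s (n + 1) - baseEig α β s n) (sub_pos.2 h1) ?_
      (le_trans (by simp only [Nat.succ_eq_add_one] at h2; linarith) (le_abs_self _))
    rcases n with _ | n
    · exact le_rfl
    · exact le_max_right _ _

lemma fdRhs_congr {q : ℝ → ℝ} {lam : ℕ → ℝ} {u v : ℕ → ℝ → ℝ} (h : ∀ j, u j =ᵐ[volI] v j)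
    (j : ℕ) : fdRhs q lam u j =ᵐ[volI] fdRhs q lam v j := by
  filter_upwards [ae_all_iff.2 h] with x hx
  simp only [fdRhs, hx]

section Scheme

variable {q : ℝ → ℝ} {b : HilbertBasis ℕ ℝ (WL2 α β)} {Q : WL2 α β →L[ℝ] WL2 α β} {n : ℕ}

lemma coeFn_fdRhs (hQ : ∀ w : WL2 α β, Q w =ᵐ[volI] fun x => q x * w x) (Λ : ℕ → ℝ)
    (U : ℕ → WL2 α β) (j : ℕ) :
    (↑(∑ p ∈ Finset.range (j + 1), Λ (j + 1 - p) • U p - Q (U j)) : ℝ → ℝ) =ᵐ[volI]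
      fdRhs q Λ (fun k => U k) j := by
  filter_upwards [coeFn_sub_volI (∑ p ∈ Finset.range (j + 1), Λ (j + 1 - p) • U p) (Q (U j)),
    coeFn_sum_smul (Finset.range (j + 1)) (fun p => Λ (j + 1 - p)) U, hQ (U j)] with x h1 h2 h3
  rw [h1, h2, h3, fdRhs]

lemma WeightBounded.fdRhs {κ : ℝ} (hqm : AEStronglyMeasurable q volI)
    (hq : ∀ᵐ x ∂volI, |q x| ≤ κ) (Λ : ℕ → ℝ) {u : ℕ → ℝ → ℝ} {j : ℕ}
    (h : ∀ i ≤ j, WeightBounded α (u i)) : WeightBounded α (FracJacobi.fdRhs q Λ u j) := by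
  refine ((WeightBounded.sum (Finset.range (j + 1)) fun p hp =>
    (h p (Finset.mem_range_succ_iff.1 hp)).const_mul (Λ (j + 1 - p))).add
    (((h j le_rfl).mul_left hqm hq).const_mul (-1))).congr (Eventually.of_forall fun x => ?_)
  simp only [FracJacobi.fdRhs]
  ring

/-- The FD corrections of `L²_ω` are weight-bounded. -/
lemma AbsFD.weightBounded (hs0 : 0 < s) (hs1 : s < 1) (hα : s - 1 < α) (hβ : -1 < β)
    (hb : ∀ m, b m =ᵐ[volI] baseFun α β m) {κ : ℝ} (hqm : AEStronglyMeasurable q volI)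
    (hq : ∀ᵐ x ∂volI, |q x| ≤ κ) (hQ : ∀ w : WL2 α β, Q w =ᵐ[volI] fun x => q x * w x)
    {Λ : ℕ → ℝ} {U : ℕ → WL2 α β} (h : AbsFD b (baseEig α β s) Q n Λ U) (j : ℕ) :
    WeightBounded α (U j) := by
  induction j using Nat.strong_induction_on with
  | _ j ih =>
    rcases j with _ | j
    · rw [h.u_zero]
      exact (weightBounded_baseFun α β n).congr (hb n).symm
    · refine weightBounded_of_coeff hs0 hs1 hα hβ hb (p := fun _ => baseEig α β s n)
        (baseEig_pos hs0 hα hβ n).le aestronglyMeasurable_const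
        (Eventually.of_forall fun x => (abs_of_pos (baseEig_pos hs0 hα hβ n)).le)
        (F := baseEig α β s n • U (j + 1) +
          (∑ p ∈ Finset.range (j + 1), Λ (j + 1 - p) • U p - Q (U j)))
        (h := ∑ p ∈ Finset.range (j + 1), Λ (j + 1 - p) • U p - Q (U j)) ?_ ?_ fun m => ?_
      · exact (WeightBounded.fdRhs hqm hq Λ fun i hi => ih i (by omega)).congr
          (coeFn_fdRhs hQ Λ U j).symm
      · filter_upwards [coeFn_add_volI (baseEig α β s n • U (j + 1))
          (∑ p ∈ Finset.range (j + 1), Λ (j + 1 - p) • U p - Q (U j)),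
          coeFn_smul_volI (baseEig α β s n) (U (j + 1))] with x h1 h2
        rw [h1, h2]
      · rw [h.step, inner_add_right, inner_smul_right]

/-- The abstract corrections are only L² classes. Being bounded by multiples of (1-x)^α, they have
representatives in the range of T, and these satisfy the pointwise boundary conditions. -/
lemma exists_isFDScheme (hs0 : 0 < s) (hs1 : s < 1) (hα : s - 1 < α) (hβ : -1 < β)
    (hb : ∀ m, b m =ᵐ[volI] baseFun α β m) {κ : ℝ} (hqm : AEStronglyMeasurable q volI)
    (hq : ∀ᵐ x ∂volI, |q x| ≤ κ) (hQ : ∀ w : WL2 α β, Q w =ᵐ[volI] fun x => q x * w x) :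
    ∃ lam u, IsFDScheme α β s q n lam u := by
  obtain ⟨Λ, U, h⟩ := exists_absFD (b := b) (Q := Q) (n := n)
    (fun m hm => one_le_gapRecip_mul hs0 hα hβ hm) (gapRecip_nonneg hs0 hα hβ n)
  have hw := h.weightBounded hs0 hs1 hα hβ hb hqm hq hQ
  set F : ℕ → WL2 α β := fun j => baseEig α β s n • U (j + 1) +
    (∑ p ∈ Finset.range (j + 1), Λ (j + 1 - p) • U p - Q (U j)) with hF
  have hFe : ∀ j, F j =ᵐ[volI] fun x =>
      Λ 0 * U (j + 1) x + fdRhs q Λ (fun k => U k) j x := fun j => by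
    filter_upwards [coeFn_add_volI (baseEig α β s n • U (j + 1))
      (∑ p ∈ Finset.range (j + 1), Λ (j + 1 - p) • U p - Q (U j)),
      coeFn_smul_volI (baseEig α β s n) (U (j + 1)), coeFn_fdRhs hQ Λ U j] with x h1 h2 h3
    rw [hF]
    simp only
    rw [h1, h2, h3, h.lam_zero]
  have hFw : ∀ j, WeightBounded α (F j) := fun j =>
    (((hw (j + 1)).const_mul (Λ 0)).add
      (WeightBounded.fdRhs hqm hq Λ fun i _ => hw i)).congr (hFe j).symm
  -- F j is the full right side, including λ_n U_{j+1}, so T of it is a representative of U_{j+1}.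
  let u : ℕ → ℝ → ℝ := fun j => Nat.casesOn j (baseFun α β n) fun k => solOp α β s (F k)
  have hu : ∀ j, U j =ᵐ[volI] u j := fun j => by
    rcases j with _ | j
    · rw [h.u_zero]
      exact hb n
    · refine ae_eq_solOp_of_coeff hs0 hα hβ hb (hFw j) fun m => ?_
      rw [h.step, hF]
      simp only
      rw [inner_add_right, inner_smul_right]
  refine ⟨Λ, u, h.lam_zero, fun x _ => rfl, fun j => ?_, fun j => ?_⟩
  · refine (hFw j).isSolution hs0 hs1 hα hβ (EventuallyEq.trans ?_ (hFe j).symm)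
    filter_upwards [hu (j + 1), fdRhs_congr (q := q) (lam := Λ) (u := fun k => U k) hu j]
      with x h1 h2
    rw [h1, h2]
  · exact (inner_basis_eq hb (hu (j + 1)) n).symm.trans (h.orth j)

/-- By uniqueness of solutions every scheme satisfies the abstract recursion, so the error bounds
hold for all schemes and not just for the constructed one. -/
lemma IsFDScheme.exists_absFD (hs0 : 0 < s) (hs1 : s < 1) (hα : s - 1 < α) (hβ : -1 < β)
    (hb : ∀ m, b m =ᵐ[volI] baseFun α β m)
    (hQ : ∀ w : WL2 α β, Q w =ᵐ[volI] fun x => q x * w x) {lam : ℕ → ℝ} {u : ℕ → ℝ → ℝ}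
    (h : IsFDScheme α β s q n lam u) :
    ∃ U : ℕ → WL2 α β, (∀ j, U j =ᵐ[volI] u j) ∧ AbsFD b (baseEig α β s) Q n lam U := by
  have h0 : baseFun α β n =ᵐ[volI] u 0 := ae_volI_mem.mono fun x hx => (h.u_zero x hx).symm
  have hmem : ∀ j, MemLp (u j) 2 (weightMeasure (-α) β) := fun j => by
    rcases j with _ | j
    · exact ((weightBounded_baseFun α β n).congr h0).memLp (by linarith) hβ
    · exact (h.step j).memLp
  set U : ℕ → WL2 α β := fun j => (hmem j).toLp (u j)
  have hU : ∀ j, U j =ᵐ[volI] u j := fun j => coeFn_toLp_volI (hmem j)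
  refine ⟨U, hU, h.lam_zero, WL2.ext ((hU 0).trans (h0.symm.trans (hb n).symm)), fun j m => ?_,
    fun j => ?_⟩
  · have hF : (↑(lam 0 • U (j + 1) +
        (∑ p ∈ Finset.range (j + 1), lam (j + 1 - p) • U p - Q (U j))) : ℝ → ℝ) =ᵐ[volI]
        fun x => lam 0 * u (j + 1) x + fdRhs q lam u j x := by
      filter_upwards [coeFn_add_volI (lam 0 • U (j + 1))
        (∑ p ∈ Finset.range (j + 1), lam (j + 1 - p) • U p - Q (U j)),
        coeFn_smul_volI (lam 0) (U (j + 1)), coeFn_fdRhs hQ lam U j, hU (j + 1),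
        fdRhs_congr (q := q) (lam := lam) (u := fun k => U k) hU j] with x h1 h2 h3 h4 h5
      rw [h1, h2, h3, h4, h5]
    have h1 := (h.step j).wInner_baseFun hs0 hs1 hα hβ
      ((Lp.memLp _).ae_eq (ae_weightMeasure_iff.2 hF)) m
    rw [← inner_basis_eq hb hF, ← inner_basis_eq hb (hU (j + 1)), inner_add_right,
      inner_smul_right, h.lam_zero] at h1
    exact h1
  · rw [inner_basis_eq hb (hU (j + 1)), wInner_congr h0 EventuallyEq.rfl]
    exact h.orth j

/-- The sum of the FD series is an eigenpair. -/
lemma AbsFD.exists_isEigenpair (hs0 : 0 < s) (hs1 : s < 1) (hα : s - 1 < α) (hβ : -1 < β)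
    (hb : ∀ m, b m =ᵐ[volI] baseFun α β m) {κ : ℝ} (hκ : 0 ≤ κ)
    (hqm : AEStronglyMeasurable q volI) (hq : ∀ᵐ x ∂volI, |q x| ≤ κ)
    (hQ : ∀ w : WL2 α β, Q w =ᵐ[volI] fun x => q x * w x)
    {Λ : ℕ → ℝ} {U : ℕ → WL2 α β} (h : AbsFD b (baseEig α β s) Q n Λ U)
    (hU : Summable fun j => ‖U j‖) (hΛ : Summable fun j => ‖Λ j‖) :
    ∃ uN, (↑(∑' j, U j) : ℝ → ℝ) =ᵐ[volI] uN ∧ IsEigenpair α β s q (∑' j, Λ j) uN := by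
  set V := ∑' j, U j with hV
  set μ := ∑' j, Λ j
  have hF : (↑(μ • V - Q V) : ℝ → ℝ) =ᵐ[volI] fun x => (μ - q x) * V x := by
    filter_upwards [coeFn_sub_volI (μ • V) (Q V), coeFn_smul_volI μ V, hQ V] with x h1 h2 h3
    rw [h1, h2, h3, sub_mul]
  have h0 : ((0 : WL2 α β) : ℝ → ℝ) =ᵐ[volI] fun _ => 0 :=
    ae_weightMeasure_iff.1 (Lp.coeFn_zero ℝ 2 _)
  have hpm : AEStronglyMeasurable (fun x => μ - q x) volI := aestronglyMeasurable_const.sub hqm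
  have hp : ∀ᵐ x ∂volI, |μ - q x| ≤ |μ| + κ := hq.mono fun x hx =>
    (abs_sub _ _).trans (add_le_add le_rfl hx)
  have hVw : WeightBounded α V := by
    refine weightBounded_of_coeff hs0 hs1 hα hβ hb (by positivity) hpm hp
      (weightBounded_zero.congr h0.symm) ?_ (h.limit_eq hU hΛ)
    filter_upwards [hF, h0] with x h1 h2
    rw [h1, h2, add_zero]
  have hFw : WeightBounded α ↑(μ • V - Q V) := (hVw.mul_left hpm hp).congr hF.symm
  have hVe := ae_eq_solOp_of_coeff hs0 hα hβ hb hFw (h.limit_eq hU hΛ)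
  refine ⟨_, hVe, ?_, hFw.isSolution hs0 hs1 hα hβ ?_⟩
  · rw [← wNorm_congr hVe, ← norm_eq_wNorm]
    intro hn
    -- The corrections are orthogonal to b_n, so the n-th coefficient of the sum is 1 and the sum is
    -- nonzero.
    have h1 : HasSum (fun j => inner ℝ (b n) (U j)) (inner ℝ (b n) V) :=
      hU.of_norm.hasSum.mapL (innerSL ℝ (b n))
    have h2 := h1.unique (hasSum_single 0 fun j hj => by
      obtain ⟨k, rfl⟩ := Nat.exists_eq_succ_of_ne_zero hj
      exact h.orth k)
    have hV0 : V = 0 := norm_eq_zero.1 hn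
    rw [hV0, inner_zero_right, h.u_zero, inner_basis, if_pos rfl] at h2
    exact zero_ne_one h2
  · filter_upwards [hF, hVe] with x h1 h2
    rw [h1, ← h2, sub_mul]

end Scheme

/-- The factor `facRatio m` tends to 0. Keeping r^m as a factor, instead of dividing by it, also
covers r = 0. -/
lemma isLittleO_of_facRatio {f : ℕ → ℝ} {C r : ℝ} (h : ∀ m, |f m| ≤ C * r ^ m * facRatio m) :
    f =o[atTop] fun m => r ^ m := by
  have h1 : f =O[atTop] fun m => facRatio m * r ^ m := by
    refine IsBigO.of_bound |C| (Eventually.of_forall fun m => ?_)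
    rw [Real.norm_eq_abs, Real.norm_eq_abs, ← abs_mul]
    exact ((h m).trans (le_abs_self _)).trans_eq (by congr 1; ring)
  refine h1.trans_isLittleO ?_
  simpa using ((isLittleO_one_iff ℝ).2 tendsto_facRatio).mul_isBigO
    (isBigO_refl (fun m : ℕ => r ^ m) atTop)

end FracJacobi

end

open FracJacobi

theorem theorem3p1 (α β s : ℝ) (hs0 : 0 < s) (hs1 : s < 1) (hα : s - 1 < α) (hβ : -1 < β)
    (q : ℝ → ℝ) (hq : AEStronglyMeasurable q (volume.restrict (Ioo (-1 : ℝ) 1)))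
    (hqb : BddAbove ((fun x => |q x|) '' Icc (-1 : ℝ) 1))
    (n : ℕ) (hr : FracJacobi.ratio α β s q n < 1) :
    -- the starting pair is a normalized solution of the base problem
    (FracJacobi.IsEigenpair α β s (fun _ => 0) (FracJacobi.baseEig α β s n)
        (FracJacobi.baseFun α β n) ∧
      FracJacobi.wNorm α β (FracJacobi.baseFun α β n) = 1) ∧
    -- the recursive problems are solvable
    (∃ (lam : ℕ → ℝ) (u : ℕ → ℝ → ℝ), FracJacobi.IsFDScheme α β s q n lam u) ∧
    -- every solution of the recursive problems converges to an eigenpair, with the error bounds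
    (∀ (lam : ℕ → ℝ) (u : ℕ → ℝ → ℝ), FracJacobi.IsFDScheme α β s q n lam u →
      ∃ (lamN : ℝ) (uN : ℝ → ℝ),
        FracJacobi.IsEigenpair α β s q lamN uN ∧
        HasSum lam lamN ∧
        Tendsto (fun m => FracJacobi.wNorm α β (fun x => uN x - FracJacobi.uApprox u m x))
          atTop (𝓝 0) ∧
        (fun m => lamN - FracJacobi.lamApprox lam m)
          =o[atTop] (fun m : ℕ => FracJacobi.ratio α β s q n ^ m) ∧
        (fun m => FracJacobi.wNorm α β (fun x => uN x - FracJacobi.uApprox u m x))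
          =o[atTop] (fun m : ℕ => FracJacobi.ratio α β s q n ^ m) ∧
        (∀ m : ℕ,
          |lamN - FracJacobi.lamApprox lam m| ≤
            2 * FracJacobi.supNorm q *
              (FracJacobi.ratio α β s q n ^ m / (1 - FracJacobi.ratio α β s q n)) *
              (((2 * m - 1)‼ : ℝ) / ((2 * m + 2)‼ : ℝ))) ∧
        (∀ m : ℕ, 1 ≤ m →
          2 * FracJacobi.supNorm q *
              (FracJacobi.ratio α β s q n ^ m / (1 - FracJacobi.ratio α β s q n)) *
              (((2 * m - 1)‼ : ℝ) / ((2 * m + 2)‼ : ℝ)) ≤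
            FracJacobi.supNorm q *
              (FracJacobi.ratio α β s q n ^ m / (1 - FracJacobi.ratio α β s q n)) *
              (1 / ((m + 1) * √(Real.pi * m)))) ∧
        (∀ m : ℕ,
          FracJacobi.wNorm α β (fun x => uN x - FracJacobi.uApprox u m x) ≤
            2 * (FracJacobi.ratio α β s q n ^ (m + 1) / (1 - FracJacobi.ratio α β s q n)) *
              (((2 * m + 1)‼ : ℝ) / ((2 * m + 4)‼ : ℝ)) ∧
          2 * (FracJacobi.ratio α β s q n ^ (m + 1) / (1 - FracJacobi.ratio α β s q n)) *
              (((2 * m + 1)‼ : ℝ) / ((2 * m + 4)‼ : ℝ)) ≤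
            FracJacobi.ratio α β s q n ^ (m + 1) / (1 - FracJacobi.ratio α β s q n) *
              (1 / ((m + 2) * √(Real.pi * (m + 1)))))) := by
  have hα1 : -1 < α := by linarith
  obtain ⟨b, hb⟩ := exists_hilbertBasis_baseFun hs0 hα hβ
  have hqn := abs_le_supNorm hqb
  have hκ := supNorm_nonneg q
  have hM := gapRecip_nonneg hs0 hα hβ n
  obtain ⟨Q, hQ, hQn⟩ := exists_mulOp (α := α) (β := β) hq hqn
  refine ⟨⟨isEigenpair_baseFun hs0 hs1 hα hβ n, wNorm_baseFun hα1 hβ n⟩,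
    exists_isFDScheme hs0 hs1 hα hβ hb hq hqn hQ, fun lam u h => ?_⟩
  obtain ⟨U, hU, hA⟩ := h.exists_absFD hs0 hs1 hα hβ hb hQ
  have hgap : ∀ m, m ≠ n → 1 ≤ gapRecip α β s n * |baseEig α β s m - baseEig α β s n| :=
    fun m hm => one_le_gapRecip_mul hs0 hα hβ hm
  obtain ⟨hsU, hsΛ⟩ := hA.summable hκ hQn hgap hM hr
  obtain ⟨uN, huN, hpair⟩ := hA.exists_isEigenpair hs0 hs1 hα hβ hb hκ hq hqn hQ hsU hsΛ
  have hsumU : HasSum U (∑' j, U j) := hsU.of_norm.hasSum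
  have hsumΛ : HasSum lam (∑' j, lam j) := hsΛ.of_norm.hasSum
  have hr0 : 0 ≤ ratio α β s q n := mul_nonneg (mul_nonneg zero_le_four hκ) hM
  have hr1 : 0 < 1 - ratio α β s q n := sub_pos.2 hr
  have hnorm : ∀ m, wNorm α β (fun x => uN x - uApprox u m x) =
      ‖∑' j, U j - ∑ j ∈ Finset.range (m + 1), U j‖ := fun m => by
    rw [norm_eq_wNorm]
    refine wNorm_congr ?_
    filter_upwards [huN, ae_all_iff.2 hU, coeFn_sub_volI (∑' j, U j)
      (∑ j ∈ Finset.range (m + 1), U j), ae_weightMeasure_iff.1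
      (Lp.coeFn_fun_finsetSum (Finset.range (m + 1)) U)] with x h1 h2 h3 h4
    rw [h3, h1, h4, uApprox]
    simp only [h2]
  have hlam : ∀ m, |∑' j, lam j - lamApprox lam m| ≤ 2 * supNorm q *
      (ratio α β s q n ^ m / (1 - ratio α β s q n)) * facRatio m :=
    hA.abs_sub_le hκ hQn hgap hM hr hsumΛ
  have hu : ∀ m, wNorm α β (fun x => uN x - uApprox u m x) ≤
      2 * (ratio α β s q n ^ (m + 1) / (1 - ratio α β s q n)) * facRatio (m + 1) := fun m => by
    rw [hnorm]
    exact hA.norm_sub_le hκ hQn hgap hM hr hsumU m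
  -- The bound carries r^{m+1} and `facRatio (m + 1)`; one factor r goes into the constant, and
  -- monotonicity replaces m + 1 by m in the second factor.
  have hou : (fun m => wNorm α β (fun x => uN x - uApprox u m x)) =o[atTop]
      fun m : ℕ => ratio α β s q n ^ m := by
    refine isLittleO_of_facRatio (C := 2 * ratio α β s q n / (1 - ratio α β s q n)) fun m => ?_
    rw [abs_of_nonneg (show 0 ≤ wNorm α β (fun x => uN x - uApprox u m x) from Real.sqrt_nonneg _)]
    refine (hu m).trans ?_
    have h1 := facRatio_antitone (Nat.le_succ m)
    calc _ ≤ 2 * (ratio α β s q n ^ (m + 1) / (1 - ratio α β s q n)) * facRatio m := by gcongr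
      _ = _ := by ring
  refine ⟨∑' j, lam j, uN, hpair, hsumΛ, ?_, ?_, hou, hlam, fun m hm => ?_, fun m => ⟨hu m, ?_⟩⟩
  · exact hou.isBigO.trans_tendsto (tendsto_pow_atTop_nhds_zero_of_lt_one hr0 hr)
  · refine isLittleO_of_facRatio (C := 2 * supNorm q / (1 - ratio α β s q n)) fun m => ?_
    exact (hlam m).trans_eq (by ring)
  · have h1 := two_mul_facRatio_le hm
    calc _ = supNorm q * (ratio α β s q n ^ m / (1 - ratio α β s q n)) * (2 * facRatio m) := by
          rw [facRatio]; ring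
      _ ≤ _ := by gcongr
  · have h1 := two_mul_facRatio_le (Nat.le_add_left 1 m)
    rw [Nat.cast_add_one, add_assoc, one_add_one_eq_two] at h1
    calc _ = ratio α β s q n ^ (m + 1) / (1 - ratio α β s q n) * (2 * facRatio (m + 1)) := by
          rw [facRatio, show 2 * (m + 1) - 1 = 2 * m + 1 by omega,
            show 2 * (m + 1) + 2 = 2 * m + 4 by ring]
          ring
      _ ≤ _ := by gcongr
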